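/- **Conventions.** For a C*-algebra $A$, $\mathfrak{sa}(A)$ is its self-adjoint part, $uA$ the smallest unital C*-algebra containing $A$, and $\mathscr S(A)$ its state space. A *Lipschitz triple* $(A,L,M)$ consists of a C*-algebra $A$, a seminorm $L$ on a dense subspace of $\mathfrak{sa}(uA)$ with $\{L=0\}=\mathbb R1$ (put $L=\infty$ outside its domain), and an Abelian C*-subalgebra $M\subseteq A$ (the topography) containing an approximate unit of $A$. $M^\sigma$ is the Gel'fand spectrum of $M$. For compact $K\subseteq M^\sigma$ let $1_K\in M^{**}\subseteq A^{**}$ be its indicator function, and $$\mathscr S[A|K]=\{\varphi\in\mathscr S(A):\varphi(1_K)=1\},\qquad \mathfrak{Loc}(A|K)=\{a\in\mathfrak{sa}(A): 1_Ka1_K=a,\ L(a)<\infty\},$$ $\mathfrak{Loc}_\star=\bigcup_K\mathfrak{Loc}(A|K)$. Put $\mathsf{mk}_L(\varphi,\psi)=\sup\{|\varphi(a)-\psi(a)|:a\in\mathfrak{sa}(A),L(a)\le1\}$, and let $\mathsf{mk}^\sigma_L$ be the same metric for the restriction of $L$ to $M$. A set $S\subseteq\mathscr S(A)$ is *tame*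 if $\lim_K\sup\{|\varphi(a-1_Ka1_K)|:\varphi\in S,a\in\mathfrak{sa}(A),L(a)\le1\}=0$, the limit being along the compact subsets of $M^\sigma$. The triple is a *quantum locally compact metric space* if $\mathsf{mk}_L$ metrizes the weak* topology on every tame set. It is a *proper quantum metric space* if moreover $A$ is separable; $L(\frac{ab+ba}2)$ and $L(\frac{ab-ba}{2i})$ are at most $\|a\|L(b)+L(a)\|b\|$ for all $a,b\in\mathfrak{sa}(A)$; $L$ is lower semi-continuous on $\mathfrak{sa}(A)$; $\mathfrak{Loc}_\star$ is dense in $\{a\in\mathfrak{sa}(A):L(a)<\infty\}$ and $\mathfrak{Loc}_\star\cap M$ is dense in $\mathfrak{sa}(M)$; and $(M^\sigma,\mathsf{mk}^\sigma_L)$ is a proper metric space. A *pointed* one $\mathbb A=(A,L,M,\mu)$ has in addition a base point $\mu\in M^\sigma$; write $B_{\mathbb A}(r)$ for the closed $\mathsf{mk}^\sigma_L$-ball of radius $r$ around $\mu$, $\mathscr S[\mathbb A|r]=\mathscr S[A|B_{\mathbb A}(r)]$ and $\mathfrak{Loc}(\mathbb A|r)=\mathfrak{Loc}(A|B_{\mathbb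 A}(r))$. A *passage* $\tau=(D,L_D,M_D,\pi_1,\pi_2)$ from $\mathbb A_1=(A_1,L_1,M_1,\mu_1)$ to $\mathbb A_2=(A_2,L_2,M_2,\mu_2)$ is a quantum locally compact metric space $(D,L_D,M_D)$ with $L_D$ lower semi-continuous and surjective *-morphisms $\pi_j:D\to A_j$ with $\pi_j(M_D)\subseteq M_j$ which map some approximate unit of $D$ in $M_D$ to an approximate unit of $A_j$. For $r,\varepsilon>0$ and compact $K\subseteq M_D^\sigma$, the pair $(\varepsilon,K)$ is *$r$-admissible* if for $(i,j)=(1,2)$ and for $(i,j)=(2,1)$: * $\pi_i^*(\mathscr S[\mathbb A_i|r])\subseteq\mathscr S[D|K]$, and each $\varphi\in\mathscr S[D|K]$ is within $\mathsf{mk}_{L_D}$-distance $\varepsilon$ of $\psi\circ\pi_i$ for some $\psi\in\mathscr S[\mathbb A_i|r+4\varepsilon]$; * for each $a\in\mathfrak{Loc}(\mathbb A_i|r)$ there is $d\in\mathfrak{Loc}(D|K)$ with $\pi_i(d)=a$, $L_D(d)\le L_i(a)$ and $\pi_j(d)\in\mathfrak{Loc}(\mathbb A_j|r+4\varepsilon)$,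 and if $a\in M_i$ then $d$ can be chosen with moreover $\pi_j(d)\in M_j$; * $L_j(\pi_j(d))\le L_D(d)$ for all $d\in\mathfrak{Loc}(D|K)$; and moreover $\mathsf{mk}^\sigma_{L_D}(\mu_1\circ\pi_1,\mu_2\circ\pi_2)\le\varepsilon$, and $L_D(\frac{dd'+d'd}2)$ and $L_D(\frac{dd'-d'd}{2i})$ are at most $L_D(d)\|d'\|+L_D(d')\|d\|$ for all $d,d'\in\mathfrak{Loc}(D|K)$. A number $\varepsilon>0$ is *$r$-admissible* if there are compact sets $K_t\subseteq M_D^\sigma$ ($0<t\le r$), increasing with $t$, such that $(\varepsilon,K_t)$ is $t$-admissible for every $t\in(0,r]$. The passage is an *$r$-tunnel* if some $\varepsilon>0$ is $r$-admissible; its *$r$-extent* is the infimum of all $r$-admissible $\varepsilon$. **Proposition.** Let $\mathbb A_1=(A_1,L_1,M_1,\mu_1)$ and $\mathbb A_2=(A_2,L_2,M_2,\mu_2)$ be two pointed proper quantum metric spaces and $r>0$. 1. If $r\ge\max\{\operatorname{diam}(M_1^\sigma,\mathsf{mk}^\sigma_{L_1}),\operatorname{diam}(M_2^\sigma,\mathsf{mk}^\sigma_{L_2})\}$,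 then there is an $r$-tunnel from $\mathbb A_1$ to $\mathbb A_2$. 2. Let $r<\min\{\operatorname{diam}(M_1^\sigma,\mathsf{mk}^\sigma_{L_1}),\operatorname{diam}(M_2^\sigma,\mathsf{mk}^\sigma_{L_2})\}$, and assume that it does not happen that $B_{\mathbb A_i}(r)=M_i^\sigma$ for one $i\in\{1,2\}$ while $M_j^\sigma$ is not compact for the other index $j$. Then there is an $r$-tunnel $\tau$ from $\mathbb A_1$ to $\mathbb A_2$. If moreover $B_{\mathbb A_i}(r)\ne M_i^\sigma$ for both $i$, then $\tau$ can be chosen with $r$-extent at most $$D=\max\{\|a\|_{A_j}: j\in\{1,2\},\ a\in\mathfrak{Loc}(\mathbb A_j|r),\ L_j(a)\le1\},$$ and this maximum exists (so it is finite). -/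

import Mathlib

open Filter Topology Set
open scoped ENNReal ComplexOrder

universe u

noncomputable section

namespace QMS

/-! ### The Monge-Kantorovich metric -/

/-- The Monge-Kantorovich extended metric of `L`, evaluated at two functionals `φ` and `ψ`:
the supremum of `|φ b - ψ b|` over all `b` with `L b ≤ 1`. -/
def mkDist {B : Type*} (L : B → ℝ≥0∞) (φ ψ : B → ℂ) : ℝ≥0∞ :=
  ⨆ (b : B) (_ : L b ≤ 1), edist (φ b) (ψ b)

/-- The Monge-Kantorovich metric, as an extended pseudometric on a family `X` of functionals. -/
abbrev mkPseudoEMetric {B X : Type*} (L : B → ℝ≥0∞) (ev : X → B → ℂ) : PseudoEMetricSpace X where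
  edist x y := mkDist L (ev x) (ev y)
  edist_self x := by simp [mkDist]
  edist_comm x y := by simp only [mkDist, edist_comm]
  edist_triangle x y z := by
    refine iSup₂_le fun b hb => (edist_triangle _ (ev y b) _).trans ?_
    exact add_le_add (le_iSup₂ (f := fun b (_ : L b ≤ 1) => edist (ev x b) (ev y b)) b hb)
      (le_iSup₂ (f := fun b (_ : L b ≤ 1) => edist (ev y b) (ev z b)) b hb)

/-- The topology of the Monge-Kantorovich metric on a family `X` of functionals. -/
abbrev mkTopology {B X : Type*} (L : B → ℝ≥0∞) (ev : X → B → ℂ) : TopologicalSpace X :=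
  (mkPseudoEMetric L ev).toUniformSpace.toTopologicalSpace

section Algebra

variable {A : Type u} [NonUnitalCStarAlgebra A]

/-- The state space of a C*-algebra: positive linear functionals of norm one. -/
def states (A : Type u) [NonUnitalCStarAlgebra A] : Set (WeakDual ℂ A) :=
  {φ | (∀ a, 0 ≤ φ (star a * a)) ∧ ‖WeakDual.toStrongDual φ‖ = 1}

/-- The Jordan product of two elements. -/
def jordan (a b : A) : A := (1 / 2 : ℂ) • (a * b + b * a)

/-- The Lie product of two elements. -/
def lie (a b : A) : A := (1 / (2 * Complex.I) : ℂ) • (a * b - b * a)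

/-- The elements of `A` which are real multiples of the unit of the smallest unital C*-algebra
containing `A`: only `0` if `A` has no unit, and the real multiples of the unit otherwise. -/
def realScalars (A : Type u) [NonUnitalCStarAlgebra A] : Set A :=
  {a | a = 0 ∨ ∃ (e : A) (t : ℝ), (∀ b, e * b = b ∧ b * e = b) ∧ a = (t : ℂ) • e}

/-- Lipschitz pairs `(A, L)`. The value `L a = ⊤` means that `a` is not in the domain of `L`.

If `A` has no unit, then the seminorm is usually given on the self-adjoint part of the
unitization `A ⊕ ℂ1`; as its domain contains `ℝ1` and it vanishes there, it is determined by
`L (a + t1) = L a`, so that only its restriction to `A` has to be recorded; its domain is dense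
in the self-adjoint part of `A ⊕ ℂ1` exactly when the domain of the restriction is dense in the
self-adjoint part of `A`, and its kernel is `ℝ1` exactly when the restriction has kernel `0`. -/
structure IsLipschitzPair (L : A → ℝ≥0∞) : Prop where
  isSelfAdjoint_of_lt_top : ∀ a, L a < ⊤ → IsSelfAdjoint a
  add_le : ∀ a b, L (a + b) ≤ L a + L b
  smul_eq : ∀ (t : ℝ) (a : A), L ((t : ℂ) • a) = ENNReal.ofReal |t| * L a
  dense_dom : ∀ a, IsSelfAdjoint a → a ∈ closure {b | L b < ⊤}
  eq_zero_iff : ∀ a, L a = 0 ↔ a ∈ realScalars A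

/-- Topographies: Abelian C*-subalgebras which contain an approximate unit. -/
structure IsTopography (M : NonUnitalStarSubalgebra ℂ A) : Prop where
  isClosed : IsClosed (M : Set A)
  comm : ∀ a ∈ M, ∀ b ∈ M, a * b = b * a
  approx : ∃ l : Filter A, l.IsApproximateUnit ∧ (M : Set A) ∈ l

/-- The Gel'fand spectrum of the topography, with the weak* topology. -/
abbrev Spectrum (M : NonUnitalStarSubalgebra ℂ A) : Type u :=
  WeakDual.characterSpace ℂ M

/-! ### Localization

For a compact subset `K` of the spectrum of `M`, the indicator function of `K` is a projection
`1_K` in `M** ⊆ A**`. It is the infimum, and the strong limit, of the decreasing net of all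
cut-off functions of `K`, which are the `m ∈ M` with `0 ≤ m ≤ 1` on the spectrum and `m = 1` on
`K`. Hence `φ(1_K)` and `φ(1_K a 1_K)` are the limits of `φ(m)` and of `φ(m a m)` along this net,
for each state `φ`. -/

/-- The positive elements of `A`. -/
def IsPos (a : A) : Prop := ∃ b : A, a = star b * b

/-- The cut-off functions of `K` in the topography `M`. -/
def cutoffs (M : NonUnitalStarSubalgebra ℂ A) (K : Set (Spectrum M)) : Set A :=
  {m | IsPos m ∧ ‖m‖ ≤ 1 ∧ ∃ h : m ∈ M, ∀ x ∈ K, x ⟨m, h⟩ = 1}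

/-- The section filter of the downward directed set of the cut-off functions of `K`. -/
def cutoffFilter (M : NonUnitalStarSubalgebra ℂ A) (K : Set (Spectrum M)) : Filter A :=
  ⨅ u ∈ cutoffs M K, 𝓟 {m | m ∈ cutoffs M K ∧ IsPos (u - m)}

/-- `φ(1_K) = z`. -/
def IndicatorValue (M : NonUnitalStarSubalgebra ℂ A) (K : Set (Spectrum M))
    (φ : WeakDual ℂ A) (z : ℂ) : Prop :=
  Tendsto (fun m => φ m) (cutoffFilter M K) (𝓝 z)

/-- `φ(1_K a 1_K) = z`. -/
def CornerValue (M : NonUnitalStarSubalgebra ℂ A) (K : Set (Spectrum M))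
    (φ : WeakDual ℂ A) (a : A) (z : ℂ) : Prop :=
  Tendsto (fun m => φ (m * a * m)) (cutoffFilter M K) (𝓝 z)

/-- The states `φ` of `A` with `φ(1_K) = 1`. -/
def localStates (M : NonUnitalStarSubalgebra ℂ A) (K : Set (Spectrum M)) :
    Set (WeakDual ℂ A) :=
  {φ | φ ∈ states A ∧ IndicatorValue M K φ 1}

/-- The self-adjoint `a` in `A` with `a = 1_K a 1_K` (an identity in `A**`, tested on the states)
and with `L a < ∞`. -/
def Loc (L : A → ℝ≥0∞) (M : NonUnitalStarSubalgebra ℂ A) (K : Set (Spectrum M)) : Set A :=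
  {a | IsSelfAdjoint a ∧ (∀ φ ∈ states A, CornerValue M K φ a (φ a)) ∧ L a < ⊤}

/-- The locally supported Lipschitz elements. -/
def LocStar (L : A → ℝ≥0∞) (M : NonUnitalStarSubalgebra ℂ A) : Set A :=
  {a | ∃ K : Set (Spectrum M), IsCompact K ∧ a ∈ Loc L M K}

/-- Tame sets of states: the supremum of `|φ(a - 1_K a 1_K)|` over `φ ∈ S` and `L a ≤ 1` tends
to `0` along the compact subsets `K` of the spectrum of the topography. -/
def IsTame (L : A → ℝ≥0∞) (M : NonUnitalStarSubalgebra ℂ A) (S : Set (WeakDual ℂ A)) : Prop :=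
  ∀ ε : ℝ, 0 < ε → ∃ K₀ : Set (Spectrum M), IsCompact K₀ ∧
    ∀ K : Set (Spectrum M), IsCompact K → K₀ ⊆ K →
      ∀ φ ∈ S, ∀ a : A, L a ≤ 1 → ∃ z : ℂ, CornerValue M K φ a z ∧ ‖φ a - z‖ ≤ ε

/-- Quantum locally compact metric spaces: Lipschitz triples `(A, L, M)` such that the
Monge-Kantorovich metric metrizes the weak* topology on each tame set of states. -/
structure IsQuantumLCMS (L : A → ℝ≥0∞) (M : NonUnitalStarSubalgebra ℂ A) : Prop where
  isLipschitzPair : IsLipschitzPair L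
  isTopography : IsTopography M
  metrizes : ∀ S : Set (WeakDual ℂ A), S ⊆ states A → IsTame L M S →
    mkTopology L (fun (φ : S) (a : A) => (φ : WeakDual ℂ A) a) =
      (instTopologicalSpaceSubtype : TopologicalSpace S)

/-- The Monge-Kantorovich metric of the restriction of `L` to the topography `M`, on the
spectrum of `M`. -/
def spectrumDist (L : A → ℝ≥0∞) (M : NonUnitalStarSubalgebra ℂ A) (x y : Spectrum M) : ℝ≥0∞ :=
  mkDist (fun m : M => L (m : A)) (fun m => x m) (fun m => y m)

/-- The closed balls of the spectrum of the topography. -/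
def spectrumBall (L : A → ℝ≥0∞) (M : NonUnitalStarSubalgebra ℂ A) (x : Spectrum M) (r : ℝ) :
    Set (Spectrum M) :=
  {y | spectrumDist L M y x ≤ ENNReal.ofReal r}

/-- Lower semi-continuity for the norm on the self-adjoint part. -/
def IsLSC (L : A → ℝ≥0∞) : Prop := LowerSemicontinuousOn L {a | IsSelfAdjoint a}

/-- Proper quantum metric spaces. -/
structure IsProperQMS (L : A → ℝ≥0∞) (M : NonUnitalStarSubalgebra ℂ A) : Prop
    extends IsQuantumLCMS L M where
  separable : TopologicalSpace.SeparableSpace A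
  leibniz_jordan : ∀ a b : A, IsSelfAdjoint a → IsSelfAdjoint b →
    L (jordan a b) ≤ ‖a‖ₑ * L b + L a * ‖b‖ₑ
  leibniz_lie : ∀ a b : A, IsSelfAdjoint a → IsSelfAdjoint b →
    L (lie a b) ≤ ‖a‖ₑ * L b + L a * ‖b‖ₑ
  isLSC : IsLSC L
  locStar_dense : ∀ a, L a < ⊤ → a ∈ closure (LocStar L M)
  locStar_dense_topography : ∀ m ∈ M, IsSelfAdjoint m → m ∈ closure (LocStar L M ∩ M)
  spectrumDist_lt_top : ∀ x y : Spectrum M, spectrumDist L M x y < ⊤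
  isCompact_ball : ∀ (x : Spectrum M) (r : ℝ),
    @IsCompact _ (mkTopology (fun m : M => L (m : A)) fun (y : Spectrum M) m => y m)
      (spectrumBall L M x r)

/-- Topographic morphisms: *-epimorphisms which map the topography into the topography and some
approximate unit in the topography to an approximate unit. -/
structure IsTopographicMorphism {B : Type u} [NonUnitalCStarAlgebra B]
    (M : NonUnitalStarSubalgebra ℂ A) (N : NonUnitalStarSubalgebra ℂ B) (π : A →⋆ₙₐ[ℂ] B) :
    Prop where
  surjective : Function.Surjective π
  map_mem : ∀ m ∈ M, π m ∈ N
  map_approx : ∃ l : Filter A, l.IsApproximateUnit ∧ (M : Set A) ∈ l ∧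
    (l.map π).IsApproximateUnit

end Algebra

/-! ### Pointed proper quantum metric spaces, passages and tunnels -/

/-- Pointed proper quantum metric spaces `(A, L, M, μ)`. -/
structure PointedProperQMS : Type (u + 1) where
  Carrier : Type u
  [cstar : NonUnitalCStarAlgebra Carrier]
  L : Carrier → ℝ≥0∞
  M : NonUnitalStarSubalgebra ℂ Carrier
  isProper : IsProperQMS L M
  μ : Spectrum M

attribute [instance] PointedProperQMS.cstar

namespace PointedProperQMS

variable (𝔸 : PointedProperQMS.{u})

/-- The closed ball of the spectrum of the topography around the base point. -/
def ball (r : ℝ) : Set (Spectrum 𝔸.M) := spectrumBall 𝔸.L 𝔸.M 𝔸.μ r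

/-- The diameter of the spectrum of the topography. -/
def diam : ℝ≥0∞ := ⨆ (x : Spectrum 𝔸.M) (y : Spectrum 𝔸.M), spectrumDist 𝔸.L 𝔸.M x y

/-- The Lipschitz elements supported on the ball of radius `r` around the base point. -/
def LocBall (r : ℝ) : Set 𝔸.Carrier := Loc 𝔸.L 𝔸.M (𝔸.ball r)

/-- The states supported on the ball of radius `r` around the base point. -/
def ballStates (r : ℝ) : Set (WeakDual ℂ 𝔸.Carrier) := localStates 𝔸.M (𝔸.ball r)

end PointedProperQMS

/-- Passages from `𝔸` to `𝔹`. -/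
structure Passage (𝔸 𝔹 : PointedProperQMS.{u}) : Type (u + 1) where
  D : Type u
  [cstar : NonUnitalCStarAlgebra D]
  L : D → ℝ≥0∞
  M : NonUnitalStarSubalgebra ℂ D
  isQuantumLCMS : IsQuantumLCMS L M
  isLSC : IsLSC L
  π : D →⋆ₙₐ[ℂ] 𝔸.Carrier
  ρ : D →⋆ₙₐ[ℂ] 𝔹.Carrier
  topographic_π : IsTopographicMorphism M 𝔸.M π
  topographic_ρ : IsTopographicMorphism M 𝔹.M ρ

attribute [instance] Passage.cstar

namespace Passage

variable {𝔸 𝔹 : PointedProperQMS.{u}}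

/-- The inverse passage. -/
def inv (τ : Passage 𝔸 𝔹) : Passage 𝔹 𝔸 where
  D := τ.D
  L := τ.L
  M := τ.M
  isQuantumLCMS := τ.isQuantumLCMS
  isLSC := τ.isLSC
  π := τ.ρ
  ρ := τ.π
  topographic_π := τ.topographic_ρ
  topographic_ρ := τ.topographic_π

/-- The lift set of `a` associated with `(l, r, ε, K)`. -/
def liftSet (τ : Passage 𝔸 𝔹) (a : 𝔸.Carrier) (l : ℝ≥0∞) (r ε : ℝ) (K : Set (Spectrum τ.M)) :
    Set τ.D :=
  {d | d ∈ Loc τ.L τ.M K ∧ τ.π d = a ∧ τ.ρ d ∈ 𝔹.LocBall (r + 4 * ε) ∧ τ.L d ≤ l}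

/-- The target set of `a` associated with `(l, r, ε, K)`. -/
def targetSet (τ : Passage 𝔸 𝔹) (a : 𝔸.Carrier) (l : ℝ≥0∞) (r ε : ℝ) (K : Set (Spectrum τ.M)) :
    Set 𝔹.Carrier :=
  τ.ρ '' τ.liftSet a l r ε K

/-- The pair `(ε, K)` is `r`-left admissible. -/
structure IsLeftAdmissible (τ : Passage 𝔸 𝔹) (r ε : ℝ) (K : Set (Spectrum τ.M)) : Prop where
  states_subset : ∀ ψ ∈ 𝔸.ballStates r, ∃ φ ∈ localStates τ.M K, ∀ d, φ d = ψ (τ.π d)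
  states_near : ∀ φ ∈ localStates τ.M K, ∃ ψ ∈ 𝔸.ballStates (r + 4 * ε),
    mkDist τ.L (fun d => φ d) (fun d => ψ (τ.π d)) ≤ ENNReal.ofReal ε
  target_nonempty : ∀ a ∈ 𝔸.LocBall r, (τ.targetSet a (𝔸.L a) r ε K).Nonempty
  target_topography : ∀ a ∈ 𝔸.LocBall r, a ∈ 𝔸.M →
    (τ.targetSet a (𝔸.L a) r ε K ∩ (𝔹.M : Set 𝔹.Carrier)).Nonempty
  lip_le : ∀ d ∈ Loc τ.L τ.M K, 𝔹.L (τ.ρ d) ≤ τ.L d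

/-- The pair `(ε, K)` is `r`-admissible. -/
structure IsAdmissiblePair (τ : Passage 𝔸 𝔹) (r ε : ℝ) (K : Set (Spectrum τ.M)) : Prop where
  left : τ.IsLeftAdmissible r ε K
  right : τ.inv.IsLeftAdmissible r ε K
  basePoint : mkDist (fun m : τ.M => τ.L (m : τ.D))
    (fun m => 𝔸.μ ⟨τ.π m, τ.topographic_π.map_mem m m.2⟩)
    (fun m => 𝔹.μ ⟨τ.ρ m, τ.topographic_ρ.map_mem m m.2⟩) ≤ ENNReal.ofReal ε
  leibniz_jordan : ∀ d ∈ Loc τ.L τ.M K, ∀ d' ∈ Loc τ.L τ.M K,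
    τ.L (jordan d d') ≤ τ.L d * ‖d'‖ₑ + τ.L d' * ‖d‖ₑ
  leibniz_lie : ∀ d ∈ Loc τ.L τ.M K, ∀ d' ∈ Loc τ.L τ.M K,
    τ.L (lie d d') ≤ τ.L d * ‖d'‖ₑ + τ.L d' * ‖d‖ₑ

/-- The set of the `r`-admissible numbers of a passage. -/
def Adm (τ : Passage 𝔸 𝔹) (r : ℝ) : Set ℝ :=
  {ε | 0 < ε ∧ ∃ K : ℝ → Set (Spectrum τ.M), (∀ t ∈ Ioc 0 r, IsCompact (K t)) ∧
    (∀ t ∈ Ioc 0 r, ∀ t' ∈ Ioc 0 r, t ≤ t' → K t ⊆ K t') ∧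
    ∀ t ∈ Ioc 0 r, τ.IsAdmissiblePair t ε (K t)}

/-- A passage is an `r`-tunnel when it has an `r`-admissible number. -/
def IsTunnel (τ : Passage 𝔸 𝔹) (r : ℝ) : Prop := (τ.Adm r).Nonempty

/-- The `r`-extent of an `r`-tunnel. -/
def extent (τ : Passage 𝔸 𝔹) (r : ℝ) : ℝ := sInf (τ.Adm r)

end Passage

/-- The norms of the elements `a`, in either space, which are supported on the ball of radius `r`
around the base point and satisfy `L a ≤ 1`. -/
def lipNorms (𝔸 𝔹 : PointedProperQMS.{u}) (r : ℝ) : Set ℝ :=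
  (fun a => ‖a‖) '' {a | a ∈ 𝔸.LocBall r ∧ 𝔸.L a ≤ 1} ∪
    (fun b => ‖b‖) '' {b | b ∈ 𝔹.LocBall r ∧ 𝔹.L b ≤ 1}

end QMS

end

/-! The tunnel is the direct sum of the two algebras with the coordinate projections, the direct sum
of the topographies, and the seminorm `prodL`, the maximum of L₁(a), L₂(b) and gap(a, b)/C. Here
gap(a, b) is the largest |φ(a) − ψ(b)| over all pairs of states φ of A₁ and ψ of A₂.

Taking the gap over all pairs of states makes this a good seminorm. The gap obeys the Leibniz
inequalities (`gap_jordan_le`, `gap_lie_le`), since every state of A₁ takes at a′ a value within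
gap(a′, b′) of the fixed scalar ψ(b′). It is lower semi-continuous as a supremum of continuous
functions. It also puts each element of the unit ball within 2C of one scalar on all states, which
is why the Monge-Kantorovich metric metrizes the weak* topology (`IsQuantumLCMS.prod`). One
compresses with a compactly supported h from the topography, φ(h) being close to 1, at an error of
order C√(1 − φ(h)). What remains splits into multiples of locally supported states of the two
factors, where the metrization hypotheses of the factors apply.

Local states of the sum are convex combinations of local states of the factors, whose values on the
unit ball differ by at most C. So the conditions on states and on base points hold with ε = C, and
admissibility reduces to lifts (`isAdmissiblePair_prodPassage`): each local a needs a counterpart b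
in the other topography with L₂(b) ≤ L₁(a) and gap(a, b) ≤ C·L₁(a). There are two choices. If both
spectra are compact, the topographies contain units, C bounds the finite Monge-Kantorovich
diameters, and b = φ(a)·1 for some state φ. If neither ball is the whole spectrum, b = 0 and C = D,
since gap(a, 0) ≤ ‖a‖ ≤ D·L₁(a). When one ball is the whole spectrum, the assumption of the second
statement makes both spectra compact.

The maximum D exists because the elements with L ≤ 1 supported in a compact K which is not the whole
spectrum form a norm compact set (`IsQuantumLCMS.isCompact_locUnit`). This is an Arzelà-Ascoli
argument in which a point outside K supplies the bound on the norm.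

Admissible numbers are positive, so D > 0 is also needed: a nonzero Lipschitz element supported in a
given ball (`IsProperQMS.exists_ne_zero_mem_Loc`). Only the Leibniz inequality and lower
semi-continuity are available for this. The Leibniz inequality bounds L of the n-th Chebyshev
polynomial of an element of the topography by a multiple of n⁵, so cosine series with coefficients
of order n⁻⁸ act on Lipschitz elements. Such a series which vanishes near zero, but not identically,
is obtained from the eighth Bernoulli polynomial. -/

namespace QMS

/-! ### Characters and cut-off functions in commutative C*-algebras -/

section Commutative

variable {N : Type*} [NonUnitalCommCStarAlgebra N]

/-- A character of a commutative C*-algebra, as a *-morphism. -/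
noncomputable def charHom (x : WeakDual.characterSpace ℂ N) : N →⋆ₙₐ[ℂ] ℂ where
  __ := WeakDual.CharacterSpace.toNonUnitalAlgHom x
  map_star' a := by
    have := map_star (Unitization.lift (WeakDual.CharacterSpace.toNonUnitalAlgHom x))
      (a : Unitization ℂ N)
    rw [← Unitization.inr_star] at this
    simpa using this

@[simp] lemma charHom_apply (x : WeakDual.characterSpace ℂ N) (a : N) : charHom x a = x a := rfl

lemma char_star (x : WeakDual.characterSpace ℂ N) (a : N) : x (star a) = star (x a) :=
  map_star (charHom x) a

lemma norm_char_le (x : WeakDual.characterSpace ℂ N) (a : N) : ‖x a‖ ≤ ‖a‖ :=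
  NonUnitalStarAlgHom.norm_apply_le (charHom x) a

lemma char_eq_re {a : N} (ha : IsSelfAdjoint a) (x : WeakDual.characterSpace ℂ N) :
    x a = ((x a).re : ℂ) := by
  have h : star (x a) = x a := by rw [← char_star, ha.star_eq]
  exact (Complex.conj_eq_iff_re.mp h).symm

/-- A character is a *-morphism to the scalars, hence commutes with the continuous functional
calculus, which on a real scalar is evaluation. The algebra may lack a unit, whence f(0) = 0. -/
lemma char_cfc {a : N} (ha : IsSelfAdjoint a) (f : ℝ → ℝ) (hf : Continuous f) (h0 : f 0 = 0)
    (x : WeakDual.characterSpace ℂ N) : x (cfcₙ f a) = (f (x a).re : ℂ) := by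
  have h1 : charHom x (cfcₙ f a) = cfcₙ f (charHom x a) :=
    NonUnitalStarAlgHom.map_cfcₙ (charHom x) f a (hf.continuousOn) h0
      (AddMonoidHomClass.continuous_of_bound (charHom x) 1
        (by simpa using norm_char_le x)) ha (ha.map (charHom x))
  have h2 : IsSelfAdjoint (charHom x a) := ha.map (charHom x)
  have h3 : charHom x a = algebraMap ℝ ℂ (x a).re := char_eq_re ha x
  rw [charHom_apply] at h1
  rw [h1, cfcₙ_eq_cfc (hf.continuousOn) h0, h3, cfc_algebraMap]
  rfl

/-- On the unitization the Gel'fand transform is isometric over a compact space, so the norm is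
attained at a character. Its restriction to `N` is nonzero, having modulus ‖y‖ > 0 at y. -/
lemma exists_char_norm_eq {y : N} (hy : y ≠ 0) :
    ∃ x : WeakDual.characterSpace ℂ N, ‖x y‖ = ‖y‖ := by
  have h1 : ‖WeakDual.gelfandTransform ℂ (Unitization ℂ N) (y : Unitization ℂ N)‖ = ‖y‖ := by
    rw [← Unitization.norm_inr (𝕜 := ℂ) y]
    exact (gelfandTransform_isometry (Unitization ℂ N)).norm_map_of_map_zero (map_zero _) _
  have hne : Nonempty (WeakDual.characterSpace ℂ (Unitization ℂ N)) := inferInstance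
  obtain ⟨X, -, hX⟩ := isCompact_univ.exists_isMaxOn
    (s := (univ : Set (WeakDual.characterSpace ℂ (Unitization ℂ N)))) univ_nonempty
    (f := fun X => ‖X (y : Unitization ℂ N)‖)
    (map_continuous (WeakDual.gelfandTransform ℂ (Unitization ℂ N) (y : Unitization ℂ N))).norm.continuousOn
  have h2 : ‖y‖ ≤ ‖X (y : Unitization ℂ N)‖ := by
    rw [← h1, ContinuousMap.norm_le _ (norm_nonneg _)]
    intro Y
    exact hX (mem_univ Y)
  have h3 : ‖X (y : Unitization ℂ N)‖ ≤ ‖y‖ := by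
    rw [← Unitization.norm_inr (𝕜 := ℂ) y]
    exact norm_char_le X _
  refine ⟨⟨StrongDual.toWeakDual ((WeakDual.CharacterSpace.toCLM X).comp
    (LinearMap.mkContinuous (Unitization.inrHom ℂ ℂ N) 1 (fun a => by
      simpa using (Unitization.norm_inr (𝕜 := ℂ) a).le))), ?_, ?_⟩, le_antisymm h3 h2⟩
  · intro h0
    have : X (y : Unitization ℂ N) = 0 := congrArg (fun f : WeakDual ℂ N => f y) h0
    rw [this, norm_zero] at h2
    exact hy (norm_le_zero_iff.mp h2)
  · intro a b
    change X ((a * b : N) : Unitization ℂ N) = X (a : Unitization ℂ N) * X (b : Unitization ℂ N)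
    rw [Unitization.inr_mul, map_mul]

lemma ext_char {y z : N} (h : ∀ x : WeakDual.characterSpace ℂ N, x y = x z) : y = z := by
  by_contra hne
  obtain ⟨x, hx⟩ := exists_char_norm_eq (sub_ne_zero.mpr hne)
  rw [map_sub, h, sub_self, norm_zero] at hx
  exact sub_ne_zero.mpr hne (norm_eq_zero.mp hx.symm)

lemma norm_le_of_char {y : N} {c : ℝ} (hc : 0 ≤ c)
    (h : ∀ x : WeakDual.characterSpace ℂ N, ‖x y‖ ≤ c) : ‖y‖ ≤ c := by
  by_cases hy : y = 0
  · simpa [hy] using hc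
  · obtain ⟨x, hx⟩ := exists_char_norm_eq hy
    exact hx ▸ h x

lemma isSelfAdjoint_of_char {y : N} (h : ∀ x : WeakDual.characterSpace ℂ N, (x y).im = 0) :
    IsSelfAdjoint y :=
  ext_char fun x => by rw [char_star]; exact Complex.conj_eq_iff_im.mpr (h x)

lemma exists_star_mul_self_of_char {y : N} (h : ∀ x : WeakDual.characterSpace ℂ N, 0 ≤ x y) :
    ∃ b : N, IsSelfAdjoint b ∧ y = star b * b := by
  have hs : IsSelfAdjoint y := isSelfAdjoint_of_char fun x => (Complex.nonneg_iff.mp (h x)).2.symm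
  have hb : IsSelfAdjoint (cfcₙ Real.sqrt y) := cfcₙ_predicate _ _
  refine ⟨_, hb, ext_char fun x => ?_⟩
  rw [hb.star_eq, map_mul, char_cfc hs _ Real.continuous_sqrt Real.sqrt_zero, ← Complex.ofReal_mul,
    Real.mul_self_sqrt (Complex.nonneg_iff.mp (h x)).1]
  exact char_eq_re hs x

/-- Otherwise the kernel of ω lies in that of y, so y is a multiple of ω, and multiplicativity
forces the factor to be one. The case ω = 0 is allowed; it plays the role of the point at infinity.
-/
lemma exists_char_separates (ω : N →⋆ₙₐ[ℂ] ℂ) (y : WeakDual.characterSpace ℂ N)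
    (h : ∃ a, ω a ≠ y a) : ∃ g : N, ω g = 0 ∧ y g ≠ 0 := by
  by_contra! hc
  obtain ⟨e, he⟩ : ∃ e, y e ≠ 0 := by
    by_contra! h0
    exact y.2.1 (DFunLike.ext _ _ h0)
  have hω : ω e ≠ 0 := fun h0 => he (hc e h0)
  have key : ∀ n, y n * ω e = ω n * y e := fun n => by
    have := hc (ω e • n - ω n • e) (by simp [mul_comm])
    rw [map_sub, map_smul, map_smul, sub_eq_zero, smul_eq_mul, smul_eq_mul] at this
    rw [mul_comm, this]
  have h2 : y e = ω e := by
    have := key (e * e)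
    rw [map_mul, map_mul] at this
    have h3 : y e * ω e * (y e - ω e) = 0 := by linear_combination this
    rcases mul_eq_zero.mp h3 with h4 | h4
    · exact absurd h4 (mul_ne_zero he hω)
    · exact sub_eq_zero.mp h4
  obtain ⟨a, ha⟩ := h
  have := key a
  rw [h2] at this
  exact ha (mul_right_cancel₀ hω this).symm

lemma continuous_char_apply (a : N) : Continuous fun x : WeakDual.characterSpace ℂ N => x a :=
  (WeakDual.eval_continuous a).comp continuous_subtype_val

/-- The characters together with the zero functional are weak* closed in the compact dual unit ball.
The condition δ > 0 excludes the zero functional. -/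
lemma isCompact_char_ge (u : N) {δ : ℝ} (hδ : 0 < δ) :
    IsCompact {x : WeakDual.characterSpace ℂ N | δ ≤ ‖x u‖} := by
  rw [Topology.IsInducing.subtypeVal.isCompact_iff]
  have h : (Subtype.val '' {x : WeakDual.characterSpace ℂ N | δ ≤ ‖x u‖}) =
      WeakDual.toStrongDual ⁻¹' Metric.closedBall (0 : StrongDual ℂ N) 1 ∩
        ((WeakDual.characterSpace ℂ N ∪ {0}) ∩ {φ : WeakDual ℂ N | δ ≤ ‖φ u‖}) := by
    ext φ
    constructor
    · rintro ⟨x, hx, rfl⟩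
      refine ⟨?_, Or.inl x.2, hx⟩
      rw [mem_preimage, mem_closedBall_zero_iff]
      exact ContinuousLinearMap.opNorm_le_bound _ zero_le_one fun a => by
        simpa using norm_char_le x a
    · rintro ⟨-, h1 | h1, h2⟩
      · exact ⟨⟨φ, h1⟩, h2, rfl⟩
      · rw [mem_singleton_iff] at h1
        subst h1
        have : δ ≤ ‖(0 : ℂ)‖ := h2
        rw [norm_zero] at this
        exact absurd this (not_le.mpr hδ)
  rw [h]
  refine (WeakDual.isCompact_closedBall 0 1).inter_right (IsClosed.inter ?_ ?_)
  · exact WeakDual.CharacterSpace.union_zero_isClosed ℂ N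
  · exact isClosed_le continuous_const (WeakDual.eval_continuous u).norm

/-- Cut-off functions for a compact set on which a given *-morphism to the scalars does not lie. -/
lemma exists_cutoff_of_ne {K : Set (WeakDual.characterSpace ℂ N)} (hK : IsCompact K)
    (ω : N →⋆ₙₐ[ℂ] ℂ) (hω : ∀ y ∈ K, ∃ a, ω a ≠ y a) :
    ∃ u : N, (∀ x : WeakDual.characterSpace ℂ N, 0 ≤ x u ∧ x u ≤ 1) ∧ (∀ x ∈ K, x u = 1) ∧
      ω u = 0 := by
  -- A nonnegative function which is positive on `K` and killed by ω: near each point of `K` take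
  -- `star g * g` for a separating g, and add up finitely many of these by compactness.
  obtain ⟨g, hg0, hgK, hgω⟩ : ∃ g : N, (∀ x : WeakDual.characterSpace ℂ N, 0 ≤ x g) ∧
      (∀ x ∈ K, 0 < (x g).re) ∧ ω g = 0 := by
    refine hK.induction_on (p := fun s => ∃ g : N, (∀ x : WeakDual.characterSpace ℂ N, 0 ≤ x g) ∧
      (∀ x ∈ s, 0 < (x g).re) ∧ ω g = 0) ⟨0, by simp⟩ ?_ ?_ ?_
    · rintro s t hst ⟨g, h1, h2, h3⟩
      exact ⟨g, h1, fun x hx => h2 x (hst hx), h3⟩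
    · rintro s t ⟨g, h1, h2, h3⟩ ⟨g', h1', h2', h3'⟩
      refine ⟨g + g', fun x => by rw [map_add]; exact add_nonneg (h1 x) (h1' x), ?_,
        by rw [map_add, h3, h3', add_zero]⟩
      have q := fun x => (Complex.nonneg_iff.mp (h1 x)).1
      have q' := fun x => (Complex.nonneg_iff.mp (h1' x)).1
      rintro x (hx | hx) <;> rw [map_add, Complex.add_re]
      · exact add_pos_of_pos_of_nonneg (h2 x hx) (q' x)
      · exact add_pos_of_nonneg_of_pos (q x) (h2' x hx)
    · intro y hy
      obtain ⟨g, hg, hyg⟩ := exists_char_separates ω y (hω y hy)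
      have hval : ∀ x : WeakDual.characterSpace ℂ N, x (star g * g) = ((Complex.normSq (x g) : ℝ) : ℂ) :=
        fun x => by
          rw [map_mul, char_star, Complex.star_def, Complex.normSq_eq_conj_mul_self]
      refine ⟨{x | 0 < (x (star g * g)).re}, ?_, star g * g, fun x => ?_, fun x hx => hx,
        by rw [map_mul, hg, mul_zero]⟩
      · refine mem_nhdsWithin_of_mem_nhds (IsOpen.mem_nhds ?_ ?_)
        · exact isOpen_lt continuous_const (Complex.continuous_re.comp (continuous_char_apply _))
        · rw [mem_ofPred_eq, hval, Complex.ofReal_re]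
          exact Complex.normSq_pos.mpr hyg
      · rw [hval]
        exact_mod_cast Complex.normSq_nonneg _
  obtain ⟨δ, hδ, hδK⟩ : ∃ δ : ℝ, 0 < δ ∧ ∀ x ∈ K, δ ≤ (x g).re := by
    rcases K.eq_empty_or_nonempty with rfl | hne
    · exact ⟨1, one_pos, by simp⟩
    · obtain ⟨x, hx, hmin⟩ := hK.exists_isMinOn hne
        (Complex.continuous_re.comp (continuous_char_apply g)).continuousOn
      exact ⟨_, hgK x hx, fun y hy => hmin hy⟩
  have hsa : IsSelfAdjoint g :=
    isSelfAdjoint_of_char fun x => (Complex.nonneg_iff.mp (hg0 x)).2.symm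
  -- Truncation at the lower bound δ of g on `K` turns g into a cut-off function, still killed by ω.
  have hc : Continuous fun t : ℝ => min (t / δ) 1 := by fun_prop
  have h0 : min ((0 : ℝ) / δ) 1 = 0 := by simp
  refine ⟨cfcₙ (fun t : ℝ => min (t / δ) 1) g, fun x => ?_, fun x hx => ?_, ?_⟩
  · rw [char_cfc hsa _ hc h0]
    have : 0 ≤ (x g).re := (Complex.nonneg_iff.mp (hg0 x)).1
    constructor
    · exact_mod_cast le_min (by positivity) zero_le_one
    · exact_mod_cast min_le_right _ _
  · rw [char_cfc hsa _ hc h0, min_eq_right, Complex.ofReal_one]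
    rw [le_div_iff₀ hδ, one_mul]
    exact hδK x hx
  · have h1 : ω (cfcₙ (fun t : ℝ => min (t / δ) 1) g) = cfcₙ (fun t : ℝ => min (t / δ) 1) (ω g) :=
      NonUnitalStarAlgHom.map_cfcₙ ω _ g hc.continuousOn h0
        (AddMonoidHomClass.continuous_of_bound ω 1
          (by simpa using NonUnitalStarAlgHom.norm_apply_le ω)) hsa (hsa.map ω)
    rw [h1, hgω, cfcₙ_apply_zero]

end Commutative

/-! ### Positive functionals and states of C*-algebras without unit -/

section Functionals

variable {A : Type u} [NonUnitalCStarAlgebra A]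

/-- The norm of a functional. -/
noncomputable def fnorm (φ : WeakDual ℂ A) : ℝ := ‖WeakDual.toStrongDual φ‖

lemma fnorm_nonneg (φ : WeakDual ℂ A) : 0 ≤ fnorm φ := norm_nonneg _

lemma norm_apply_le_fnorm (φ : WeakDual ℂ A) (a : A) : ‖φ a‖ ≤ fnorm φ * ‖a‖ :=
  (WeakDual.toStrongDual φ).le_opNorm a

/-- Positive functionals. -/
def IsPosFun (φ : WeakDual ℂ A) : Prop := ∀ a, 0 ≤ φ (star a * a)

lemma IsPosFun.of_isPos {φ : WeakDual ℂ A} (hφ : IsPosFun φ) {a : A} (ha : IsPos a) : 0 ≤ φ a := by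
  obtain ⟨b, rfl⟩ := ha
  exact hφ b

lemma mem_states_iff {φ : WeakDual ℂ A} : φ ∈ states A ↔ IsPosFun φ ∧ fnorm φ = 1 := Iff.rfl

lemma norm_state_apply_le {φ : WeakDual ℂ A} (hφ : φ ∈ states A) (a : A) : ‖φ a‖ ≤ ‖a‖ := by
  simpa [(mem_states_iff.mp hφ).2] using norm_apply_le_fnorm φ a

lemma isPos_iff_nonneg {a : A} :
    IsPos a ↔ @LE.le A (CStarAlgebra.spectralOrder A).toLE 0 a := by
  let _ := CStarAlgebra.spectralOrder A
  have := CStarAlgebra.spectralOrderedRing A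
  exact CStarAlgebra.nonneg_iff_eq_star_mul_self.symm

lemma IsPos.isSelfAdjoint {a : A} (ha : IsPos a) : IsSelfAdjoint a := by
  obtain ⟨b, rfl⟩ := ha
  exact IsSelfAdjoint.star_mul_self b

lemma IsPosFun.cauchy_schwarz {φ : WeakDual ℂ A} (hφ : IsPosFun φ) (a b : A) :
    ‖φ (star a * b)‖ ^ 2 ≤ (φ (star a * a)).re * (φ (star b * b)).re := by
  let _ := CStarAlgebra.spectralOrder A
  have := CStarAlgebra.spectralOrderedRing A
  let f : A →ₚ[ℂ] ℂ := PositiveLinearMap.mk₀ (WeakDual.toStrongDual φ : A →ₗ[ℂ] ℂ)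
    (fun a ha => hφ.of_isPos (isPos_iff_nonneg.mpr ha))
  have h := norm_inner_le_norm (𝕜 := ℂ) (f.toPreGNS a) (f.toPreGNS b)
  have h1 : ‖f.toPreGNS a‖ ^ 2 = (φ (star a * a)).re := by
    rw [PositiveLinearMap.preGNS_norm_def, Real.sq_sqrt]
    · rfl
    · exact (Complex.nonneg_iff.mp (hφ a)).1
  have h2 : ‖f.toPreGNS b‖ ^ 2 = (φ (star b * b)).re := by
    rw [PositiveLinearMap.preGNS_norm_def, Real.sq_sqrt]
    · rfl
    · exact (Complex.nonneg_iff.mp (hφ b)).1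
  rw [← h1, ← h2, ← mul_pow]
  exact pow_le_pow_left₀ (norm_nonneg _) h 2

lemma exists_approx_unit (A : Type u) [NonUnitalCStarAlgebra A] :
    ∃ l : Filter A, l.IsApproximateUnit ∧ ∀ᶠ u in l, IsPos u ∧ ‖u‖ ≤ 1 := by
  let _ := CStarAlgebra.spectralOrder A
  have := CStarAlgebra.spectralOrderedRing A
  have h := CStarAlgebra.increasingApproximateUnit A
  refine ⟨_, h.toIsApproximateUnit, ?_⟩
  filter_upwards [h.eventually_nonneg, h.eventually_norm] with u h1 h2
  exact ⟨isPos_iff_nonneg.mpr h1, h2⟩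

lemma IsPosFun.map_star {φ : WeakDual ℂ A} (hφ : IsPosFun φ) (a : A) :
    φ (star a) = star (φ a) := by
  let _ := CStarAlgebra.spectralOrder A
  have := CStarAlgebra.spectralOrderedRing A
  let f : A →ₚ[ℂ] ℂ := PositiveLinearMap.mk₀ (WeakDual.toStrongDual φ : A →ₗ[ℂ] ℂ)
    (fun a ha => hφ.of_isPos (isPos_iff_nonneg.mpr ha))
  exact StarHomClass.map_star f a

lemma IsPosFun.eq_re {φ : WeakDual ℂ A} (hφ : IsPosFun φ) {a : A} (ha : IsSelfAdjoint a) :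
    φ a = ((φ a).re : ℂ) := by
  have h : star (φ a) = φ a := by rw [← hφ.map_star, ha.star_eq]
  exact (Complex.conj_eq_iff_re.mp h).symm

lemma IsPosFun.cauchy_schwarz_of_isSelfAdjoint {φ : WeakDual ℂ A} (hφ : IsPosFun φ) {a : A}
    (ha : IsSelfAdjoint a) (b : A) :
    ‖φ (a * b)‖ ^ 2 ≤ (φ (a * a)).re * (φ (star b * b)).re := by
  have := hφ.cauchy_schwarz a b
  rwa [ha.star_eq] at this

lemma IsPosFun.re_mul_self_nonneg {φ : WeakDual ℂ A} (hφ : IsPosFun φ) {a : A}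
    (ha : IsSelfAdjoint a) : 0 ≤ (φ (a * a)).re := by
  have := hφ a
  rw [ha.star_eq] at this
  exact (Complex.nonneg_iff.mp this).1

lemma tendsto_mul_self {l : Filter A} (hl : l.IsApproximateUnit) (a b : A) :
    Tendsto (fun u => a * (u * u) * b) l (𝓝 (a * b)) := by
  have := (hl.tendsto_mul_left a).mul (hl.tendsto_mul_right b)
  refine this.congr fun u => by simp only [mul_assoc]

/-- This replaces φ(1) = ‖φ‖ when there is no unit. For the lower bound, Cauchy-Schwarz gives
|φ(ua)|² ≤ φ(u²)φ(a*a) ≤ φ(u²)‖φ‖ for a in the unit ball, where φ(ua) → φ(a), and a may be chosen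
with |φ(a)| close to ‖φ‖. -/
lemma IsPosFun.tendsto_mul_self {φ : WeakDual ℂ A} (hφ : IsPosFun φ) {l : Filter A}
    (hl : l.IsApproximateUnit) (hu : ∀ᶠ u in l, IsSelfAdjoint u ∧ ‖u‖ ≤ 1) :
    Tendsto (fun u => φ (u * u)) l (𝓝 (fnorm φ : ℂ)) := by
  have hre : Tendsto (fun u => (φ (u * u)).re) l (𝓝 (fnorm φ)) := by
    refine tendsto_order.mpr ⟨fun c hc => ?_, fun c hc => ?_⟩
    · set η := fnorm φ - c with hη
      have hη0 : 0 < η := sub_pos.mpr hc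
      rcases (fnorm_nonneg φ).eq_or_lt with h0 | h0
      · filter_upwards [hu] with u hu
        have := hφ.re_mul_self_nonneg hu.1
        linarith
      · obtain ⟨a, ha1, ha2⟩ := (WeakDual.toStrongDual φ).exists_lt_apply_of_lt_opNorm
          (show max (fnorm φ - η / 2) 0 < fnorm φ from max_lt (by linarith) h0)
        have h1 : Tendsto (fun u => ‖φ (u * a)‖) l (𝓝 ‖φ a‖) :=
          (((WeakDual.toStrongDual φ).continuous.tendsto a).comp (hl.tendsto_mul_right a)).norm
        filter_upwards [hu, h1.eventually (lt_mem_nhds ha2)] with u hu h2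
        have h3 := hφ.cauchy_schwarz_of_isSelfAdjoint hu.1 a
        have h4 : (φ (star a * a)).re ≤ fnorm φ := by
          refine (Complex.re_le_norm _).trans ((norm_apply_le_fnorm φ _).trans ?_)
          rw [CStarRing.norm_star_mul_self]
          have := norm_nonneg a
          have : ‖a‖ * ‖a‖ ≤ 1 := by nlinarith
          nlinarith
        have h5 := hφ.re_mul_self_nonneg hu.1
        have h6 : (max (fnorm φ - η / 2) 0) ^ 2 < (φ (u * u)).re * fnorm φ :=
          (pow_lt_pow_left₀ h2 (le_max_right _ _) two_ne_zero).trans_le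
            (h3.trans (mul_le_mul_of_nonneg_left h4 h5))
        by_contra! hcon
        have h7 : (φ (u * u)).re * fnorm φ ≤ c * fnorm φ := by gcongr
        have h8 := le_max_left (fnorm φ - η / 2) 0
        have h9 := le_max_right (fnorm φ - η / 2) 0
        have hcc : c = fnorm φ - η := by rw [hη]; ring
        by_cases h10 : 0 ≤ fnorm φ - η / 2
        · nlinarith
        · nlinarith
    · filter_upwards [hu] with u hu
      refine lt_of_le_of_lt ((Complex.re_le_norm _).trans ((norm_apply_le_fnorm φ _).trans ?_)) hc
      have := norm_mul_le u u
      have h1 := norm_nonneg u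
      have : ‖u * u‖ ≤ 1 := by nlinarith
      nlinarith [fnorm_nonneg φ]
  have := (Complex.continuous_ofReal.tendsto _).comp hre
  refine this.congr' ?_
  filter_upwards [hu] with u hu
  refine (hφ.eq_re ?_).symm
  rw [IsSelfAdjoint, star_mul, hu.1.star_eq]

lemma IsPosFun.tendsto_apply {φ : WeakDual ℂ A} (hφ : IsPosFun φ) {l : Filter A}
    (hl : l.IsApproximateUnit) (hu : ∀ᶠ u in l, IsSelfAdjoint u ∧ ‖u‖ ≤ 1)
    (hu' : ∀ᶠ u in l, IsPos (u - u * u)) :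
    Tendsto (fun u => φ u) l (𝓝 (fnorm φ : ℂ)) := by
  have h1 := (Complex.continuous_re.tendsto _).comp (hφ.tendsto_mul_self hl hu)
  have hre : Tendsto (fun u => (φ u).re) l (𝓝 (fnorm φ)) := by
    refine tendsto_of_tendsto_of_tendsto_of_le_of_le' h1 tendsto_const_nhds ?_ ?_
    · filter_upwards [hu'] with u hu
      have := (Complex.nonneg_iff.mp (hφ.of_isPos hu)).1
      rw [map_sub, Complex.sub_re] at this
      simpa using this
    · filter_upwards [hu] with u hu
      refine (Complex.re_le_norm _).trans ((norm_apply_le_fnorm φ _).trans ?_)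
      nlinarith [fnorm_nonneg φ, hu.2]
  refine ((Complex.continuous_ofReal.tendsto _).comp hre).congr' ?_
  filter_upwards [hu] with u hu
  exact (hφ.eq_re hu.1).symm

/-- The functional `a ↦ φ (h a h)`. -/
noncomputable def compress (φ : WeakDual ℂ A) (h : A) : WeakDual ℂ A :=
  StrongDual.toWeakDual ((WeakDual.toStrongDual φ).comp
    (((ContinuousLinearMap.mul ℂ A).flip h).comp (ContinuousLinearMap.mul ℂ A h)))

@[simp] lemma compress_apply (φ : WeakDual ℂ A) (h a : A) : compress φ h a = φ (h * a * h) := rfl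

lemma IsPosFun.compress {φ : WeakDual ℂ A} (hφ : IsPosFun φ) {h : A} (hh : IsSelfAdjoint h) :
    IsPosFun (compress φ h) := fun a => by
  have := hφ (a * h)
  rw [star_mul, hh.star_eq] at this
  simpa [mul_assoc] using this

lemma IsPosFun.fnorm_compress {φ : WeakDual ℂ A} (hφ : IsPosFun φ) {h : A}
    (hh : IsSelfAdjoint h) : (fnorm (QMS.compress φ h) : ℂ) = φ (h * h) := by
  obtain ⟨l, hl, hu⟩ := exists_approx_unit A
  have := hl.neBot
  have h1 := (hφ.compress hh).tendsto_mul_self hl (hu.mono fun u hu => ⟨hu.1.isSelfAdjoint, hu.2⟩)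
  refine tendsto_nhds_unique h1 ?_
  exact ((WeakDual.toStrongDual φ).continuous.tendsto _).comp (QMS.tendsto_mul_self hl h h)

lemma IsPosFun.smul {φ : WeakDual ℂ A} (hφ : IsPosFun φ) {t : ℝ} (ht : 0 ≤ t) :
    IsPosFun ((t : ℂ) • φ) := fun a => by
  have : (0 : ℂ) ≤ (t : ℂ) := by exact_mod_cast ht
  exact mul_nonneg this (hφ a)

lemma fnorm_smul (t : ℂ) (φ : WeakDual ℂ A) : fnorm (t • φ) = ‖t‖ * fnorm φ := by
  unfold fnorm
  rw [map_smul, norm_smul]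

lemma IsPosFun.normalize_mem_states {φ : WeakDual ℂ A} (hφ : IsPosFun φ) (h0 : fnorm φ ≠ 0) :
    (((fnorm φ)⁻¹ : ℝ) : ℂ) • φ ∈ states A := by
  refine mem_states_iff.mpr ⟨hφ.smul (inv_nonneg.mpr (fnorm_nonneg φ)), ?_⟩
  rw [fnorm_smul, Complex.norm_real, norm_inv, Real.norm_of_nonneg (fnorm_nonneg φ),
    inv_mul_cancel₀ h0]

/-- In the unitization both elements lie between 0 and 1, so the spectrum of the difference lies in
[−1, 1]. -/
lemma norm_sub_le_one_of_isPos {u p : A} (hu : IsPos u) (hu1 : ‖u‖ ≤ 1) (hp : IsPos p)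
    (hp1 : ‖p‖ ≤ 1) : ‖u - p‖ ≤ 1 := by
  let _ := CStarAlgebra.spectralOrder A
  have := CStarAlgebra.spectralOrderedRing A
  let _ := CStarAlgebra.spectralOrder (Unitization ℂ A)
  have := CStarAlgebra.spectralOrderedRing (Unitization ℂ A)
  have hu0 : (0 : Unitization ℂ A) ≤ u := Unitization.inr_nonneg_iff.mpr (isPos_iff_nonneg.mp hu)
  have hp0 : (0 : Unitization ℂ A) ≤ p := Unitization.inr_nonneg_iff.mpr (isPos_iff_nonneg.mp hp)
  have hu2 : (u : Unitization ℂ A) ≤ 1 := by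
    rw [← CStarAlgebra.norm_le_one_iff_of_nonneg _ hu0, Unitization.norm_inr]; exact hu1
  have hp2 : (p : Unitization ℂ A) ≤ 1 := by
    rw [← CStarAlgebra.norm_le_one_iff_of_nonneg _ hp0, Unitization.norm_inr]; exact hp1
  rw [← Unitization.norm_inr (𝕜 := ℂ) (u - p), Unitization.inr_sub]
  set x : Unitization ℂ A := u - p
  have hx : IsSelfAdjoint x := (IsSelfAdjoint.of_nonneg hu0).sub (IsSelfAdjoint.of_nonneg hp0)
  have h1 : x ≤ algebraMap ℝ _ 1 := by
    rw [map_one]; exact (sub_le_self _ hp0).trans hu2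
  have h2 : algebraMap ℝ _ (-1) ≤ x := by
    rw [map_neg, map_one, neg_le_iff_add_nonneg]
    have : x + 1 = u + (1 - p) := by simp only [x]; abel
    rw [this]
    exact add_nonneg hu0 (sub_nonneg.mpr hp2)
  rw [le_algebraMap_iff_spectrum_le] at h1
  rw [algebraMap_le_iff_le_spectrum] at h2
  rcases CStarAlgebra.norm_or_neg_norm_mem_spectrum (a := x) hx with h | h
  · exact h1 _ h
  · linarith [h2 _ h]

/-- A functional of norm at most one which tends to one along positive contractions has a state
as its symmetrization. -/
lemma exists_state_of_tendsto (g : StrongDual ℂ A) (hg : ‖g‖ ≤ 1) {l : Filter A} [l.NeBot]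
    (hl : ∀ᶠ u in l, IsPos u ∧ ‖u‖ ≤ 1) (hlim : Tendsto g l (𝓝 1)) :
    ∃ φ ∈ states A, ∀ a, φ a = (g a + star (g (star a))) / 2 := by
  have hle : ∀ a, ‖g a‖ ≤ ‖a‖ := fun a => by
    simpa using (g.le_opNorm a).trans (mul_le_mul_of_nonneg_right hg (norm_nonneg a))
  let f : A →ₗ[ℂ] ℂ :=
    { toFun := fun a => (g a + star (g (star a))) / 2
      map_add' := fun a b => by simp only [map_add, star_add]; ring
      map_smul' := fun c a => by
        simp only [map_smul, star_smul, smul_eq_mul, star_mul', star_star, RingHom.id_apply]; ring }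
  have hf : ∀ a, ‖f a‖ ≤ 1 * ‖a‖ := fun a => by
    change ‖(g a + star (g (star a))) / 2‖ ≤ 1 * ‖a‖
    rw [norm_div, Complex.norm_two, div_le_iff₀ two_pos]
    refine (norm_add_le _ _).trans ?_
    have h1 := hle a
    have h2 := hle (star a)
    rw [norm_star] at h2
    rw [norm_star]
    linarith
  let φ : WeakDual ℂ A := StrongDual.toWeakDual (f.mkContinuous 1 hf)
  have hφ : ∀ a, φ a = (g a + star (g (star a))) / 2 := fun a => rfl
  have hφsa : ∀ a, IsSelfAdjoint a → φ a = ((g a).re : ℂ) := fun a ha => by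
    rw [hφ, ha.star_eq]
    apply Complex.ext <;> simp
  have hn : fnorm φ ≤ 1 := LinearMap.mkContinuous_norm_le f zero_le_one hf
  have hre : Tendsto (fun u => (g u).re) l (𝓝 1) := (Complex.continuous_re.tendsto _).comp hlim
  refine ⟨φ, mem_states_iff.mpr ⟨fun a => ?_, le_antisymm hn ?_⟩, hφ⟩
  · rw [hφsa _ (IsSelfAdjoint.star_mul_self a)]
    rcases eq_or_ne a 0 with rfl | ha
    · simp
    have hpos : 0 < ‖a‖ := norm_pos_iff.mpr ha
    set b : A := ((‖a‖⁻¹ : ℝ) : ℂ) • a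
    have hb1 : ‖b‖ = 1 := by
      simp [b, norm_smul, inv_mul_cancel₀ hpos.ne']
    have hb : (g (star a * a)).re = ‖a‖ ^ 2 * (g (star b * b)).re := by
      have : star b * b = ((‖a‖⁻¹ ^ 2 : ℝ) : ℂ) • (star a * a) := by
        simp only [b, star_smul, smul_mul_smul_comm, Complex.star_def, Complex.conj_ofReal]
        rw [← Complex.ofReal_mul, sq]
      rw [this, map_smul, smul_eq_mul, Complex.re_ofReal_mul]
      field_simp
    -- Here u and b*b are positive contractions, so ‖u − b*b‖ ≤ 1 and Re g(u) − Re g(b*b) ≤ 1. As Re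
    -- g(u) → 1, positivity follows.
    have h1 : 0 ≤ (g (star b * b)).re := by
      have h2 : 1 - (g (star b * b)).re ≤ 1 := by
        refine le_of_tendsto (hre.sub_const (g (star b * b)).re) ?_
        filter_upwards [hl] with u hu
        rw [← Complex.sub_re, ← map_sub]
        refine (Complex.re_le_norm _).trans ((hle _).trans ?_)
        refine norm_sub_le_one_of_isPos hu.1 hu.2 ⟨b, rfl⟩ ?_
        rw [CStarRing.norm_star_mul_self, hb1, one_mul]
      linarith
    rw [hb]
    have : (0 : ℝ) ≤ ‖a‖ ^ 2 * (g (star b * b)).re := by positivity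
    exact_mod_cast this
  · refine le_of_tendsto hre ?_
    filter_upwards [hl] with u hu
    have h1 := norm_apply_le_fnorm φ u
    rw [hφsa u hu.1.isSelfAdjoint, Complex.norm_real] at h1
    have h2 := le_abs_self (g u).re
    rw [← Real.norm_eq_abs] at h2
    nlinarith [fnorm_nonneg φ, hu.2]

/-- A norming character of the C*-algebra generated by y and 1 in the unitization extends by
Hahn-Banach to a functional which is one at the unit; its symmetrization is a state. The restriction
to `A` still has norm one, because it attains ‖y‖ at y. -/
lemma exists_state_norm_eq {y : A} (hy : IsSelfAdjoint y) (hy0 : y ≠ 0) :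
    ∃ χ ∈ states A, ‖χ y‖ = ‖y‖ := by
  set a : Unitization ℂ A := (y : Unitization ℂ A) with ha
  have hsa : IsSelfAdjoint a := by rw [IsSelfAdjoint, ha, ← Unitization.inr_star, hy.star_eq]
  have : IsStarNormal a := hsa.isStarNormal
  let a' : StarAlgebra.elemental ℂ a := ⟨a, StarAlgebra.elemental.self_mem ℂ a⟩
  have ha0 : a' ≠ 0 := fun h => hy0 (Unitization.inr_injective (R := ℂ) (congrArg Subtype.val h))
  obtain ⟨X, hX⟩ := exists_char_norm_eq ha0
  obtain ⟨g, hg1, hg2⟩ := exists_extension_norm_eq (𝕜 := ℂ)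
    (Subalgebra.toSubmodule (StarAlgebra.elemental ℂ a).toSubalgebra)
    (WeakDual.CharacterSpace.toCLM X)
  have hgn : ‖g‖ ≤ 1 := by
    rw [hg2]
    exact ContinuousLinearMap.opNorm_le_bound _ zero_le_one fun b => by
      simpa using norm_char_le X b
  have hg1' : g 1 = 1 := by
    have := hg1 (1 : StarAlgebra.elemental ℂ a)
    rw [show ((1 : StarAlgebra.elemental ℂ a) : Unitization ℂ A) = 1 from rfl] at this
    rw [this]
    exact map_one X
  obtain ⟨φ, hφ, hφg⟩ := exists_state_of_tendsto (l := pure 1) g hgn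
    (by
      rw [eventually_pure]
      exact ⟨⟨1, by simp⟩, by simp⟩)
    (by rw [← hg1']; exact tendsto_pure_nhds _ _)
  have hga : g a = X a' := hg1 a'
  have hφa : φ a = X a' := by
    have h1 : star (X a') = X a' := by
      rw [← char_star]
      exact congrArg X (Subtype.ext hsa.star_eq)
    rw [hφg, hsa.star_eq, hga, h1]
    ring
  let χ : WeakDual ℂ A := StrongDual.toWeakDual ((WeakDual.toStrongDual φ).comp
    (LinearMap.mkContinuous (Unitization.inrHom ℂ ℂ A) 1 (fun a => by
      simpa using (Unitization.norm_inr (𝕜 := ℂ) a).le)))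
  have hχ : ∀ b : A, χ b = φ (b : Unitization ℂ A) := fun b => rfl
  have hχy : ‖χ y‖ = ‖y‖ := by
    rw [hχ, ← ha, hφa, hX]
    exact Unitization.norm_inr (𝕜 := ℂ) y
  refine ⟨χ, mem_states_iff.mpr ⟨fun b => ?_, le_antisymm ?_ ?_⟩, hχy⟩
  · rw [hχ, Unitization.inr_mul, Unitization.inr_star]
    exact hφ.1 _
  · refine ContinuousLinearMap.opNorm_le_bound _ zero_le_one fun b => ?_
    rw [one_mul, ← Unitization.norm_inr (𝕜 := ℂ) b]
    exact norm_state_apply_le hφ _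
  · have := norm_apply_le_fnorm χ y
    rw [hχy] at this
    exact le_of_mul_le_mul_right (by simpa using this) (norm_pos_iff.mpr hy0)

lemma norm_le_of_states {y : A} (hy : IsSelfAdjoint y) {c : ℝ} (hc : 0 ≤ c)
    (h : ∀ χ ∈ states A, ‖χ y‖ ≤ c) : ‖y‖ ≤ c := by
  by_cases hy0 : y = 0
  · simpa [hy0] using hc
  · obtain ⟨χ, hχ, h1⟩ := exists_state_norm_eq hy hy0
    exact h1 ▸ h χ hχ

lemma eq_of_states {y z : A} (hy : IsSelfAdjoint y) (hz : IsSelfAdjoint z)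
    (h : ∀ χ ∈ states A, χ y = χ z) : y = z := by
  rw [← sub_eq_zero, ← norm_le_zero_iff]
  exact norm_le_of_states (hy.sub hz) le_rfl fun χ hχ => by rw [map_sub, h χ hχ]; simp

end Functionals

/-! ### Cut-off functions in a topography and locally supported states -/

section Topography

variable {A : Type u} [NonUnitalCStarAlgebra A] {M : NonUnitalStarSubalgebra ℂ A}

/-- A topography is a commutative C*-algebra. -/
noncomputable abbrev IsTopography.commCStar (hM : IsTopography M) : NonUnitalCommCStarAlgebra M :=
  { NonUnitalStarSubalgebra.nonUnitalCStarAlgebra (A := A) M (h_closed := hM.isClosed) with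
    mul_comm := fun a b => Subtype.ext (hM.comm a a.2 b b.2) }

/-- Positivity in `A` and in `M` agree: `M` is closed, so it contains the square roots of its
elements that are positive in `A`. -/
lemma IsTopography.isPos_iff (hM : IsTopography M) {m : A} (h : m ∈ M) :
    IsPos m ↔ ∀ x : Spectrum M, 0 ≤ x ⟨m, h⟩ := by
  let _ := hM.commCStar
  constructor
  · intro hm x
    have hsa : IsSelfAdjoint (⟨m, h⟩ : M) := Subtype.ext hm.isSelfAdjoint
    let _ := CStarAlgebra.spectralOrder A
    have := CStarAlgebra.spectralOrderedRing A
    have h0 : 0 ≤ m := isPos_iff_nonneg.mp hm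
    have hcl : IsClosed (M : Set A) := hM.isClosed
    have hs : CFC.sqrt m ∈ M := by
      rw [CFC.sqrt_eq_real_sqrt m h0]
      exact cfcₙ_mem (𝕜' := ℂ) (hs := hcl) _ h
    have hss : IsSelfAdjoint (⟨CFC.sqrt m, hs⟩ : M) :=
      Subtype.ext (IsSelfAdjoint.of_nonneg (CFC.sqrt_nonneg m))
    have h1 : (⟨m, h⟩ : M) = star (⟨CFC.sqrt m, hs⟩ : M) * ⟨CFC.sqrt m, hs⟩ := by
      rw [hss.star_eq]
      exact Subtype.ext (CFC.sqrt_mul_sqrt_self m h0).symm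
    rw [h1, map_mul, char_star]
    exact star_mul_self_nonneg (R := ℂ) _
  · intro hx
    obtain ⟨b, -, hb⟩ := exists_star_mul_self_of_char hx
    exact ⟨b, congrArg Subtype.val hb⟩

lemma IsTopography.char_le_one (hM : IsTopography M) {m : A} (h : m ∈ M) (hm : IsPos m)
    (h1 : ‖m‖ ≤ 1) (x : Spectrum M) : x ⟨m, h⟩ ≤ 1 := by
  let _ := hM.commCStar
  have h2 := norm_char_le x ⟨m, h⟩
  have h3 := (hM.isPos_iff h).mp hm x
  rw [Complex.eq_coe_norm_of_nonneg h3]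
  have : ‖(⟨m, h⟩ : M)‖ ≤ 1 := h1
  exact_mod_cast h2.trans this

lemma IsTopography.norm_le_one (hM : IsTopography M) {m : A} (h : m ∈ M)
    (h1 : ∀ x : Spectrum M, 0 ≤ x ⟨m, h⟩ ∧ x ⟨m, h⟩ ≤ 1) : ‖m‖ ≤ 1 := by
  let _ := hM.commCStar
  refine norm_le_of_char (y := (⟨m, h⟩ : M)) zero_le_one fun x => ?_
  have := (h1 x).2
  rw [Complex.eq_coe_norm_of_nonneg (h1 x).1] at this
  exact_mod_cast this

lemma IsTopography.mem_cutoffs_iff (hM : IsTopography M) {K : Set (Spectrum M)} {m : A} :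
    m ∈ cutoffs M K ↔ ∃ h : m ∈ M, (∀ x : Spectrum M, 0 ≤ x ⟨m, h⟩ ∧ x ⟨m, h⟩ ≤ 1) ∧
      ∀ x ∈ K, x ⟨m, h⟩ = 1 := by
  constructor
  · rintro ⟨h1, h2, h, h3⟩
    exact ⟨h, fun x => ⟨(hM.isPos_iff h).mp h1 x, hM.char_le_one h h1 h2 x⟩, h3⟩
  · rintro ⟨h, h1, h2⟩
    exact ⟨(hM.isPos_iff h).mpr fun x => (h1 x).1, hM.norm_le_one h h1, h, h2⟩

lemma cutoffs_anti {K K' : Set (Spectrum M)} (h : K ⊆ K') : cutoffs M K' ⊆ cutoffs M K := by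
  rintro m ⟨h1, h2, h3, h4⟩
  exact ⟨h1, h2, h3, fun x hx => h4 x (h hx)⟩

lemma IsTopography.ext_char (hM : IsTopography M) {m n : A} (hm : m ∈ M) (hn : n ∈ M)
    (h : ∀ x : Spectrum M, x ⟨m, hm⟩ = x ⟨n, hn⟩) : m = n := by
  let _ := hM.commCStar
  exact congrArg Subtype.val (QMS.ext_char (y := (⟨m, hm⟩ : M)) (z := ⟨n, hn⟩) h)

lemma map_mk_mul (x : Spectrum M) {m n : A} (hm : m ∈ M) (hn : n ∈ M) (h : m * n ∈ M) :
    x ⟨m * n, h⟩ = x ⟨m, hm⟩ * x ⟨n, hn⟩ :=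
  map_mul x (⟨m, hm⟩ : M) ⟨n, hn⟩

lemma map_mk_sub (x : Spectrum M) {m n : A} (hm : m ∈ M) (hn : n ∈ M) (h : m - n ∈ M) :
    x ⟨m - n, h⟩ = x ⟨m, hm⟩ - x ⟨n, hn⟩ :=
  map_sub x (⟨m, hm⟩ : M) ⟨n, hn⟩

lemma IsTopography.cutoffs_nonempty (hM : IsTopography M) {K : Set (Spectrum M)}
    (hK : IsCompact K) : (cutoffs M K).Nonempty := by
  let _ := hM.commCStar
  obtain ⟨u, h1, h2, -⟩ := exists_cutoff_of_ne hK (0 : M →⋆ₙₐ[ℂ] ℂ) fun y _ => by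
    by_contra! h
    exact y.2.1 (DFunLike.ext _ _ fun a => (h a).symm)
  exact ⟨u, hM.mem_cutoffs_iff.mpr ⟨u.2, h1, h2⟩⟩

lemma IsTopography.exists_cutoff_apply_eq_zero (hM : IsTopography M) {K : Set (Spectrum M)}
    (hK : IsCompact K) {x₀ : Spectrum M} (hx₀ : x₀ ∉ K) :
    ∃ u ∈ cutoffs M K, ∃ h : u ∈ M, x₀ ⟨u, h⟩ = 0 := by
  let _ := hM.commCStar
  obtain ⟨u, h1, h2, h3⟩ := exists_cutoff_of_ne hK (charHom x₀) fun y hy => by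
    by_contra! h
    have : x₀ = y := WeakDual.CharacterSpace.ext h
    exact hx₀ (this ▸ hy)
  exact ⟨u, hM.mem_cutoffs_iff.mpr ⟨u.2, h1, h2⟩, u.2, h3⟩

lemma IsTopography.mul_mem_cutoffs (hM : IsTopography M) {K : Set (Spectrum M)} {u v : A}
    (hu : u ∈ cutoffs M K) (hv : v ∈ cutoffs M K) :
    u * v ∈ cutoffs M K ∧ IsPos (u - u * v) := by
  obtain ⟨h, h1, h2⟩ := hM.mem_cutoffs_iff.mp hu
  obtain ⟨h', h1', h2'⟩ := hM.mem_cutoffs_iff.mp hv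
  have hm : u * v ∈ M := mul_mem h h'
  refine ⟨hM.mem_cutoffs_iff.mpr ⟨hm, fun x => ?_, fun x hx => ?_⟩,
    (hM.isPos_iff (sub_mem h hm)).mpr fun x => ?_⟩
  · rw [map_mk_mul x h h']
    exact ⟨mul_nonneg (h1 x).1 (h1' x).1, mul_le_one₀ (h1 x).2 (h1' x).1 (h1' x).2⟩
  · rw [map_mk_mul x h h', h2 x hx, h2' x hx, one_mul]
  · rw [map_mk_sub x h hm, map_mk_mul x h h', sub_nonneg]
    exact mul_le_of_le_one_right (h1 x).1 (h1' x).2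

lemma IsPos.add {a b : A} (ha : IsPos a) (hb : IsPos b) : IsPos (a + b) := by
  let _ := CStarAlgebra.spectralOrder A
  have := CStarAlgebra.spectralOrderedRing A
  rw [isPos_iff_nonneg] at *
  exact add_nonneg ha hb

lemma IsPos.sub_trans {a b c : A} (ha : IsPos (a - b)) (hb : IsPos (b - c)) : IsPos (a - c) := by
  simpa using ha.add hb

lemma isPos_zero : IsPos (0 : A) := ⟨0, by simp⟩

/-- The product of two cut-off functions is a cut-off function below both, so the family is directed
downwards. -/
lemma IsTopography.hasBasis_cutoffFilter (hM : IsTopography M) {K : Set (Spectrum M)}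
    (hK : IsCompact K) : (cutoffFilter M K).HasBasis (fun u => u ∈ cutoffs M K)
      fun u => {m | m ∈ cutoffs M K ∧ IsPos (u - m)} := by
  refine hasBasis_biInf_principal ?_ (hM.cutoffs_nonempty hK)
  intro u hu v hv
  refine ⟨u * v, (hM.mul_mem_cutoffs hu hv).1, fun m hm => ⟨hm.1, ?_⟩, fun m hm => ⟨hm.1, ?_⟩⟩
  · exact (hM.mul_mem_cutoffs hu hv).2.sub_trans hm.2
  · refine IsPos.sub_trans ?_ hm.2
    rw [hM.comm u hu.2.2.1 v hv.2.2.1]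
    exact (hM.mul_mem_cutoffs hv hu).2

lemma IsTopography.cutoffFilter_neBot (hM : IsTopography M) {K : Set (Spectrum M)}
    (hK : IsCompact K) : (cutoffFilter M K).NeBot :=
  (hM.hasBasis_cutoffFilter hK).neBot_iff.mpr fun {u} hu => ⟨u, hu, by simpa using isPos_zero⟩

lemma IsTopography.eventually_mem_cutoffs (hM : IsTopography M) {K : Set (Spectrum M)}
    (hK : IsCompact K) {u : A} (hu : u ∈ cutoffs M K) :
    ∀ᶠ m in cutoffFilter M K, m ∈ cutoffs M K ∧ IsPos (u - m) :=
  (hM.hasBasis_cutoffFilter hK).mem_of_mem hu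

lemma IsTopography.isPos_sub_mul_self (hM : IsTopography M) {m : A} (h : m ∈ M)
    (h1 : ∀ x : Spectrum M, 0 ≤ x ⟨m, h⟩ ∧ x ⟨m, h⟩ ≤ 1) : IsPos (m - m * m) := by
  refine (hM.isPos_iff (sub_mem h (mul_mem h h))).mpr fun x => ?_
  rw [map_mk_sub x h (mul_mem h h), map_mk_mul x h h, sub_nonneg]
  exact mul_le_of_le_one_right (h1 x).1 (h1 x).2

/-- Values of a state at cut-off functions decrease along the net and never exceed 1, so the limit
is 1 only if every value is 1. This removes the limit from the definition. -/
lemma IsTopography.mem_localStates_iff (hM : IsTopography M) {K : Set (Spectrum M)}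
    (hK : IsCompact K) {φ : WeakDual ℂ A} :
    φ ∈ localStates M K ↔ φ ∈ states A ∧ ∀ m ∈ cutoffs M K, φ m = 1 := by
  have hne := hM.cutoffFilter_neBot hK
  refine and_congr_right fun hφ => ⟨fun h u hu => ?_, fun h => ?_⟩
  · have h1 : 1 ≤ (φ u).re := by
      have h2 : Tendsto (fun m => (φ m).re) (cutoffFilter M K) (𝓝 1) :=
        (Complex.continuous_re.tendsto _).comp h
      refine le_of_tendsto h2 ?_
      filter_upwards [hM.eventually_mem_cutoffs hK hu] with m hm
      have := (Complex.nonneg_iff.mp (IsPosFun.of_isPos hφ.1 hm.2)).1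
      rw [map_sub, Complex.sub_re] at this
      linarith
    have h3 : (φ u).re ≤ 1 :=
      (Complex.re_le_norm _).trans ((norm_state_apply_le hφ u).trans hu.2.1)
    rw [IsPosFun.eq_re hφ.1 hu.1.isSelfAdjoint, le_antisymm h3 h1, Complex.ofReal_one]
  · obtain ⟨u, hu⟩ := hM.cutoffs_nonempty hK
    refine tendsto_const_nhds.congr' ?_
    filter_upwards [hM.eventually_mem_cutoffs hK hu] with m hm
    exact (h m hm.1).symm

lemma localStates_mono_of_isCompact (hM : IsTopography M) {K K' : Set (Spectrum M)}
    (hK : IsCompact K) (hK' : IsCompact K') (h : K ⊆ K') : localStates M K ⊆ localStates M K' :=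
  fun φ hφ => by
    rw [hM.mem_localStates_iff hK] at hφ
    exact (hM.mem_localStates_iff hK').mpr ⟨hφ.1, fun m hm => hφ.2 m (cutoffs_anti h hm)⟩

/-- A state which takes the value one at `m` is unchanged by multiplication with `m`. -/
lemma state_mul_eq {φ : WeakDual ℂ A} (hφ : φ ∈ states A) {m : A} (hm : IsSelfAdjoint m)
    (hm1 : ‖m‖ ≤ 1) (h : φ m = 1) (a : A) : φ (m * a) = φ a := by
  obtain ⟨l, hl, hu⟩ := exists_approx_unit A
  have := hl.neBot
  have hpf : IsPosFun φ := hφ.1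
  have hu' : ∀ᶠ u in l, IsSelfAdjoint u ∧ ‖u‖ ≤ 1 := hu.mono fun u hu => ⟨hu.1.isSelfAdjoint, hu.2⟩
  have h1 := hpf.tendsto_mul_self hl hu'
  rw [(mem_states_iff.mp hφ).2, Complex.ofReal_one] at h1
  have hc := (WeakDual.toStrongDual φ).continuous
  -- The inequality φ(m)² ≤ φ(m²) comes from Cauchy-Schwarz for φ(mu), in the limit over an
  -- approximate unit u.
  have hmm : φ (m * m) = 1 := by
    have h2 : ‖φ m‖ ^ 2 ≤ (φ (m * m)).re := by
      have h4 : ∀ᶠ u in l, ‖φ (m * u)‖ ^ 2 ≤ (φ (m * m)).re := by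
        filter_upwards [hu'] with u hu
        refine (hpf.cauchy_schwarz_of_isSelfAdjoint hm u).trans ?_
        refine mul_le_of_le_one_right (hpf.re_mul_self_nonneg hm) ?_
        refine (Complex.re_le_norm _).trans ((norm_state_apply_le hφ _).trans ?_)
        rw [CStarRing.norm_star_mul_self]
        nlinarith [hu.2, norm_nonneg u]
      exact le_of_tendsto (((hc.tendsto _).comp (hl.tendsto_mul_left m)).norm.pow 2) h4
    rw [h, norm_one, one_pow] at h2
    have h3 : (φ (m * m)).re ≤ 1 := by
      refine (Complex.re_le_norm _).trans ((norm_state_apply_le hφ _).trans ?_)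
      refine (norm_mul_le _ _).trans ?_
      nlinarith [norm_nonneg m]
    rw [hpf.eq_re (by rw [IsSelfAdjoint, star_mul, hm.star_eq]), le_antisymm h3 h2,
      Complex.ofReal_one]
  -- The substitute for φ((1 − m)²) = 0. By Cauchy-Schwarz it makes φ((u − m)a), whose limit is φ(a)
  -- − φ(ma), tend to zero.
  have h5 : Tendsto (fun u => φ ((u - m) * (u - m))) l (𝓝 0) := by
    have h6 : Tendsto (fun u => φ (u * u) - φ (u * m) - φ (m * u) + φ (m * m)) l
        (𝓝 (1 - φ m - φ m + φ (m * m))) :=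
      ((h1.sub ((hc.tendsto _).comp (hl.tendsto_mul_right m))).sub
        ((hc.tendsto _).comp (hl.tendsto_mul_left m))).add_const _
    rw [h, hmm] at h6
    norm_num at h6
    refine h6.congr fun u => ?_
    rw [← hmm, ← map_sub, ← map_sub, ← map_add]
    congr 1
    noncomm_ring
  have h6 : Tendsto (fun u => φ ((u - m) * a)) l (𝓝 (φ a - φ (m * a))) := by
    have : Tendsto (fun u => φ (u * a) - φ (m * a)) l (𝓝 (φ a - φ (m * a))) :=
      ((hc.tendsto _).comp (hl.tendsto_mul_right a)).sub_const _
    refine this.congr fun u => ?_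
    rw [← map_sub, sub_mul]
  have h7 : ‖φ a - φ (m * a)‖ ^ 2 ≤ 0 := by
    have h8 : Tendsto (fun u => (φ ((u - m) * (u - m))).re * (φ (star a * a)).re) l (𝓝 0) := by
      have := ((Complex.continuous_re.tendsto _).comp h5).mul_const (φ (star a * a)).re
      simpa using this
    refine le_of_tendsto_of_tendsto (h6.norm.pow 2) h8 ?_
    filter_upwards [hu'] with u hu
    exact hpf.cauchy_schwarz_of_isSelfAdjoint (hu.1.sub hm) a
  have h8 : ‖φ a - φ (m * a)‖ = 0 := pow_eq_zero_iff two_ne_zero |>.mp (le_antisymm h7 (sq_nonneg _))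
  exact (sub_eq_zero.mp (norm_eq_zero.mp h8)).symm

lemma state_mul_eq' {φ : WeakDual ℂ A} (hφ : φ ∈ states A) {m : A} (hm : IsSelfAdjoint m)
    (hm1 : ‖m‖ ≤ 1) (h : φ m = 1) (a : A) : φ (a * m) = φ a := by
  have h1 := state_mul_eq hφ hm hm1 h (star a)
  have h2 : star (m * star a) = a * m := by rw [star_mul, star_star, hm.star_eq]
  rw [← h2, IsPosFun.map_star hφ.1, h1, IsPosFun.map_star hφ.1, star_star]

lemma IsTopography.cornerValue_of_mem_localStates (hM : IsTopography M) {K K' : Set (Spectrum M)}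
    (hK : IsCompact K) (hK' : IsCompact K') (hKK' : K ⊆ K') {φ : WeakDual ℂ A}
    (hφ : φ ∈ localStates M K) (a : A) : CornerValue M K' φ a (φ a) := by
  obtain ⟨u, hu⟩ := hM.cutoffs_nonempty hK'
  have h1 := (hM.mem_localStates_iff hK).mp hφ
  refine tendsto_const_nhds.congr' ?_
  filter_upwards [hM.eventually_mem_cutoffs hK' hu] with m hm
  have hm1 := h1.2 m (cutoffs_anti hKK' hm.1)
  rw [state_mul_eq' hφ.1 hm.1.1.isSelfAdjoint hm.1.2.1 hm1,
    state_mul_eq hφ.1 hm.1.1.isSelfAdjoint hm.1.2.1 hm1]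

lemma IsTopography.isTame_localStates (hM : IsTopography M) {K : Set (Spectrum M)}
    (hK : IsCompact K) (L : A → ℝ≥0∞) : IsTame L M (localStates M K) := by
  intro ε hε
  refine ⟨K, hK, fun K' hK' hKK' φ hφ a _ => ⟨φ a,
    hM.cornerValue_of_mem_localStates hK hK' hKK' hφ a, by simpa using hε.le⟩⟩

/-- Having norm one is not a weak* closed condition, but it follows from the closed conditions ‖φ‖ ≤
1 and φ(u) = 1 for a cut-off function u. -/
lemma isCompact_localStates (hM : IsTopography M) {K : Set (Spectrum M)}
    (hK : IsCompact K) : IsCompact (localStates M K) := by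
  obtain ⟨u, hu⟩ := hM.cutoffs_nonempty hK
  have h : localStates M K = WeakDual.toStrongDual ⁻¹' Metric.closedBall (0 : StrongDual ℂ A) 1 ∩
      ((⋂ a : A, {φ : WeakDual ℂ A | 0 ≤ φ (star a * a)}) ∩
        ⋂ m ∈ cutoffs M K, {φ : WeakDual ℂ A | φ m = 1}) := by
    ext φ
    rw [hM.mem_localStates_iff hK, mem_states_iff]
    simp only [mem_inter_iff, mem_preimage, mem_closedBall_zero_iff, mem_iInter]
    constructor
    · rintro ⟨⟨h1, h2⟩, h3⟩
      exact ⟨h2.le, h1, h3⟩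
    · rintro ⟨h1, h2, h3⟩
      refine ⟨⟨h2, le_antisymm h1 ?_⟩, h3⟩
      have h4 := norm_apply_le_fnorm φ u
      rw [show φ u = 1 from h3 u hu, norm_one] at h4
      nlinarith [fnorm_nonneg φ, hu.2.1]
  rw [h]
  refine (WeakDual.isCompact_closedBall 0 1).inter_right (IsClosed.inter ?_ ?_)
  · exact isClosed_iInter fun a => (isClosed_Ici (a := (0 : ℂ))).preimage (WeakDual.eval_continuous _)
  · exact isClosed_biInter fun m _ => isClosed_eq (WeakDual.eval_continuous _) continuous_const

/-- The elements of the topography with values in the unit interval and supported in `K`. -/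
def bumps (M : NonUnitalStarSubalgebra ℂ A) (K : Set (Spectrum M)) : Set A :=
  {h | ∃ hh : h ∈ M, (∀ x : Spectrum M, 0 ≤ x ⟨h, hh⟩ ∧ x ⟨h, hh⟩ ≤ 1) ∧
    ∀ x : Spectrum M, x ∉ K → x ⟨h, hh⟩ = 0}

lemma IsTopography.cutoff_mul_of_support (hM : IsTopography M) {K : Set (Spectrum M)} {m h : A}
    (hm : m ∈ cutoffs M K) (hh : h ∈ M) (h0 : ∀ x : Spectrum M, x ∉ K → x ⟨h, hh⟩ = 0) :
    m * h = h := by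
  obtain ⟨h1, -, h3⟩ := hM.mem_cutoffs_iff.mp hm
  refine hM.ext_char (mul_mem h1 hh) hh fun x => ?_
  rw [map_mk_mul x h1 hh]
  by_cases hx : x ∈ K
  · rw [h3 x hx, one_mul]
  · rw [h0 x hx, mul_zero]

lemma IsTopography.isPos_of_mem_bumps (hM : IsTopography M) {K : Set (Spectrum M)} {h : A}
    (hh : h ∈ bumps M K) : IsPos h :=
  (hM.isPos_iff hh.1).mpr fun x => (hh.2.1 x).1

/-- The function max(t − δ, 0) moves a positive contraction u of `M` by at most δ in norm and makes
it vanish off the compact set |u| ≥ δ. Apply it to an approximate unit of `M` and let δ tend to 0.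
-/
lemma IsTopography.exists_approx_bumps (hM : IsTopography M) :
    ∃ l : Filter A, l.IsApproximateUnit ∧ ∀ᶠ u in l, ∃ K : Set (Spectrum M),
      IsCompact K ∧ u ∈ bumps M K := by
  let _ := hM.commCStar
  obtain ⟨l₀, hl₀, hu₀⟩ := exists_approx_unit M
  have := hl₀.neBot
  let f : ℝ → ℝ → ℝ := fun δ t => max (t - δ) 0
  have hf : ∀ δ, Continuous (f δ) := fun δ => by fun_prop
  let F : M × ℝ → A := fun p => ((cfcₙ (f p.2) p.1 : M) : A)
  have hF : ∀ᶠ p in l₀ ×ˢ 𝓝[>] (0 : ℝ), ‖F p - p.1‖ ≤ p.2 ∧ ∃ K : Set (Spectrum M),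
      IsCompact K ∧ F p ∈ bumps M K := by
    filter_upwards [hu₀.prod_mk (self_mem_nhdsWithin : Ioi (0 : ℝ) ∈ 𝓝[>] (0 : ℝ))] with p hp
    have hδ : 0 < p.2 := hp.2
    have hsa : IsSelfAdjoint p.1 := hp.1.1.isSelfAdjoint
    have hf0 : f p.2 0 = 0 := by simp [f, hδ.le]
    have hx : ∀ x : WeakDual.characterSpace ℂ M, x (cfcₙ (f p.2) p.1) = (f p.2 (x p.1).re : ℂ) :=
      char_cfc hsa _ (hf _) hf0
    have hpos : ∀ x : WeakDual.characterSpace ℂ M, 0 ≤ (x p.1).re := fun x => by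
      obtain ⟨b, hb⟩ := hp.1.1
      rw [hb, map_mul, char_star]
      exact (Complex.nonneg_iff.mp (star_mul_self_nonneg (R := ℂ) _)).1
    have hle : ∀ x : WeakDual.characterSpace ℂ M, (x p.1).re ≤ 1 := fun x =>
      (Complex.re_le_norm _).trans ((norm_char_le x _).trans hp.1.2)
    constructor
    · refine norm_le_of_char (y := cfcₙ (f p.2) p.1 - p.1) hδ.le fun x => ?_
      rw [map_sub, hx, char_eq_re hsa x, Complex.ofReal_re, ← Complex.ofReal_sub,
        Complex.norm_real, Real.norm_eq_abs, abs_le]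
      simp only [f]
      constructor <;> rcases max_cases ((x p.1).re - p.2) 0 with h | h <;> linarith [hpos x]
    · refine ⟨_, isCompact_char_ge p.1 hδ, (cfcₙ (f p.2) p.1 : M).2, fun x => ?_, fun x hxK => ?_⟩
      · change 0 ≤ x (cfcₙ (f p.2) p.1) ∧ x (cfcₙ (f p.2) p.1) ≤ 1
        rw [hx]
        constructor
        · exact_mod_cast le_max_right _ _
        · have : f p.2 (x p.1).re ≤ 1 := max_le (by linarith [hle x]) zero_le_one
          exact_mod_cast this
      · change x (cfcₙ (f p.2) p.1) = 0
        rw [hx]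
        have h1 : ¬ p.2 ≤ ‖x p.1‖ := hxK
        have h2 := Complex.re_le_norm (x p.1)
        have : f p.2 (x p.1).re = 0 := max_eq_right (by linarith)
        rw [this, Complex.ofReal_zero]
  obtain ⟨l₁, hl₁, hM₁⟩ := hM.approx
  have := hl₁.neBot
  -- An approximate unit of `M` is one of `A`: since `M` contains an approximate unit of `A`, some m
  -- in `M` satisfies am ≈ a, and then mu ≈ m.
  have hleft : ∀ a : A, Tendsto (fun u : M => a * (u : A)) l₀ (𝓝 a) := by
    intro a
    rw [Metric.tendsto_nhds]
    intro ε hε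
    have h1 := (hl₁.tendsto_mul_left a).eventually (Metric.ball_mem_nhds a (ε := ε / 3) (by positivity))
    obtain ⟨m, hm, hmM⟩ := (h1.and hM₁).exists
    have h2 : Tendsto (fun u : M => ‖a‖ * ‖(⟨m, hmM⟩ : M) * u - ⟨m, hmM⟩‖) l₀ (𝓝 0) := by
      have := ((hl₀.tendsto_mul_left (⟨m, hmM⟩ : M)).sub_const ⟨m, hmM⟩).norm.const_mul ‖a‖
      simpa using this
    filter_upwards [hu₀, h2.eventually (gt_mem_nhds (show 0 < ε / 3 by positivity))] with u hu h3
    have h4 : ‖m * (u : A) - m‖ * ‖a‖ < ε / 3 := by rw [mul_comm]; exact h3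
    have h5 : ‖a * m - a‖ < ε / 3 := by rw [← dist_eq_norm]; exact hm
    have hu1 : ‖(u : A)‖ ≤ 1 := hu.2
    rw [dist_eq_norm]
    have h6 : a * (u : A) - a = (a - a * m) * u + a * (m * u - m) + (a * m - a) := by noncomm_ring
    rw [h6]
    have h7 : ‖(a - a * m) * (u : A)‖ ≤ ‖a * m - a‖ := by
      rw [norm_sub_rev]
      exact (norm_mul_le _ _).trans (mul_le_of_le_one_right (norm_nonneg _) hu1)
    have h8 : ‖a * (m * (u : A) - m)‖ ≤ ‖m * (u : A) - m‖ * ‖a‖ := by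
      rw [mul_comm ‖m * (u : A) - m‖]
      exact norm_mul_le _ _
    have h9 := norm_add₃_le (a := (a - a * m) * (u : A)) (b := a * (m * u - m)) (c := a * m - a)
    linarith
  have hF0 : Tendsto (fun p => F p - p.1) (l₀ ×ˢ 𝓝[>] (0 : ℝ)) (𝓝 0) := by
    refine squeeze_zero_norm' (hF.mono fun p hp => hp.1) ?_
    exact (tendsto_nhdsWithin_of_tendsto_nhds tendsto_id).comp tendsto_snd
  have hFl : ∀ a, Tendsto (fun p => a * F p) (l₀ ×ˢ 𝓝[>] (0 : ℝ)) (𝓝 a) := fun a => by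
    have h1 : Tendsto (fun p : M × ℝ => a * (p.1 : A)) (l₀ ×ˢ 𝓝[>] (0 : ℝ)) (𝓝 a) :=
      (hleft a).comp tendsto_fst
    have h2 := h1.add (hF0.const_mul a)
    rw [mul_zero, add_zero] at h2
    exact h2.congr fun p => by noncomm_ring
  refine ⟨map F (l₀ ×ˢ 𝓝[>] (0 : ℝ)), ⟨fun a => tendsto_map'_iff.mpr (hFl a), fun a => ?_⟩,
    hF.mono fun p hp => hp.2⟩
  have h1 := ((continuous_star.tendsto _).comp (hFl (star a)))
  rw [star_star] at h1
  rw [tendsto_map'_iff]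
  refine h1.congr' ?_
  filter_upwards [hF] with p hp
  obtain ⟨-, K, -, hK⟩ := hp
  simp only [Function.comp_apply]
  rw [star_mul, star_star, (hM.isPos_of_mem_bumps hK).isSelfAdjoint.star_eq]

/-- Characters of the topography extend to states. -/
lemma IsTopography.exists_state_extending (hM : IsTopography M) (x : Spectrum M) :
    ∃ φ ∈ states A, ∀ m : M, φ m = x m := by
  let _ := hM.commCStar
  obtain ⟨g, hg1, hg2⟩ := exists_extension_norm_eq (𝕜 := ℂ) M.toSubmodule
    (WeakDual.CharacterSpace.toCLM x)
  have hgn : ‖g‖ ≤ 1 := by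
    rw [hg2]
    exact ContinuousLinearMap.opNorm_le_bound _ zero_le_one fun b => by
      rw [one_mul]
      exact norm_char_le x b
  have hgx : ∀ m : M, g m = x m := hg1
  obtain ⟨l₀, hl₀, hu₀⟩ := exists_approx_unit M
  have := hl₀.neBot
  obtain ⟨e, he⟩ : ∃ e, x e ≠ 0 := by
    by_contra! h0
    exact x.2.1 (DFunLike.ext _ _ h0)
  have hx1 : Tendsto (fun u => x u) l₀ (𝓝 1) := by
    have h1 : Tendsto (fun u => x (u * e) * (x e)⁻¹) l₀ (𝓝 (x e * (x e)⁻¹)) :=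
      (((map_continuous x).tendsto _).comp (hl₀.tendsto_mul_right e)).mul_const _
    rw [mul_inv_cancel₀ he] at h1
    refine h1.congr fun u => ?_
    rw [map_mul, mul_assoc, mul_inv_cancel₀ he, mul_one]
  obtain ⟨φ, hφ, hφg⟩ := exists_state_of_tendsto (l := map (Subtype.val : M → A) l₀) g hgn
    (by
      rw [eventually_map]
      filter_upwards [hu₀] with u hu
      obtain ⟨b, hb⟩ := hu.1
      exact ⟨⟨b, congrArg Subtype.val hb⟩, hu.2⟩)
    (by
      rw [tendsto_map'_iff]
      exact hx1.congr fun u => (hgx u).symm)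
  refine ⟨φ, hφ, fun m => ?_⟩
  have h1 : g (star (m : A)) = star (x m) := by
    rw [← char_star, ← hgx]
    rfl
  rw [hφg, hgx, h1, star_star]
  ring

lemma IsTopography.exists_localState_extending (hM : IsTopography M) {K : Set (Spectrum M)}
    (hK : IsCompact K) {x : Spectrum M} (hx : x ∈ K) :
    ∃ φ ∈ localStates M K, ∀ m : M, φ m = x m := by
  obtain ⟨φ, hφ, h⟩ := hM.exists_state_extending x
  refine ⟨φ, (hM.mem_localStates_iff hK).mpr ⟨hφ, fun m hm => ?_⟩, h⟩
  obtain ⟨hm1, -, hm2⟩ := hM.mem_cutoffs_iff.mp hm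
  exact (h ⟨m, hm1⟩).trans (hm2 x hx)

end Topography

/-- Each tⁱ with i < n is at least tⁿ, and (1 − t) times the sum of these powers telescopes to 1 −
tⁿ. -/
lemma nat_mul_pow_mul_one_sub_le {t : ℝ} (h0 : 0 ≤ t) (h1 : t ≤ 1) (n : ℕ) :
    n * (t ^ n * (1 - t)) ≤ 1 := by
  have h2 : (n : ℝ) * t ^ n ≤ ∑ i ∈ Finset.range n, t ^ i := by
    have := Finset.card_nsmul_le_sum (Finset.range n) (fun i => t ^ i) (t ^ n) fun i hi =>
      pow_le_pow_of_le_one h0 h1 (Finset.mem_range.mp hi).le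
    simpa using this
  have h3 : (∑ i ∈ Finset.range n, t ^ i) * (1 - t) = 1 - t ^ n := geom_sum_mul_neg t n
  have h4 : 0 ≤ t ^ n := pow_nonneg h0 n
  nlinarith [mul_le_mul_of_nonneg_right h2 (sub_nonneg.mpr h1)]

section MK

variable {B : Type*} {L : B → ℝ≥0∞}

lemma mkDist_le_iff {φ ψ : B → ℂ} {c : ℝ} (hc : 0 ≤ c) :
    mkDist L φ ψ ≤ ENNReal.ofReal c ↔ ∀ b, L b ≤ 1 → ‖φ b - ψ b‖ ≤ c := by
  unfold mkDist
  rw [iSup₂_le_iff]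
  refine forall₂_congr fun b _ => ?_
  rw [edist_dist, dist_eq_norm, ENNReal.ofReal_le_ofReal_iff hc]

end MK

/-! ### Locally supported elements, and the Monge-Kantorovich metric on local states -/

section Localization

variable {A : Type u} [NonUnitalCStarAlgebra A] {M : NonUnitalStarSubalgebra ℂ A}

lemma IsTopography.exists_pow_cutoff (hM : IsTopography M) {K : Set (Spectrum M)} {u : A}
    (hu : u ∈ cutoffs M K) (h : u ∈ M) (n : ℕ) :
    ∃ v ∈ cutoffs M K, ∃ hv : v ∈ M, ∀ x : Spectrum M, x ⟨v, hv⟩ = x ⟨u, h⟩ ^ (n + 1) := by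
  induction n with
  | zero => exact ⟨u, hu, h, fun x => by simp⟩
  | succ n ih =>
    obtain ⟨v, hv, hv', hvx⟩ := ih
    refine ⟨v * u, (hM.mul_mem_cutoffs hv hu).1, mul_mem hv' h, fun x => ?_⟩
    rw [map_mk_mul x hv' h, hvx, pow_succ _ (n + 1)]

/-- Eventually m ≤ uⁿ⁺¹, hence m(1 − u) ≤ uⁿ⁺¹(1 − u) ≤ 1/(n + 1). So u acts as the identity on late
cut-off functions in norm, although the net itself only converges strongly. -/
lemma IsTopography.tendsto_sub_mul (hM : IsTopography M) {K : Set (Spectrum M)}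
    (hK : IsCompact K) {u : A} (hu : u ∈ cutoffs M K) :
    Tendsto (fun m => m - m * u) (cutoffFilter M K) (𝓝 0) := by
  let _ := hM.commCStar
  obtain ⟨h, h1, -⟩ := hM.mem_cutoffs_iff.mp hu
  rw [Metric.tendsto_nhds]
  intro ε hε
  obtain ⟨n, hn⟩ := exists_nat_one_div_lt hε
  obtain ⟨v, hv, hvM, hvx⟩ := hM.exists_pow_cutoff hu h n
  filter_upwards [hM.eventually_mem_cutoffs hK hv] with m hm
  obtain ⟨hmM, h2, -⟩ := hM.mem_cutoffs_iff.mp hm.1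
  rw [dist_zero_right]
  refine lt_of_le_of_lt ?_ hn
  have hmu : m - m * u ∈ M := sub_mem hmM (mul_mem hmM h)
  refine norm_le_of_char (y := (⟨m - m * u, hmu⟩ : M)) (by positivity) fun x => ?_
  have e1 : x ⟨m - m * u, hmu⟩ = x ⟨m, hmM⟩ * (1 - x ⟨u, h⟩) := by
    rw [map_mk_sub x hmM (mul_mem hmM h), map_mk_mul x hmM h]
    ring
  have e2 := (hM.isPos_iff (sub_mem hvM hmM)).mp hm.2 x
  rw [map_mk_sub x hvM hmM, hvx, sub_nonneg] at e2
  obtain ⟨p1, p2⟩ := h1 x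
  obtain ⟨q1, q2⟩ := h2 x
  rw [Complex.eq_coe_norm_of_nonneg p1] at p2 e2
  rw [e1, norm_mul]
  rw [Complex.eq_coe_norm_of_nonneg p1, Complex.eq_coe_norm_of_nonneg q1]
  rw [Complex.eq_coe_norm_of_nonneg q1] at e2
  set t := ‖x ⟨u, h⟩‖
  set s := ‖x ⟨m, hmM⟩‖
  have ht1 : t ≤ 1 := by exact_mod_cast p2
  have hts : s ≤ t ^ (n + 1) := by exact_mod_cast e2
  have h5 : ‖(1 : ℂ) - (t : ℂ)‖ = 1 - t := by
    rw [← Complex.ofReal_one, ← Complex.ofReal_sub, Complex.norm_real,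
      Real.norm_of_nonneg (sub_nonneg.mpr ht1)]
  rw [h5, Complex.norm_real, norm_norm]
  have h6 := nat_mul_pow_mul_one_sub_le (norm_nonneg _ : 0 ≤ t) ht1 (n + 1)
  push_cast at h6
  have h7 : s * (1 - t) ≤ t ^ (n + 1) * (1 - t) :=
    mul_le_mul_of_nonneg_right hts (sub_nonneg.mpr ht1)
  rw [le_div_iff₀ (by positivity)]
  nlinarith

lemma eq_zero_of_fnorm_eq_zero {φ : WeakDual ℂ A} (h : fnorm φ = 0) (a : A) : φ a = 0 := by
  have := norm_apply_le_fnorm φ a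
  rw [h, zero_mul] at this
  exact norm_le_zero_iff.mp this

/-- The elements supported in a compact set are those fixed by its cut-off functions. -/
lemma IsTopography.mem_Loc_iff (hM : IsTopography M) {K : Set (Spectrum M)}
    (hK : IsCompact K) {L : A → ℝ≥0∞} {a : A} :
    a ∈ Loc L M K ↔ IsSelfAdjoint a ∧ (∀ u ∈ cutoffs M K, u * a = a) ∧ L a < ⊤ := by
  have hne := hM.cutoffFilter_neBot hK
  obtain ⟨u₀, hu₀⟩ := hM.cutoffs_nonempty hK
  refine and_congr_right fun ha => and_congr_left fun _ => ⟨fun h => ?_, fun h φ hφ => ?_⟩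
  -- The defining identity, tested on the compression of φ by u, gives φ(u(mam)u) → φ(uau). Since
  -- mam − u(mam)u → 0 in norm and φ(mam) → φ(a), the limits φ(uau) and φ(a) agree for every state.
  · have key : ∀ u ∈ cutoffs M K, u * a * u = a := by
      intro u hu
      have hus := hu.1.isSelfAdjoint
      refine eq_of_states (by simpa [hus.star_eq] using ha.conjugate u) ha fun φ hφ => ?_
      have hpf : IsPosFun φ := hφ.1
      have hc := (WeakDual.toStrongDual φ).continuous
      have h1 : Tendsto (fun m => φ (u * (m * a * m) * u)) (cutoffFilter M K)
          (𝓝 (φ (u * a * u))) := by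
        by_cases h0 : fnorm (compress φ u) = 0
        · have : ∀ b, φ (u * b * u) = 0 := fun b => eq_zero_of_fnorm_eq_zero h0 b
          simp only [this]
          exact tendsto_const_nhds
        · have h2 := h _ ((hpf.compress hus).normalize_mem_states h0)
          have h3 := Tendsto.const_mul (fnorm (compress φ u) : ℂ) h2
          have h4 : ∀ b, (fnorm (compress φ u) : ℂ) *
              ((((fnorm (compress φ u))⁻¹ : ℝ) : ℂ) • compress φ u) b = φ (u * b * u) := by
            intro b
            change (fnorm (compress φ u) : ℂ) * ((((fnorm (compress φ u))⁻¹ : ℝ) : ℂ) *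
              φ (u * b * u)) = φ (u * b * u)
            rw [← mul_assoc, ← Complex.ofReal_mul, mul_inv_cancel₀ h0, Complex.ofReal_one, one_mul]
          simpa only [h4] using h3
      have h5 := h φ hφ
      refine tendsto_nhds_unique h1 ?_
      have h6 : Tendsto (fun m => m * a * m - u * (m * a * m) * u) (cutoffFilter M K) (𝓝 0) := by
        have h7 : Tendsto (fun m => ‖a‖ * ‖m - m * u‖ + ‖a‖ * ‖m - m * u‖) (cutoffFilter M K)
            (𝓝 0) := by
          have := ((hM.tendsto_sub_mul hK hu).norm.const_mul ‖a‖)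
          simpa using this.add this
        refine squeeze_zero_norm' ?_ h7
        filter_upwards [hM.eventually_mem_cutoffs hK hu] with m hm
        have hm1 : ‖m‖ ≤ 1 := hm.1.2.1
        have hu1 : ‖u‖ ≤ 1 := hu.2.1
        have hcomm : u * m = m * u := hM.comm u hu.2.2.1 m hm.1.2.2.1
        have e : m * a * m - u * (m * a * m) * u =
            (m - u * m) * (a * m) + (u * m) * (a * (m - m * u)) := by noncomm_ring
        rw [e, hcomm]
        refine (norm_add_le _ _).trans (add_le_add ?_ ?_)
        · refine (norm_mul_le _ _).trans ?_
          rw [mul_comm]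
          refine mul_le_mul_of_nonneg_right ?_ (norm_nonneg _)
          exact (norm_mul_le _ _).trans (mul_le_of_le_one_right (norm_nonneg _) hm1)
        · refine (norm_mul_le _ _).trans ?_
          have : ‖m * u‖ ≤ 1 := (norm_mul_le _ _).trans (mul_le_one₀ hm1 (norm_nonneg _) hu1)
          exact (mul_le_of_le_one_left (norm_nonneg _) this).trans (norm_mul_le _ _)
      have h8 : Tendsto (fun m => φ (m * a * m) - φ (u * (m * a * m) * u)) (cutoffFilter M K)
          (𝓝 0) := by
        have := (hc.tendsto _).comp h6
        rw [map_zero] at this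
        exact this.congr fun m => map_sub φ _ _
      have := h5.sub h8
      simpa using this
    intro u hu
    -- A constant net: substituting a = mam gives a − ua = (m − mu)(am), which tends to zero.
    have h1 : Tendsto (fun m => a - u * a) (cutoffFilter M K) (𝓝 0) := by
      have h7 : Tendsto (fun m => ‖m - m * u‖ * ‖a‖) (cutoffFilter M K) (𝓝 0) := by
        simpa using (hM.tendsto_sub_mul hK hu).norm.mul_const ‖a‖
      refine squeeze_zero_norm' ?_ h7
      filter_upwards [hM.eventually_mem_cutoffs hK hu] with m hm
      have hcomm : u * m = m * u := hM.comm u hu.2.2.1 m hm.1.2.2.1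
      have e : a - u * a = (m - m * u) * (a * m) := by
        conv_lhs => rw [← key m hm.1]
        rw [← hcomm]
        noncomm_ring
      rw [e]
      refine (norm_mul_le _ _).trans (mul_le_mul_of_nonneg_left ?_ (norm_nonneg _))
      exact (norm_mul_le _ _).trans (mul_le_of_le_one_right (norm_nonneg _) hm.1.2.1)
    exact (sub_eq_zero.mp (tendsto_nhds_unique h1 tendsto_const_nhds).symm).symm
  · refine tendsto_const_nhds.congr' ?_
    filter_upwards [hM.eventually_mem_cutoffs hK hu₀] with m hm
    have h1 := h m hm.1
    have h2 : a * m = a := by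
      have := congrArg star h1
      rwa [star_mul, ha.star_eq, hm.1.1.isSelfAdjoint.star_eq] at this
    rw [h1, h2]

lemma IsTopography.mem_localStates_of_le (hM : IsTopography M) {K : Set (Spectrum M)}
    (hK : IsCompact K) {φ : WeakDual ℂ A} (h1 : IsPosFun φ) (h2 : fnorm φ ≤ 1)
    (h3 : ∀ m ∈ cutoffs M K, φ m = 1) : φ ∈ localStates M K := by
  obtain ⟨u, hu⟩ := hM.cutoffs_nonempty hK
  refine (hM.mem_localStates_iff hK).mpr ⟨mem_states_iff.mpr ⟨h1, le_antisymm h2 ?_⟩, h3⟩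
  have h4 := norm_apply_le_fnorm φ u
  rw [h3 u hu, norm_one] at h4
  nlinarith [fnorm_nonneg φ, hu.2.1]

lemma IsTopography.convexCombo_mem_localStates (hM : IsTopography M) {K : Set (Spectrum M)}
    (hK : IsCompact K) {φ ψ : WeakDual ℂ A} (hφ : φ ∈ localStates M K) (hψ : ψ ∈ localStates M K)
    {t : ℝ} (h0 : 0 ≤ t) (h1 : t ≤ 1) :
    ((1 - t : ℝ) : ℂ) • φ + (t : ℂ) • ψ ∈ localStates M K := by
  have hφ' := (hM.mem_localStates_iff hK).mp hφ
  have hψ' := (hM.mem_localStates_iff hK).mp hψ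
  refine hM.mem_localStates_of_le hK (fun a => ?_) ?_ fun m hm => ?_
  · exact add_nonneg (IsPosFun.smul hφ.1.1 (sub_nonneg.mpr h1) a) (IsPosFun.smul hψ.1.1 h0 a)
  · have e : fnorm (((1 - t : ℝ) : ℂ) • φ + (t : ℂ) • ψ) ≤
        fnorm (((1 - t : ℝ) : ℂ) • φ) + fnorm ((t : ℂ) • ψ) := by
      unfold fnorm
      rw [map_add]
      exact norm_add_le _ _
    rw [fnorm_smul, fnorm_smul, Complex.norm_real, Complex.norm_real,
      (mem_states_iff.mp hφ.1).2, (mem_states_iff.mp hψ.1).2, Real.norm_of_nonneg h0,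
      Real.norm_of_nonneg (sub_nonneg.mpr h1)] at e
    linarith
  · change ((1 - t : ℝ) : ℂ) * φ m + (t : ℂ) * ψ m = 1
    rw [hφ'.2 m hm, hψ'.2 m hm]
    push_cast
    ring

variable {L : A → ℝ≥0∞}

/-- Local states of a compact set are tame, so the metrization axiom turns weak* convergence among
them into convergence that is uniform over L ≤ 1. -/
lemma IsQuantumLCMS.eventually_mkDist_le (hQ : IsQuantumLCMS L M) {K : Set (Spectrum M)}
    (hK : IsCompact K) {ι : Type*} {F : Filter ι} {f : ι → WeakDual ℂ A} {φ : WeakDual ℂ A}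
    (hf : ∀ᶠ i in F, f i ∈ localStates M K) (hφ : φ ∈ localStates M K)
    (h : Tendsto f F (𝓝 φ)) {ε : ℝ} (hε : 0 < ε) :
    ∀ᶠ i in F, mkDist L (f i) φ ≤ ENNReal.ofReal ε := by
  classical
  have hS : localStates M K ⊆ states A := fun χ hχ => hχ.1
  have hmet := hQ.metrizes _ hS (hQ.isTopography.isTame_localStates hK L)
  let g : ι → localStates M K := fun i => if hi : f i ∈ localStates M K then ⟨f i, hi⟩ else ⟨φ, hφ⟩
  have hgf : ∀ᶠ i in F, (g i : WeakDual ℂ A) = f i := hf.mono fun i hi => by simp [g, hi]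
  have hg : Tendsto g F (𝓝 (⟨φ, hφ⟩ : localStates M K)) := by
    rw [tendsto_subtype_rng]
    exact h.congr' (hgf.mono fun i hi => hi.symm)
  rw [← hmet] at hg
  let _ := mkPseudoEMetric L (fun (φ : localStates M K) (a : A) => (φ : WeakDual ℂ A) a)
  have h1 := EMetric.tendsto_nhds.mp hg (ENNReal.ofReal ε) (ENNReal.ofReal_pos.mpr hε)
  filter_upwards [h1, hgf] with i hi hi'
  have h2 : mkDist L (g i : WeakDual ℂ A) φ < ENNReal.ofReal ε := hi
  rw [hi'] at h2
  exact h2.le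

/-- If ψₙ were at distance more than n + 1 from φ₀, the convex combinations (1 − 1/(n+1))φ₀ +
ψₙ/(n+1) would converge weak* to φ₀ while staying at distance more than 1, against metrization. -/
lemma IsQuantumLCMS.exists_mkDist_le (hQ : IsQuantumLCMS L M) {K : Set (Spectrum M)}
    (hK : IsCompact K) : ∃ C : ℝ, 0 < C ∧ ∀ φ ∈ localStates M K, ∀ ψ ∈ localStates M K,
      ∀ a, L a ≤ 1 → ‖φ a - ψ a‖ ≤ C := by
  rcases (localStates M K).eq_empty_or_nonempty with h0 | ⟨φ₀, hφ₀⟩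
  · exact ⟨1, one_pos, by simp [h0]⟩
  obtain ⟨C, hC0, hC⟩ : ∃ C : ℝ, 0 < C ∧ ∀ ψ ∈ localStates M K, ∀ a, L a ≤ 1 →
      ‖ψ a - φ₀ a‖ ≤ C := by
    by_contra! hcon
    have h1 : ∀ n : ℕ, ∃ ψ ∈ localStates M K, ∃ a, L a ≤ 1 ∧ (n + 1 : ℝ) < ‖ψ a - φ₀ a‖ :=
      fun n => hcon (n + 1) (by positivity)
    choose ψ hψ a ha hlt using h1
    have ht0 : ∀ n : ℕ, (0 : ℝ) ≤ 1 / (n + 1) := fun n => by positivity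
    have ht1 : ∀ n : ℕ, (1 : ℝ) / (n + 1) ≤ 1 := fun n => by
      rw [div_le_one (by positivity)]; linarith [(Nat.cast_nonneg n : (0 : ℝ) ≤ n)]
    let χ : ℕ → WeakDual ℂ A := fun n =>
      ((1 - 1 / (n + 1) : ℝ) : ℂ) • φ₀ + ((1 / (n + 1) : ℝ) : ℂ) • ψ n
    have hχ : ∀ n, χ n ∈ localStates M K := fun n =>
      hQ.isTopography.convexCombo_mem_localStates hK hφ₀ (hψ n) (ht0 n) (ht1 n)
    have hdiff : ∀ n b, χ n b - φ₀ b = ((1 / (n + 1) : ℝ) : ℂ) * (ψ n b - φ₀ b) := fun n b => by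
      change ((1 - 1 / (n + 1) : ℝ) : ℂ) * φ₀ b + ((1 / (n + 1) : ℝ) : ℂ) * ψ n b - φ₀ b = _
      push_cast
      ring
    have hlim : Tendsto χ atTop (𝓝 φ₀) := by
      rw [tendsto_iff_forall_eval_tendsto_topDualPairing]
      intro b
      change Tendsto (fun n => χ n b) atTop (𝓝 (φ₀ b))
      rw [tendsto_iff_norm_sub_tendsto_zero]
      have h2 : Tendsto (fun n : ℕ => 1 / ((n : ℝ) + 1) * (‖b‖ + ‖b‖)) atTop (𝓝 0) := by
        simpa using tendsto_one_div_add_atTop_nhds_zero_nat.mul_const (‖b‖ + ‖b‖)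
      refine squeeze_zero (fun n => norm_nonneg _) (fun n => ?_) h2
      rw [hdiff, norm_mul, Complex.norm_real, Real.norm_of_nonneg (ht0 n)]
      refine mul_le_mul_of_nonneg_left ((norm_sub_le _ _).trans (add_le_add ?_ ?_)) (ht0 n)
      · exact norm_state_apply_le (hψ n).1 b
      · exact norm_state_apply_le hφ₀.1 b
    obtain ⟨n, hn⟩ := (hQ.eventually_mkDist_le hK (Eventually.of_forall hχ) hφ₀ hlim
      one_pos).exists
    have h3 := (mkDist_le_iff zero_le_one).mp hn (a n) (ha n)
    rw [hdiff, norm_mul, Complex.norm_real, Real.norm_of_nonneg (ht0 n)] at h3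
    have h4 : (0 : ℝ) < n + 1 := by positivity
    rw [one_div, inv_mul_le_iff₀ h4, mul_one] at h3
    exact absurd (hlt n) (not_lt.mpr h3)
  refine ⟨C + C, by positivity, fun φ hφ ψ hψ a ha => ?_⟩
  have h1 := hC φ hφ a ha
  have h2 := hC ψ hψ a ha
  rw [norm_sub_rev] at h2
  calc ‖φ a - ψ a‖ = ‖(φ a - φ₀ a) + (φ₀ a - ψ a)‖ := by rw [sub_add_sub_cancel]
    _ ≤ C + C := (norm_add_le _ _).trans (add_le_add h1 h2)

/-- The state obtained by compressing with a function supported in `K` is supported in `K`. -/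
lemma IsTopography.normalize_compress_mem_localStates (hM : IsTopography M)
    {K : Set (Spectrum M)} (hK : IsCompact K) {φ : WeakDual ℂ A} (hφ : IsPosFun φ) {h : A}
    (hh : h ∈ bumps M K) (h0 : fnorm (compress φ h) ≠ 0) :
    (((fnorm (compress φ h))⁻¹ : ℝ) : ℂ) • compress φ h ∈ localStates M K := by
  have hsa := (hM.isPos_of_mem_bumps hh).isSelfAdjoint
  refine (hM.mem_localStates_iff hK).mpr ⟨(hφ.compress hsa).normalize_mem_states h0, fun m hm => ?_⟩
  change (((fnorm (compress φ h))⁻¹ : ℝ) : ℂ) * φ (h * m * h) = 1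
  rw [mul_assoc, hM.cutoff_mul_of_support hm hh.1 hh.2.2, ← hφ.fnorm_compress hsa,
    ← Complex.ofReal_mul, inv_mul_cancel₀ h0, Complex.ofReal_one]

end Localization

/-! ### Compactness of balls and of sets of local Lipschitz elements -/

section Lipschitz

variable {A : Type u} [NonUnitalCStarAlgebra A] {M : NonUnitalStarSubalgebra ℂ A}
  {L : A → ℝ≥0∞}

lemma IsLSC.le_of_tendsto (h : IsLSC L) {ι : Type*} {F : Filter ι} [F.NeBot] {f : ι → A} {a : A}
    (hf : Tendsto f F (𝓝 a)) (hsa : ∀ᶠ i in F, IsSelfAdjoint (f i)) {c : ℝ≥0∞}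
    (hc : ∀ᶠ i in F, L (f i) ≤ c) : L a ≤ c := by
  have ha : IsSelfAdjoint a :=
    (isClosed_eq continuous_star continuous_id : IsClosed {a : A | star a = a}).mem_of_tendsto hf hsa
  by_contra! hlt
  have h1 := h a ha c hlt
  have h2 : Tendsto f F (𝓝[{a | IsSelfAdjoint a}] a) := tendsto_nhdsWithin_iff.mpr ⟨hf, hsa⟩
  obtain ⟨i, hi, hi'⟩ := ((h2.eventually h1).and hc).exists
  exact absurd hi (not_lt.mpr hi')

lemma IsLipschitzPair.smul_le_one (h : IsLipschitzPair L) {a : A} {c : ℝ} (hc : 0 < c)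
    (ha : L a ≤ ENNReal.ofReal c) : L (((c⁻¹ : ℝ) : ℂ) • a) ≤ 1 := by
  rw [h.smul_eq, abs_of_pos (inv_pos.mpr hc), ENNReal.ofReal_inv_of_pos hc]
  calc (ENNReal.ofReal c)⁻¹ * L a ≤ (ENNReal.ofReal c)⁻¹ * ENNReal.ofReal c := by gcongr
    _ = 1 := ENNReal.inv_mul_cancel (ENNReal.ofReal_pos.mpr hc).ne' ENNReal.ofReal_ne_top

lemma IsLipschitzPair.exists_pos_le (_h : IsLipschitzPair L) {a : A} (ha : L a < ⊤) :
    ∃ c : ℝ, 0 < c ∧ L a ≤ ENNReal.ofReal c := by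
  refine ⟨(L a).toReal + 1, by positivity, ?_⟩
  rw [← ENNReal.ofReal_toReal ha.ne]
  exact ENNReal.ofReal_le_ofReal (by simp)

lemma IsLipschitzPair.norm_sub_le (h : IsLipschitzPair L) {φ ψ : WeakDual ℂ A} {C c : ℝ}
    (hC : ∀ b, L b ≤ 1 → ‖φ b - ψ b‖ ≤ C) {a : A} (hc : 0 < c) (ha : L a ≤ ENNReal.ofReal c) :
    ‖φ a - ψ a‖ ≤ C * c := by
  have h1 := hC _ (h.smul_le_one hc ha)
  rw [map_smul, map_smul, ← smul_sub, norm_smul, Complex.norm_real, norm_inv,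
    Real.norm_of_nonneg hc.le, inv_mul_le_iff₀ hc] at h1
  linarith

lemma spectrumDist_le_mkDist {x y : Spectrum M} {φ ψ : WeakDual ℂ A}
    (hφ : ∀ m : M, φ m = x m) (hψ : ∀ m : M, ψ m = y m) :
    spectrumDist L M x y ≤ mkDist L φ ψ := by
  refine iSup₂_le fun m hm => ?_
  simp only
  rw [← hφ, ← hψ]
  exact le_iSup₂ (f := fun b (_ : L b ≤ 1) => edist (φ b) (ψ b)) (m : A) hm

lemma continuous_add_const_mul {X : Type*} [TopologicalSpace X] {f g : X → ℂ}
    (hf : Continuous f) (hg : Continuous g) (c : ℂ) : Continuous fun x => f x + c * g x :=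
  hf.add (continuous_const.mul hg)

lemma continuous_to_spectrum {X : Type*} [TopologicalSpace X] {f : X → Spectrum M}
    (h : ∀ m, Continuous fun x => f x m) : Continuous f :=
  continuous_induced_rng.mpr (WeakDual.continuous_of_continuous_eval h)

/-- Evaluation at an element with L finite is Lipschitz for the Monge-Kantorovich metric.
Self-adjoint elements of `M` are norm limits of such elements, so their evaluations are uniform
limits of continuous functions. -/
lemma IsProperQMS.continuous_apply_mk (hP : IsProperQMS L M) (m : M) :
    @Continuous _ _ (mkTopology (fun m : M => L (m : A)) fun (y : Spectrum M) m => y m) _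
      (fun x : Spectrum M => x m) := by
  have hM := hP.isTopography
  let _ := hM.commCStar
  have hL := hP.isLipschitzPair
  let P : PseudoEMetricSpace (Spectrum M) :=
    mkPseudoEMetric (fun m : M => L (m : A)) fun (y : Spectrum M) m => y m
  have h1 : ∀ m : M, L (m : A) < ⊤ → @Continuous _ _ P.toUniformSpace.toTopologicalSpace _
      (fun x : Spectrum M => x m) := by
    intro m hm
    obtain ⟨c, hc, hmc⟩ := hL.exists_pos_le hm
    have hLip : @LipschitzWith _ _ P _ (Real.toNNReal c) (fun x : Spectrum M => x m) := by
      intro x y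
      have h2 : edist (x (((c⁻¹ : ℝ) : ℂ) • m)) (y (((c⁻¹ : ℝ) : ℂ) • m)) ≤ P.edist x y :=
        le_iSup₂ (f := fun (b : M) (_ : L (b : A) ≤ 1) => edist (x b) (y b))
          (((c⁻¹ : ℝ) : ℂ) • m) (hL.smul_le_one hc hmc)
      rw [map_smul, map_smul, edist_dist, dist_eq_norm, ← smul_sub, norm_smul, Complex.norm_real,
        norm_inv, Real.norm_of_nonneg hc.le] at h2
      rw [edist_dist, dist_eq_norm]
      have h3 : ‖x m - y m‖ = c * (c⁻¹ * ‖x m - y m‖) := by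
        rw [← mul_assoc, mul_inv_cancel₀ hc.ne', one_mul]
      rw [h3, ENNReal.ofReal_mul hc.le]
      exact mul_le_mul_right h2 _
    exact @LipschitzWith.continuous _ _ P _ _ _ hLip
  have h2 : ∀ m : M, IsSelfAdjoint m → @Continuous _ _ P.toUniformSpace.toTopologicalSpace _
      (fun x : Spectrum M => x m) := by
    intro m hm
    refine @continuous_of_uniform_approx_of_continuous _ _ P.toUniformSpace.toTopologicalSpace _ _
      fun U hU => ?_
    obtain ⟨ε, hε, hεU⟩ := Metric.mem_uniformity_dist.mp hU
    obtain ⟨b, hb, hmb⟩ := Metric.mem_closure_iff.mp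
      (hP.locStar_dense_topography m m.2 (congrArg Subtype.val hm)) ε hε
    refine ⟨fun x => x ⟨b, hb.2⟩, h1 ⟨b, hb.2⟩ ?_, fun x => ?_⟩
    · obtain ⟨K, -, hK⟩ := hb.1
      exact hK.2.2
    · refine hεU ?_
      rw [dist_eq_norm, ← map_sub]
      refine lt_of_le_of_lt (norm_char_le x _) ?_
      rw [dist_eq_norm] at hmb
      exact hmb
  have h3 : m = (2⁻¹ : ℂ) • (m + star m) + Complex.I • ((2⁻¹ : ℂ) • (Complex.I • (star m - m))) := by
    rw [smul_comm (2⁻¹ : ℂ) Complex.I, smul_smul Complex.I Complex.I, Complex.I_mul_I, neg_one_smul,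
      ← smul_neg, neg_sub, ← smul_add, add_add_sub_cancel, ← two_smul ℂ m, smul_smul]
    norm_num
  have hp : IsSelfAdjoint ((2⁻¹ : ℂ) • (m + star m)) := by
    rw [IsSelfAdjoint, star_smul, star_add, star_star, add_comm]
    congr 1
    simp
  have hq : IsSelfAdjoint ((2⁻¹ : ℂ) • (Complex.I • (star m - m))) := by
    rw [IsSelfAdjoint, star_smul, star_smul, star_sub, star_star, Complex.star_def,
      Complex.conj_I, neg_smul, ← smul_neg, neg_sub]
    congr 1
    rw [map_inv₀, map_ofNat]
  have h4 : (fun x : Spectrum M => x m) = fun x => x ((2⁻¹ : ℂ) • (m + star m)) +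
      Complex.I * x ((2⁻¹ : ℂ) • (Complex.I • (star m - m))) := by
    funext x
    conv_lhs => rw [h3]
    rw [map_add, map_smul x Complex.I, smul_eq_mul]
  rw [h4]
  exact @continuous_add_const_mul _ P.toUniformSpace.toTopologicalSpace _ _ (h2 _ hp) (h2 _ hq) _

/-- Properness gives compactness in the metric topology, whereas localization uses the Gel'fand
topology; the identity map from the former to the latter is continuous. -/
lemma IsProperQMS.isCompact_spectrumBall (hP : IsProperQMS L M) (x : Spectrum M) (r : ℝ) :
    IsCompact (spectrumBall L M x r) := by
  have hc : @Continuous _ _ (mkTopology (fun m : M => L (m : A)) fun (y : Spectrum M) m => y m) _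
      (id : Spectrum M → Spectrum M) := by
    exact @continuous_to_spectrum _ _ _ _
      (mkTopology (fun m : M => L (m : A)) fun (y : Spectrum M) m => y m) _ hP.continuous_apply_mk
  have := @IsCompact.image _ _ (mkTopology (fun m : M => L (m : A)) fun (y : Spectrum M) m => y m) _
    _ _ (hP.isCompact_ball x r) hc
  rwa [image_id] at this

lemma spectrumBall_mono {x : Spectrum M} {r s : ℝ} (h : r ≤ s) :
    spectrumBall L M x r ⊆ spectrumBall L M x s :=
  fun _ hy => le_trans (show _ ≤ _ from hy) (ENNReal.ofReal_le_ofReal h)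

/-- Otherwise some ultrafilter converges to x outside the ball. Extend its points to states
supported in a compact neighbourhood of x; by compactness they have a weak* limit, which extends x.
Metrization makes their distance to this limit small, and the spectral distance is no larger. -/
lemma IsQuantumLCMS.spectrumBall_mem_nhds (hQ : IsQuantumLCMS L M) (x : Spectrum M) {r : ℝ}
    (hr : 0 < r) : spectrumBall L M x r ∈ 𝓝 x := by
  have hM := hQ.isTopography
  by_contra hcon
  have hne : (𝓝 x ⊓ 𝓟 (spectrumBall L M x r)ᶜ).NeBot := by
    rw [inf_principal_neBot_iff]
    intro U hU
    by_contra hemp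
    rw [not_nonempty_iff_eq_empty, ← sdiff_eq, sdiff_eq_empty] at hemp
    exact hcon (mem_of_superset hU hemp)
  let F : Ultrafilter (Spectrum M) := @Ultrafilter.of _ _ hne
  have hF : (F : Filter (Spectrum M)) ≤ 𝓝 x ⊓ 𝓟 (spectrumBall L M x r)ᶜ := @Ultrafilter.of_le _ _ hne
  obtain ⟨e, he⟩ := hM.cutoffs_nonempty (isCompact_singleton (x := x))
  obtain ⟨heM, -, hex⟩ := hM.mem_cutoffs_iff.mp he
  let _ := hM.commCStar
  set K : Set (Spectrum M) := {y | 1 / 2 ≤ ‖y ⟨e, heM⟩‖}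
  have hK : IsCompact K := isCompact_char_ge (⟨e, heM⟩ : M) (by norm_num)
  have hKx : K ∈ 𝓝 x := by
    have : {y : Spectrum M | 1 / 2 < ‖y ⟨e, heM⟩‖} ∈ 𝓝 x := by
      refine IsOpen.mem_nhds (isOpen_lt continuous_const (continuous_char_apply (⟨e, heM⟩ : M)).norm) ?_
      change 1 / 2 < ‖x ⟨e, heM⟩‖
      rw [hex x rfl, norm_one]
      norm_num
    exact mem_of_superset this fun y (hy : 1 / 2 < ‖y ⟨e, heM⟩‖) => hy.le
  choose ext hext using fun y : Spectrum M => hM.exists_state_extending y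
  have hextK : ∀ y ∈ K, ext y ∈ localStates M K := fun y hy =>
    (hM.mem_localStates_iff hK).mpr ⟨(hext y).1, fun m hm => by
      obtain ⟨hm1, -, hm2⟩ := hM.mem_cutoffs_iff.mp hm
      exact ((hext y).2 ⟨m, hm1⟩).trans (hm2 y hy)⟩
  have hFK : ∀ᶠ y in (F : Filter (Spectrum M)), ext y ∈ localStates M K :=
    (hF (mem_inf_of_left hKx) : K ∈ (F : Filter (Spectrum M))) |> fun h =>
      mem_of_superset h hextK
  obtain ⟨ν, hν, hlim⟩ := isCompact_iff_ultrafilter_le_nhds.mp (isCompact_localStates hM hK)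
    (F.map ext) (le_principal_iff.mpr hFK)
  have hlim' : Tendsto ext F (𝓝 ν) := hlim
  have hνx : ∀ m : M, ν m = x m := by
    intro m
    have h1 : Tendsto (fun y => ext y m) F (𝓝 (ν m)) :=
      ((WeakDual.eval_continuous (m : A)).tendsto _).comp hlim'
    have h2 : Tendsto (fun y : Spectrum M => y m) F (𝓝 (x m)) :=
      ((continuous_char_apply m).tendsto x).mono_left (hF.trans inf_le_left)
    refine tendsto_nhds_unique h1 (h2.congr fun y => ((hext y).2 m).symm)
  have hev := hQ.eventually_mkDist_le hK hFK hν hlim' hr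
  have hout : ∀ᶠ y in (F : Filter (Spectrum M)), y ∉ spectrumBall L M x r :=
    hF (mem_inf_of_right (mem_principal_self _))
  obtain ⟨y, hy1, hy2⟩ := (hev.and hout).exists
  exact hy2 ((spectrumDist_le_mkDist (hext y).2 hνx).trans hy1)

/-- Apply max(2t − 1, 0) to a cut-off function u: it keeps the value 1 on `K` and vanishes off the
compact set |u| ≥ 1/2. -/
lemma IsTopography.exists_cutoff_bump (hM : IsTopography M) {K : Set (Spectrum M)}
    (hK : IsCompact K) : ∃ K' : Set (Spectrum M), IsCompact K' ∧ ∃ h ∈ cutoffs M K,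
      h ∈ bumps M K' := by
  let _ := hM.commCStar
  obtain ⟨u, hu⟩ := hM.cutoffs_nonempty hK
  obtain ⟨huM, h1, h2⟩ := hM.mem_cutoffs_iff.mp hu
  have hsa : IsSelfAdjoint (⟨u, huM⟩ : M) := Subtype.ext hu.1.isSelfAdjoint
  have hc : Continuous fun t : ℝ => max (2 * t - 1) 0 := by fun_prop
  have h0 : max (2 * (0 : ℝ) - 1) 0 = 0 := by norm_num
  have hx := char_cfc hsa _ hc h0
  set h : M := cfcₙ (fun t : ℝ => max (2 * t - 1) 0) (⟨u, huM⟩ : M)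
  have hrange : ∀ x : Spectrum M, 0 ≤ x h ∧ x h ≤ 1 := fun x => by
    rw [hx]
    have h3 : (x ⟨u, huM⟩).re ≤ 1 := (Complex.le_def.mp (h1 x).2).1
    have h4 : max (2 * (x ⟨u, huM⟩).re - 1) 0 ≤ 1 := max_le (by linarith) zero_le_one
    exact ⟨by exact_mod_cast le_max_right _ _, by exact_mod_cast h4⟩
  refine ⟨_, isCompact_char_ge (⟨u, huM⟩ : M) (δ := 1 / 2) (by norm_num), h,
    hM.mem_cutoffs_iff.mpr ⟨h.2, hrange, fun x hxK => ?_⟩, h.2, hrange, fun x hxK => ?_⟩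
  · change x h = 1
    rw [hx, h2 x hxK]
    norm_num
  · change x h = 0
    have h5 : ¬ 1 / 2 ≤ ‖x ⟨u, huM⟩‖ := hxK
    have h6 := Complex.re_le_norm (x ⟨u, huM⟩)
    rw [hx, max_eq_right (by linarith), Complex.ofReal_zero]

/-- Since a = hah, the value χ(a) is that of the compression of χ by h, which is a state supported
in `K` times a factor at most 1. -/
lemma IsTopography.norm_le_of_localStates (hM : IsTopography M) {K : Set (Spectrum M)}
    (hK : IsCompact K) {h a : A} (hh : h ∈ bumps M K) (ha : IsSelfAdjoint a) (hha : h * a = a)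
    {c : ℝ} (hc : 0 ≤ c) (hac : ∀ ψ ∈ localStates M K, ‖ψ a‖ ≤ c) : ‖a‖ ≤ c := by
  refine norm_le_of_states ha hc fun χ hχ => ?_
  have hsa := (hM.isPos_of_mem_bumps hh).isSelfAdjoint
  have hpf : IsPosFun χ := hχ.1
  have hah : a * h = a := by
    have := congrArg star hha
    rwa [star_mul, ha.star_eq, hsa.star_eq] at this
  have h1 : χ a = compress χ h a := by rw [compress_apply, hha, hah]
  by_cases h0 : fnorm (compress χ h) = 0
  · rw [h1, eq_zero_of_fnorm_eq_zero h0]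
    simpa using hc
  · have h2 := hac _ (hM.normalize_compress_mem_localStates hK hpf hh h0)
    have h3 : (((fnorm (compress χ h))⁻¹ : ℝ) : ℂ) • compress χ h a =
      ((((fnorm (compress χ h))⁻¹ : ℝ) : ℂ) • compress χ h) a := rfl
    rw [← h3, ← h1, norm_smul, Complex.norm_real, norm_inv,
      Real.norm_of_nonneg (fnorm_nonneg _),
      inv_mul_le_iff₀ (lt_of_le_of_ne (fnorm_nonneg _) (Ne.symm h0))] at h2
    refine h2.trans (mul_le_of_le_one_left hc ?_)
    have h4 : ‖χ (h * h)‖ ≤ 1 := by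
      refine (norm_state_apply_le hχ _).trans ((norm_mul_le _ _).trans ?_)
      have := hM.norm_le_one hh.1 hh.2.1
      nlinarith [norm_nonneg h]
    rw [← hpf.fnorm_compress hsa, Complex.norm_real, Real.norm_of_nonneg (fnorm_nonneg _)] at h4
    exact h4

/-- The unit ball of the elements supported in a compact set. -/
def locUnit (L : A → ℝ≥0∞) (M : NonUnitalStarSubalgebra ℂ A) (K : Set (Spectrum M)) : Set A :=
  {a | a ∈ Loc L M K ∧ L a ≤ 1}

/-- A state ν extending a point outside `K` vanishes at every a supported in `K`, because some
cut-off function of `K` vanishes at that point. So |ψ(a)| = |ψ(a) − ν(a)| is bounded by a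
Monge-Kantorovich diameter. -/
lemma IsQuantumLCMS.exists_norm_le (hQ : IsQuantumLCMS L M) {K : Set (Spectrum M)}
    (hK : IsCompact K) (hne : K ≠ univ) : ∃ C : ℝ, ∀ a ∈ locUnit L M K, ‖a‖ ≤ C := by
  have hM := hQ.isTopography
  obtain ⟨x₀, hx₀⟩ := (ne_univ_iff_exists_notMem K).mp hne
  obtain ⟨K', hK', h, hhK, hhK'⟩ := hM.exists_cutoff_bump hK
  have hK3 : IsCompact (K' ∪ {x₀}) := hK'.union isCompact_singleton
  obtain ⟨C, hC0, hC⟩ := hQ.exists_mkDist_le hK3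
  obtain ⟨ν, hν, hνx⟩ := hM.exists_localState_extending hK3 (x := x₀) (Or.inr rfl)
  obtain ⟨u, hu, huM, hux⟩ := hM.exists_cutoff_apply_eq_zero hK hx₀
  refine ⟨C, fun a ha => ?_⟩
  obtain ⟨hsa, hcut, -⟩ := (hM.mem_Loc_iff hK).mp ha.1
  have hνa : ν a = 0 := by
    have h1 := IsPosFun.cauchy_schwarz_of_isSelfAdjoint hν.1.1 hu.1.isSelfAdjoint a
    have h2 : ν (u * u) = 0 := by
      have := hνx ⟨u * u, mul_mem huM huM⟩
      rw [map_mk_mul x₀ huM huM, hux, mul_zero] at this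
      exact this
    rw [hcut u hu, h2, Complex.zero_re, zero_mul] at h1
    exact norm_eq_zero.mp (pow_eq_zero_iff two_ne_zero |>.mp (le_antisymm h1 (sq_nonneg _)))
  refine hM.norm_le_of_localStates hK' hhK' hsa (hcut h hhK) hC0.le fun ψ hψ => ?_
  have := hC ψ (localStates_mono_of_isCompact hM hK' hK3 subset_union_left hψ) ν hν a ha.2
  rwa [hνa, sub_zero] at this

/-- Arzelà-Ascoli: on the compact space of states supported in a slightly larger `K'` these elements
are bounded and equicontinuous, and such states determine their norms. Hence every ultrafilter on
the set is Cauchy; lower semi-continuity keeps its limit in the set. -/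
lemma IsQuantumLCMS.isCompact_locUnit (hQ : IsQuantumLCMS L M) (hlsc : IsLSC L)
    {K : Set (Spectrum M)} (hK : IsCompact K) (hne : K ≠ univ) : IsCompact (locUnit L M K) := by
  have hM := hQ.isTopography
  obtain ⟨C, hC⟩ := hQ.exists_norm_le hK hne
  obtain ⟨K', hK', h, hhK, hhK'⟩ := hM.exists_cutoff_bump hK
  rw [isCompact_iff_ultrafilter_le_nhds]
  intro F hF
  rw [le_principal_iff] at hF
  have hcauchy : Cauchy (F : Filter A) := by
    refine Metric.cauchy_iff.mpr ⟨inferInstance, fun ε hε => ?_⟩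
    -- By compactness it suffices to argue near one state φ. There ψ(a) is within ε/8 of φ(a), and
    -- φ(a) is within ε/8 of its ultrafilter limit z; the same for b yields ε/2.
    have key : ∃ t ∈ (F : Filter A), ∀ a ∈ t, ∀ b ∈ t, ∀ ψ ∈ localStates M K',
        ‖ψ a - ψ b‖ ≤ ε / 2 := by
      refine (isCompact_localStates hM hK').induction_on (p := fun s => ∃ t ∈ (F : Filter A),
        ∀ a ∈ t, ∀ b ∈ t, ∀ ψ ∈ s, ‖ψ a - ψ b‖ ≤ ε / 2) ⟨univ, univ_mem, by simp⟩ ?_ ?_ ?_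
      · rintro s s' hs ⟨t, ht, h1⟩
        exact ⟨t, ht, fun a ha b hb ψ hψ => h1 a ha b hb ψ (hs hψ)⟩
      · rintro s s' ⟨t, ht, h1⟩ ⟨t', ht', h1'⟩
        refine ⟨t ∩ t', inter_mem ht ht', fun a ha b hb ψ hψ => ?_⟩
        rcases hψ with hψ | hψ
        · exact h1 a ha.1 b hb.1 ψ hψ
        · exact h1' a ha.2 b hb.2 ψ hψ
      · intro φ hφ
        have h2 : ∀ᶠ ψ : WeakDual ℂ A in 𝓝[localStates M K'] φ, mkDist L ψ φ ≤ ENNReal.ofReal (ε / 8) :=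
          hQ.eventually_mkDist_le (f := fun ψ => ψ) hK' self_mem_nhdsWithin hφ
            (tendsto_nhdsWithin_of_tendsto_nhds tendsto_id) (by positivity)
        obtain ⟨z, -, hz⟩ := isCompact_iff_ultrafilter_le_nhds.mp
          (isCompact_closedBall (0 : ℂ) C) (F.map φ) (by
            rw [le_principal_iff]
            change {a | φ a ∈ Metric.closedBall (0 : ℂ) C} ∈ (F : Filter A)
            refine mem_of_superset hF fun a ha => ?_
            rw [mem_ofPred_eq, mem_closedBall_zero_iff]
            exact (norm_state_apply_le hφ.1 a).trans (hC a ha))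
        have hz' : Tendsto (fun a => φ a) F (𝓝 z) := hz
        have hball := hz'.eventually (Metric.ball_mem_nhds z (ε := ε / 8) (by positivity))
        refine ⟨_, h2, _, inter_mem hF hball, fun a ha b hb ψ hψ => ?_⟩
        have q1 := (mkDist_le_iff (by positivity)).mp hψ a ha.1.2
        have q2 := (mkDist_le_iff (by positivity)).mp hψ b hb.1.2
        have q3 : ‖φ a - z‖ < ε / 8 := by rw [← dist_eq_norm]; exact ha.2
        have q4 : ‖φ b - z‖ < ε / 8 := by rw [← dist_eq_norm]; exact hb.2
        have e : ψ a - ψ b = (ψ a - φ a) + (φ a - z) + (-(φ b - z)) + (-(ψ b - φ b)) := by ring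
        rw [e]
        refine (norm_add_le _ _).trans ?_
        have e2 := norm_add₃_le (a := ψ a - φ a) (b := φ a - z) (c := -(φ b - z))
        rw [norm_neg] at e2 ⊢
        linarith
    obtain ⟨t, ht, h1⟩ := key
    refine ⟨t ∩ locUnit L M K, inter_mem ht hF, fun a ha b hb => ?_⟩
    rw [dist_eq_norm]
    obtain ⟨hsa, hcut, -⟩ := (hM.mem_Loc_iff hK).mp ha.2.1
    obtain ⟨hsa', hcut', -⟩ := (hM.mem_Loc_iff hK).mp hb.2.1
    refine lt_of_le_of_lt (hM.norm_le_of_localStates hK' hhK' (hsa.sub hsa') ?_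
      (show 0 ≤ ε / 2 by positivity) fun ψ hψ => ?_) (by linarith)
    · rw [mul_sub, hcut h hhK, hcut' h hhK]
    · rw [map_sub]
      exact h1 a ha.1 b hb.1 ψ hψ
  obtain ⟨a, ha⟩ := CompleteSpace.complete hcauchy
  have hT : ∀ᶠ b in (F : Filter A), b ∈ locUnit L M K := hF
  have ha' : Tendsto (fun b : A => b) F (𝓝 a) := ha
  have hsa : IsSelfAdjoint a :=
    (isClosed_eq continuous_star continuous_id : IsClosed {a : A | star a = a}).mem_of_tendsto ha'
      (hT.mono fun b hb => hb.1.1)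
  have hL1 : L a ≤ 1 := hlsc.le_of_tendsto ha' (hT.mono fun b hb => hb.1.1) (hT.mono fun b hb => hb.2)
  refine ⟨a, ⟨(hM.mem_Loc_iff hK).mpr ⟨hsa, fun u hu => ?_, hL1.trans_lt ENNReal.one_lt_top⟩, hL1⟩, ha⟩
  refine tendsto_nhds_unique ((ha'.const_mul u).congr' ?_) ha'
  filter_upwards [hT] with b hb
  exact ((hM.mem_Loc_iff hK).mp hb.1).2.1 u hu

end Lipschitz

/-! ### Estimates for elements that are close to a scalar on all states -/

section Estimates

variable {A : Type u} [NonUnitalCStarAlgebra A] {M : NonUnitalStarSubalgebra ℂ A}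
  {L : A → ℝ≥0∞}

lemma isSelfAdjoint_mul_self {a : A} (ha : IsSelfAdjoint a) : IsSelfAdjoint (a * a) := by
  rw [IsSelfAdjoint, star_mul, ha.star_eq]

lemma IsPosFun.norm_compress_sub_le {φ : WeakDual ℂ A} (hφ : IsPosFun φ) {h : A}
    (hh : IsSelfAdjoint h) (a : A) (s : ℂ) {c : ℝ}
    (hs : ∀ χ ∈ states A, ‖χ a - s‖ ≤ c) :
    ‖φ (h * a * h) - s * φ (h * h)‖ ≤ fnorm (QMS.compress φ h) * c := by
  rw [← hφ.fnorm_compress hh]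
  by_cases h0 : fnorm (QMS.compress φ h) = 0
  · have := eq_zero_of_fnorm_eq_zero h0 a
    rw [compress_apply] at this
    simp [this, h0]
  · have h1 := hs _ ((hφ.compress hh).normalize_mem_states h0)
    have h2 : φ (h * a * h) - s * (fnorm (QMS.compress φ h) : ℂ) =
        (fnorm (QMS.compress φ h) : ℂ) *
          (((((fnorm (QMS.compress φ h))⁻¹ : ℝ) : ℂ) • QMS.compress φ h) a - s) := by
      change _ = (fnorm (QMS.compress φ h) : ℂ) *
          (((fnorm (QMS.compress φ h))⁻¹ : ℝ) * φ (h * a * h) - s)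
      rw [mul_sub, ← mul_assoc, ← Complex.ofReal_mul, mul_inv_cancel₀ h0, Complex.ofReal_one,
        one_mul, mul_comm s]
    rw [h2, norm_mul, Complex.norm_real, Real.norm_of_nonneg (fnorm_nonneg _)]
    exact mul_le_mul_of_nonneg_left h1 (fnorm_nonneg _)

lemma fnorm_compress_le_one {φ : WeakDual ℂ A} (hφ : IsPosFun φ) (h1 : fnorm φ ≤ 1) {h : A}
    (hh : IsSelfAdjoint h) (hh1 : ‖h‖ ≤ 1) : fnorm (compress φ h) ≤ 1 := by
  have h2 := norm_apply_le_fnorm φ (h * h)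
  rw [← hφ.fnorm_compress hh, Complex.norm_real, Real.norm_of_nonneg (fnorm_nonneg _)] at h2
  refine h2.trans ?_
  have : ‖h * h‖ ≤ 1 := (norm_mul_le _ _).trans (mul_le_one₀ hh1 (norm_nonneg _) hh1)
  exact mul_le_one₀ h1 (norm_nonneg _) this

/-- Elements which are close to a scalar on all states stay so after compression. -/
lemma norm_conj_sub_le {a e : A} (ha : IsSelfAdjoint a) (he : IsSelfAdjoint e) (he1 : ‖e‖ ≤ 1)
    {s : ℝ} {c : ℝ} (hc : 0 ≤ c) (hs : ∀ χ ∈ states A, ‖χ a - s‖ ≤ c) :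
    ‖e * a * e - (s : ℂ) • (e * e)‖ ≤ c := by
  have h1 : IsSelfAdjoint ((s : ℂ) • (e * e)) := by
    rw [IsSelfAdjoint, star_smul, Complex.star_def, Complex.conj_ofReal,
      (isSelfAdjoint_mul_self he).star_eq]
  have h2 : IsSelfAdjoint (e * a * e) := by simpa [he.star_eq] using ha.conjugate e
  refine norm_le_of_states (h2.sub h1) hc fun χ hχ => ?_
  rw [map_sub, map_smul, smul_eq_mul]
  refine (IsPosFun.norm_compress_sub_le hχ.1 he a s hs).trans (mul_le_of_le_one_left hc ?_)
  exact fnorm_compress_le_one hχ.1 (mem_states_iff.mp hχ).2.le he he1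

/-- This bounds φ(a(b − s)) where the unit may be missing: replace b − s by ebe − s·e², of norm at
most c, and let e run through an approximate unit. -/
lemma norm_state_mul_sub_le {φ : WeakDual ℂ A} (hφ : φ ∈ states A) {a b : A}
    (hb : IsSelfAdjoint b) {s : ℝ} {c : ℝ} (hc : 0 ≤ c) (hs : ∀ χ ∈ states A, ‖χ b - s‖ ≤ c) :
    ‖φ (a * b) - s * φ a‖ ≤ ‖a‖ * c := by
  obtain ⟨l, hl, hu⟩ := exists_approx_unit A
  have := hl.neBot
  have h1 : Tendsto (fun e => a * (e * b * e - (s : ℂ) • (e * e))) l (𝓝 (a * b - (s : ℂ) • a)) := by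
    have h2 : Tendsto (fun e => (a * e) * (b * e)) l (𝓝 (a * b)) :=
      (hl.tendsto_mul_left a).mul (hl.tendsto_mul_left b)
    have h3 : Tendsto (fun e => (a * e) * e) l (𝓝 a) := by
      rw [tendsto_iff_norm_sub_tendsto_zero]
      have h4 : Tendsto (fun e => ‖a * e - a‖ + ‖a * e - a‖) l (𝓝 0) := by
        have := tendsto_iff_norm_sub_tendsto_zero.mp (hl.tendsto_mul_left a)
        simpa using this.add this
      refine squeeze_zero' (Eventually.of_forall fun e => norm_nonneg _) ?_ h4
      filter_upwards [hu] with e he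
      have e1 : a * e * e - a = (a * e - a) * e + (a * e - a) := by noncomm_ring
      rw [e1]
      refine (norm_add_le _ _).trans (add_le_add ?_ le_rfl)
      exact (norm_mul_le _ _).trans (mul_le_of_le_one_right (norm_nonneg _) he.2)
    refine (h2.sub (h3.const_smul (s : ℂ))).congr fun e => ?_
    rw [mul_sub, mul_smul_comm, mul_assoc, mul_assoc, mul_assoc]
  have h2 : Tendsto (fun e => ‖φ (a * (e * b * e - (s : ℂ) • (e * e)))‖) l
      (𝓝 ‖φ (a * b) - s * φ a‖) := by
    have := (((WeakDual.toStrongDual φ).continuous.tendsto _).comp h1).norm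
    have e1 : (WeakDual.toStrongDual φ) (a * b - (s : ℂ) • a) = φ (a * b) - s * φ a := by
      change φ (a * b - (s : ℂ) • a) = _
      rw [map_sub, map_smul, smul_eq_mul]
    rwa [e1] at this
  refine le_of_tendsto h2 ?_
  filter_upwards [hu] with e he
  refine (norm_state_apply_le hφ _).trans ((norm_mul_le _ _).trans ?_)
  exact mul_le_mul_of_nonneg_left (norm_conj_sub_le hb he.1.isSelfAdjoint he.2 hc hs) (norm_nonneg _)

lemma norm_state_mul_sub_le' {φ : WeakDual ℂ A} (hφ : φ ∈ states A) {a b : A}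
    (ha : IsSelfAdjoint a) (hb : IsSelfAdjoint b) {s : ℝ} {c : ℝ} (hc : 0 ≤ c)
    (hs : ∀ χ ∈ states A, ‖χ b - s‖ ≤ c) :
    ‖φ (b * a) - s * φ a‖ ≤ ‖a‖ * c := by
  have h1 := norm_state_mul_sub_le hφ (a := a) hb hc hs
  rw [← norm_star, star_sub, star_mul', ← IsPosFun.map_star hφ.1, ← IsPosFun.map_star hφ.1,
    star_mul, ha.star_eq, hb.star_eq, Complex.star_def, Complex.conj_ofReal] at h1
  exact h1

lemma norm_state_jordan_sub_le {φ : WeakDual ℂ A} (hφ : φ ∈ states A) {a b : A}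
    (ha : IsSelfAdjoint a) (hb : IsSelfAdjoint b) {s : ℝ} {c : ℝ} (hc : 0 ≤ c)
    (hs : ∀ χ ∈ states A, ‖χ b - s‖ ≤ c) :
    ‖φ (jordan a b) - s * φ a‖ ≤ ‖a‖ * c := by
  have h1 := norm_state_mul_sub_le hφ (a := a) hb hc hs
  have h2 := norm_state_mul_sub_le' hφ ha hb hc hs
  have e : φ (jordan a b) - s * φ a =
      1 / 2 * ((φ (a * b) - s * φ a) + (φ (b * a) - s * φ a)) := by
    rw [jordan, map_smul, map_add, smul_eq_mul]
    ring
  rw [e, norm_mul]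
  have h3 := norm_add_le (φ (a * b) - s * φ a) (φ (b * a) - s * φ a)
  have h4 : ‖(1 / 2 : ℂ)‖ = 1 / 2 := by simp
  rw [h4]
  linarith

lemma norm_state_lie_le {φ : WeakDual ℂ A} (hφ : φ ∈ states A) {a b : A}
    (ha : IsSelfAdjoint a) (hb : IsSelfAdjoint b) {s : ℝ} {c : ℝ} (hc : 0 ≤ c)
    (hs : ∀ χ ∈ states A, ‖χ b - s‖ ≤ c) :
    ‖φ (lie a b)‖ ≤ ‖a‖ * c := by
  have h1 := norm_state_mul_sub_le hφ (a := a) hb hc hs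
  have h2 := norm_state_mul_sub_le' hφ ha hb hc hs
  have e : φ (lie a b) =
      1 / (2 * Complex.I) * ((φ (a * b) - s * φ a) - (φ (b * a) - s * φ a)) := by
    rw [lie, map_smul, map_sub, smul_eq_mul]
    ring
  rw [e, norm_mul]
  have h3 := norm_sub_le (φ (a * b) - s * φ a) (φ (b * a) - s * φ a)
  have h4 : ‖(1 / (2 * Complex.I) : ℂ)‖ = 1 / 2 := by simp
  rw [h4]
  linarith

lemma jordan_comm (a b : A) : jordan a b = jordan b a := by
  rw [jordan, jordan, add_comm]

lemma norm_lie_swap (φ : WeakDual ℂ A) (a b : A) : ‖φ (lie a b)‖ = ‖φ (lie b a)‖ := by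
  have : lie a b = -lie b a := by rw [lie, lie, ← smul_neg, neg_sub]
  rw [this, map_neg, norm_neg]

/-- Formally y − hyh = (1 − h)y + hy(1 − h). Cauchy-Schwarz bounds each term by c times the root of
φ((1 − h)²) = 1 − 2φ(h) + φ(h²), which is at most 1 − φ(h) because h² ≤ h. An approximate unit
stands in for 1. -/
lemma norm_state_sub_conj_le {φ : WeakDual ℂ A} (hφ : φ ∈ states A) {h : A} (hh : IsPos h)
    (hh1 : ‖h‖ ≤ 1) (hhh : IsPos (h - h * h)) {y : A} (hy : IsSelfAdjoint y) {c : ℝ}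
    (hyc : ‖y‖ ≤ c) : ‖φ y - φ (h * y * h)‖ ≤ 2 * (c * √(1 - (φ h).re)) := by
  have hc : 0 ≤ c := (norm_nonneg y).trans hyc
  have hsa := hh.isSelfAdjoint
  have hpf : IsPosFun φ := hφ.1
  obtain ⟨l, hl, hu⟩ := exists_approx_unit A
  have := hl.neBot
  have hu' : ∀ᶠ u in l, IsSelfAdjoint u ∧ ‖u‖ ≤ 1 := hu.mono fun u hu => ⟨hu.1.isSelfAdjoint, hu.2⟩
  have hcont := (WeakDual.toStrongDual φ).continuous
  have hq : Tendsto (fun u => (φ ((u - h) * (u - h))).re) l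
      (𝓝 (1 - (φ h).re - (φ h).re + (φ (h * h)).re)) := by
    have h1 := hpf.tendsto_mul_self hl hu'
    rw [(mem_states_iff.mp hφ).2, Complex.ofReal_one] at h1
    have h6 : Tendsto (fun u => φ (u * u) - φ (u * h) - φ (h * u) + φ (h * h)) l
        (𝓝 (1 - φ h - φ h + φ (h * h))) :=
      ((h1.sub ((hcont.tendsto _).comp (hl.tendsto_mul_right h))).sub
        ((hcont.tendsto _).comp (hl.tendsto_mul_left h))).add_const _
    have h7 := (Complex.continuous_re.tendsto _).comp h6
    simp only [Complex.add_re, Complex.sub_re, Complex.one_re] at h7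
    refine h7.congr fun u => ?_
    simp only [Function.comp_apply]
    rw [← map_sub, ← map_sub, ← map_add]
    congr 2
    noncomm_ring
  have hX : Tendsto (fun u => φ ((u - h) * y) + φ (h * y * (u - h))) l
      (𝓝 (φ y - φ (h * y * h))) := by
    have h1 : Tendsto (fun u => φ (u * y) - φ (h * y) + (φ (h * y * u) - φ (h * y * h))) l
        (𝓝 (φ y - φ (h * y) + (φ (h * y) - φ (h * y * h)))) :=
      (((hcont.tendsto _).comp (hl.tendsto_mul_right y)).sub_const _).add
        (((hcont.tendsto _).comp (hl.tendsto_mul_left (h * y))).sub_const _)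
    rw [sub_add_sub_cancel] at h1
    refine h1.congr fun u => ?_
    rw [← map_sub, ← map_sub, sub_mul, mul_sub]
  have hb : ∀ z : A, ‖z‖ ≤ c → ∀ u, IsSelfAdjoint u →
      ‖φ ((u - h) * z)‖ ≤ c * √((φ ((u - h) * (u - h))).re) := by
    intro z hz u hus
    have h1 := hpf.cauchy_schwarz_of_isSelfAdjoint (hus.sub hsa) z
    have h2 : (φ (star z * z)).re ≤ c ^ 2 := by
      refine (Complex.re_le_norm _).trans ((norm_state_apply_le hφ _).trans ?_)
      rw [CStarRing.norm_star_mul_self, ← sq]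
      exact pow_le_pow_left₀ (norm_nonneg _) hz 2
    have h3 := hpf.re_mul_self_nonneg (hus.sub hsa)
    refine le_of_sq_le_sq (a := ‖φ ((u - h) * z)‖) ?_ (by positivity)
    rw [mul_pow, Real.sq_sqrt h3, mul_comm]
    exact h1.trans (mul_le_mul_of_nonneg_left h2 h3)
  have h8 : ‖φ y - φ (h * y * h)‖ ≤
      2 * (c * √(1 - (φ h).re - (φ h).re + (φ (h * h)).re)) := by
    refine le_of_tendsto_of_tendsto hX.norm
      (((Real.continuous_sqrt.tendsto _).comp hq).const_mul c |>.const_mul 2) ?_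
    filter_upwards [hu'] with u hu
    refine (norm_add_le _ _).trans ?_
    have h1 := hb y hyc u hu.1
    have h2 := hb (y * h) ((norm_mul_le _ _).trans
      ((mul_le_of_le_one_right (norm_nonneg _) hh1).trans hyc)) u hu.1
    have h3 : ‖φ (h * y * (u - h))‖ = ‖φ ((u - h) * (y * h))‖ := by
      rw [← norm_star, ← hpf.map_star, star_mul, star_mul, (hu.1.sub hsa).star_eq, hsa.star_eq,
        hy.star_eq]
    rw [h3]
    simp only [Function.comp_apply]
    linarith
  refine h8.trans ?_
  have h9 := (Complex.nonneg_iff.mp (hpf.of_isPos hhh)).1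
  rw [map_sub, Complex.sub_re] at h9
  have h10 : √(1 - (φ h).re - (φ h).re + (φ (h * h)).re) ≤ √(1 - (φ h).re) :=
    Real.sqrt_le_sqrt (by linarith)
  nlinarith

lemma tendsto_conj {l : Filter A} (hl : l.IsApproximateUnit) (hu : ∀ᶠ u in l, ‖u‖ ≤ 1) (a : A) :
    Tendsto (fun u => u * a * u) l (𝓝 a) := by
  rw [tendsto_iff_norm_sub_tendsto_zero]
  have h1 := tendsto_iff_norm_sub_tendsto_zero.mp (hl.tendsto_mul_left a)
  have h2 := tendsto_iff_norm_sub_tendsto_zero.mp (hl.tendsto_mul_right a)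
  have h3 : Tendsto (fun u => ‖u * a - a‖ + ‖a * u - a‖) l (𝓝 0) := by simpa using h2.add h1
  refine squeeze_zero' (Eventually.of_forall fun u => norm_nonneg _) ?_ h3
  filter_upwards [hu] with u hu
  have e : u * a * u - a = (u * a - a) * u + (a * u - a) := by noncomm_ring
  rw [e]
  refine (norm_add_le _ _).trans (add_le_add ?_ le_rfl)
  exact (norm_mul_le _ _).trans (mul_le_of_le_one_right (norm_nonneg _) hu)

/-- The preceding estimate for y = a − s, approximated by eae − s·e². Its bound involves only the
oscillation c and not the norm of a. -/
lemma norm_state_sub_scalar_sub_conj_le {φ : WeakDual ℂ A} (hφ : φ ∈ states A) {h : A}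
    (hh : IsPos h) (hh1 : ‖h‖ ≤ 1) (hhh : IsPos (h - h * h)) {a : A} (ha : IsSelfAdjoint a)
    {s : ℝ} {c : ℝ} (hc : 0 ≤ c) (hs : ∀ χ ∈ states A, ‖χ a - s‖ ≤ c) :
    ‖φ a - s - (φ (h * a * h) - s * φ (h * h))‖ ≤ 2 * (c * √(1 - (φ h).re)) := by
  obtain ⟨l, hl, hu⟩ := exists_approx_unit A
  have := hl.neBot
  have hpf : IsPosFun φ := hφ.1
  have hu' : ∀ᶠ u in l, IsSelfAdjoint u ∧ ‖u‖ ≤ 1 := hu.mono fun u hu => ⟨hu.1.isSelfAdjoint, hu.2⟩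
  have hcont := (WeakDual.toStrongDual φ).continuous
  have h1 : Tendsto (fun e => φ (e * a * e - (s : ℂ) • (e * e))) l (𝓝 (φ a - s)) := by
    have h2 := hpf.tendsto_mul_self hl hu'
    rw [(mem_states_iff.mp hφ).2, Complex.ofReal_one] at h2
    have h3 := ((hcont.tendsto _).comp (tendsto_conj hl (hu.mono fun u hu => hu.2) a)).sub
      (h2.const_mul (s : ℂ))
    rw [mul_one] at h3
    refine h3.congr fun e => ?_
    rw [map_sub, map_smul]
    rfl
  have h2 : Tendsto (fun e => φ (h * (e * a * e - (s : ℂ) • (e * e)) * h)) l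
      (𝓝 (φ (h * a * h) - s * φ (h * h))) := by
    have h3 : Tendsto (fun e => (h * e) * (a * (e * h)) - (s : ℂ) • (h * (e * e) * h)) l
        (𝓝 (h * (a * h) - (s : ℂ) • (h * h))) :=
      ((hl.tendsto_mul_left h).mul ((hl.tendsto_mul_right h).const_mul a)).sub
        ((tendsto_mul_self hl h h).const_smul _)
    have h4 := (hcont.tendsto _).comp h3
    have e1 : (WeakDual.toStrongDual φ) (h * (a * h) - (s : ℂ) • (h * h)) =
        φ (h * a * h) - s * φ (h * h) := by
      change φ (h * (a * h) - (s : ℂ) • (h * h)) = _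
      rw [map_sub, map_smul, smul_eq_mul, mul_assoc]
    rw [e1] at h4
    refine h4.congr fun e => ?_
    change φ _ = φ _
    congr 1
    rw [mul_sub, sub_mul, mul_smul_comm, smul_mul_assoc]
    noncomm_ring
  refine le_of_tendsto ((h1.sub h2).norm) ?_
  filter_upwards [hu'] with e he
  have h5 : IsSelfAdjoint (e * a * e - (s : ℂ) • (e * e)) := by
    refine IsSelfAdjoint.sub (by simpa [he.1.star_eq] using ha.conjugate e) ?_
    rw [IsSelfAdjoint, star_smul, Complex.star_def, Complex.conj_ofReal,
      (isSelfAdjoint_mul_self he.1).star_eq]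
  exact norm_state_sub_conj_le hφ hh hh1 hhh h5 (norm_conj_sub_le ha he.1 he.2 hc hs)

/-- Compressions of functionals depend continuously on the functional, uniformly over Lipschitz
elements. -/
lemma IsQuantumLCMS.eventually_compress_sub_le (hQ : IsQuantumLCMS L M) {K : Set (Spectrum M)}
    (hK : IsCompact K) {h : A} (hh : h ∈ bumps M K) {ι : Type*} {F : Filter ι}
    {f : ι → WeakDual ℂ A} {φ : WeakDual ℂ A} (hf : ∀ᶠ i in F, IsPosFun (f i) ∧ fnorm (f i) ≤ 1)
    (hφ : IsPosFun φ) (hlim : Tendsto f F (𝓝 φ)) {c ε : ℝ} (hε : 0 < ε) :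
    ∀ᶠ i in F, ∀ a, L a ≤ 1 → ∀ s : ℂ, (∀ χ ∈ states A, ‖χ a - s‖ ≤ c) →
      ‖(f i (h * a * h) - s * f i (h * h)) - (φ (h * a * h) - s * φ (h * h))‖ ≤ ε := by
  have hM := hQ.isTopography
  have hsa := (hM.isPos_of_mem_bumps hh).isSelfAdjoint
  have hh1 := hM.norm_le_one hh.1 hh.2.1
  have happ : ∀ b : A, Tendsto (fun i => f i b) F (𝓝 (φ b)) := fun b =>
    ((WeakDual.eval_continuous b).tendsto _).comp hlim
  have hlam : Tendsto (fun i => fnorm (compress (f i) h)) F (𝓝 (fnorm (compress φ h))) := by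
    have h1 := (Complex.continuous_re.tendsto _).comp (happ (h * h))
    rw [← hφ.fnorm_compress hsa, Complex.ofReal_re] at h1
    refine h1.congr' ?_
    filter_upwards [hf] with i hi
    simp only [Function.comp_apply]
    rw [← hi.1.fnorm_compress hsa, Complex.ofReal_re]
  -- If the compression of the limit vanishes, the norms of the compressions tend to zero, and c
  -- times these norms bounds the left-hand side. Otherwise the normalized compressions converge
  -- weak* among states supported in `K`, hence uniformly over L ≤ 1.
  by_cases h0 : fnorm (compress φ h) = 0
  · have h1 : Tendsto (fun i => fnorm (compress (f i) h) * c) F (𝓝 0) := by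
      have := hlam.mul_const c
      rwa [h0, zero_mul] at this
    filter_upwards [hf, h1.eventually (gt_mem_nhds hε)] with i hi h2 a ha s hs
    have h3 : φ (h * a * h) - s * φ (h * h) = 0 := by
      have h4 := hφ.norm_compress_sub_le hsa a s hs
      rw [h0, zero_mul] at h4
      exact norm_le_zero_iff.mp h4
    rw [h3, sub_zero]
    exact (hi.1.norm_compress_sub_le hsa a s hs).trans h2.le
  · have hpos : 0 < fnorm (compress φ h) := lt_of_le_of_ne (fnorm_nonneg _) (Ne.symm h0)
    let g : ι → WeakDual ℂ A := fun i =>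
      (((fnorm (compress (f i) h))⁻¹ : ℝ) : ℂ) • compress (f i) h
    let ψ : WeakDual ℂ A := (((fnorm (compress φ h))⁻¹ : ℝ) : ℂ) • compress φ h
    have hgapp : ∀ i b, g i b = (((fnorm (compress (f i) h))⁻¹ : ℝ) : ℂ) * f i (h * b * h) :=
      fun i b => rfl
    have hψapp : ∀ b, ψ b = (((fnorm (compress φ h))⁻¹ : ℝ) : ℂ) * φ (h * b * h) := fun b => rfl
    have hev : ∀ᶠ i in F, 0 < fnorm (compress (f i) h) := hlam.eventually (lt_mem_nhds hpos)
    have hψ : ψ ∈ localStates M K := hM.normalize_compress_mem_localStates hK hφ hh h0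
    have hg : ∀ᶠ i in F, g i ∈ localStates M K := by
      filter_upwards [hf, hev] with i hi hi'
      exact hM.normalize_compress_mem_localStates hK hi.1 hh hi'.ne'
    have hgψ : Tendsto g F (𝓝 ψ) := by
      rw [tendsto_iff_forall_eval_tendsto_topDualPairing]
      intro b
      change Tendsto (fun i => g i b) F (𝓝 (ψ b))
      simp only [hgapp, hψapp]
      exact ((Complex.continuous_ofReal.tendsto _).comp (hlam.inv₀ h0)).mul (happ _)
    have hmk := hQ.eventually_mkDist_le hK hg hψ hgψ (ε := ε / 2) (by positivity)
    have hdl : Tendsto (fun i => |fnorm (compress (f i) h) - fnorm (compress φ h)| * c) F (𝓝 0) := by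
      have := ((hlam.sub_const (fnorm (compress φ h))).abs).mul_const c
      simpa using this
    filter_upwards [hf, hev, hmk, hdl.eventually (gt_mem_nhds (show 0 < ε / 2 by positivity))]
      with i hi hi' h2 h3 a ha s hs
    have h4 := (mkDist_le_iff (by positivity)).mp h2 a ha
    have hψs := hs ψ hψ.1
    rw [← hi.1.fnorm_compress hsa, ← hφ.fnorm_compress hsa]
    have e1 : f i (h * a * h) = (fnorm (compress (f i) h) : ℂ) * g i a := by
      rw [hgapp, ← mul_assoc, ← Complex.ofReal_mul, mul_inv_cancel₀ hi'.ne', Complex.ofReal_one,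
        one_mul]
    have e2 : φ (h * a * h) = (fnorm (compress φ h) : ℂ) * ψ a := by
      rw [hψapp, ← mul_assoc, ← Complex.ofReal_mul, mul_inv_cancel₀ h0, Complex.ofReal_one,
        one_mul]
    rw [e1, e2]
    have e3 : (fnorm (compress (f i) h) : ℂ) * g i a - s * (fnorm (compress (f i) h) : ℂ) -
        ((fnorm (compress φ h) : ℂ) * ψ a - s * (fnorm (compress φ h) : ℂ)) =
        (fnorm (compress (f i) h) : ℂ) * (g i a - ψ a) +
          ((fnorm (compress (f i) h) - fnorm (compress φ h) : ℝ) : ℂ) * (ψ a - s) := by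
      push_cast
      ring
    rw [e3]
    refine (norm_add_le _ _).trans ?_
    rw [norm_mul, norm_mul, Complex.norm_real, Complex.norm_real,
      Real.norm_of_nonneg (fnorm_nonneg _), Real.norm_eq_abs]
    have h5 : fnorm (compress (f i) h) * ‖g i a - ψ a‖ ≤ ε / 2 :=
      (mul_le_of_le_one_left (norm_nonneg _) (fnorm_compress_le_one hi.1 hi.2 hsa hh1)).trans h4
    have h6 : |fnorm (compress (f i) h) - fnorm (compress φ h)| * ‖ψ a - s‖ ≤
        |fnorm (compress (f i) h) - fnorm (compress φ h)| * c :=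
      mul_le_mul_of_nonneg_left hψs (abs_nonneg _)
    linarith

lemma continuous_to_weakDual {X : Type*} {S : Set (WeakDual ℂ A)} [TopologicalSpace X] {f : X → S}
    (h : ∀ a, Continuous fun x => (f x : WeakDual ℂ A) a) : Continuous f :=
  continuous_induced_rng.mpr (WeakDual.continuous_of_continuous_eval h)

/-- A family of states carries the weak* topology as its Monge-Kantorovich topology as soon as the
Monge-Kantorovich metric is small on weak* neighbourhoods. -/
lemma IsLipschitzPair.mkTopology_eq (hL : IsLipschitzPair L) {S : Set (WeakDual ℂ A)}
    (hS : S ⊆ states A) (h : ∀ φ ∈ S, ∀ ε : ℝ, 0 < ε →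
      ∀ᶠ ψ : WeakDual ℂ A in 𝓝[S] φ, mkDist L ψ φ ≤ ENNReal.ofReal ε) :
    mkTopology L (fun (φ : S) (a : A) => (φ : WeakDual ℂ A) a) =
      (instTopologicalSpaceSubtype : TopologicalSpace S) := by
  let P : PseudoEMetricSpace S := mkPseudoEMetric L fun (φ : S) (a : A) => (φ : WeakDual ℂ A) a
  refine le_antisymm ?_ ?_
  -- The metric topology is finer: evaluations at elements with L finite are Lipschitz, and density
  -- of the domain with the bound |φ(a)| ≤ ‖a‖ extends continuity to all self-adjoint elements.
  · have h1 : ∀ a : A, L a < ⊤ → @Continuous _ _ P.toUniformSpace.toTopologicalSpace _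
        (fun φ : S => (φ : WeakDual ℂ A) a) := by
      intro m hm
      obtain ⟨c, hc, hmc⟩ := hL.exists_pos_le hm
      have hLip : @LipschitzWith _ _ P _ (Real.toNNReal c) (fun φ : S => (φ : WeakDual ℂ A) m) := by
        intro x y
        have h2 : edist ((x : WeakDual ℂ A) (((c⁻¹ : ℝ) : ℂ) • m))
            ((y : WeakDual ℂ A) (((c⁻¹ : ℝ) : ℂ) • m)) ≤ P.edist x y :=
          le_iSup₂ (f := fun (b : A) (_ : L b ≤ 1) =>
            edist ((x : WeakDual ℂ A) b) ((y : WeakDual ℂ A) b))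
            (((c⁻¹ : ℝ) : ℂ) • m) (hL.smul_le_one hc hmc)
        rw [map_smul, map_smul, edist_dist, dist_eq_norm, ← smul_sub, norm_smul, Complex.norm_real,
          norm_inv, Real.norm_of_nonneg hc.le] at h2
        rw [edist_dist, dist_eq_norm]
        have h3 : ‖(x : WeakDual ℂ A) m - (y : WeakDual ℂ A) m‖ =
            c * (c⁻¹ * ‖(x : WeakDual ℂ A) m - (y : WeakDual ℂ A) m‖) := by
          rw [← mul_assoc, mul_inv_cancel₀ hc.ne', one_mul]
        rw [h3, ENNReal.ofReal_mul hc.le]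
        exact mul_le_mul_right h2 _
      exact @LipschitzWith.continuous _ _ P _ _ _ hLip
    have h2 : ∀ a : A, IsSelfAdjoint a → @Continuous _ _ P.toUniformSpace.toTopologicalSpace _
        (fun φ : S => (φ : WeakDual ℂ A) a) := by
      intro a ha
      refine @continuous_of_uniform_approx_of_continuous _ _ P.toUniformSpace.toTopologicalSpace _ _
        fun U hU => ?_
      obtain ⟨ε, hε, hεU⟩ := Metric.mem_uniformity_dist.mp hU
      obtain ⟨b, hb, hab⟩ := Metric.mem_closure_iff.mp (hL.dense_dom a ha) ε hε
      refine ⟨fun φ => (φ : WeakDual ℂ A) b, h1 b hb, fun φ => hεU ?_⟩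
      rw [dist_eq_norm, ← map_sub]
      refine lt_of_le_of_lt (norm_state_apply_le (hS φ.2) _) ?_
      rwa [dist_eq_norm] at hab
    have h3 : ∀ a : A, @Continuous _ _ P.toUniformSpace.toTopologicalSpace _
        (fun φ : S => (φ : WeakDual ℂ A) a) := by
      intro a
      have h4 : (fun φ : S => (φ : WeakDual ℂ A) a) = fun φ : S =>
          (φ : WeakDual ℂ A) (realPart a : A) + Complex.I * (φ : WeakDual ℂ A) (imaginaryPart a : A) := by
        funext φ
        conv_lhs => rw [← realPart_add_I_smul_imaginaryPart a]
        rw [map_add, map_smul, smul_eq_mul]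
      rw [h4]
      exact @continuous_add_const_mul _ P.toUniformSpace.toTopologicalSpace _ _
        (h2 _ (realPart a).2) (h2 _ (imaginaryPart a).2) _
    rw [← continuous_id_iff_le]
    exact @continuous_to_weakDual _ _ _ S P.toUniformSpace.toTopologicalSpace _ h3
  · refine le_of_nhds_le_nhds fun φ => ?_
    have h1 : Tendsto (fun ψ : S => ψ) (@nhds S instTopologicalSpaceSubtype φ)
        (@nhds S P.toUniformSpace.toTopologicalSpace φ) := by
      refine (@EMetric.tendsto_nhds S _ P _ _ _).mpr fun ε hε => ?_
      obtain ⟨δ, hδ, hδε⟩ : ∃ δ : ℝ, 0 < δ ∧ ENNReal.ofReal δ < ε := by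
        obtain ⟨q, hq0, hqε⟩ := ENNReal.lt_iff_exists_nnreal_btwn.mp hε
        refine ⟨q, by exact_mod_cast hq0, by simpa using hqε⟩
      have h2 := h φ φ.2 δ hδ
      rw [eventually_nhdsWithin_iff] at h2
      have h3 : Tendsto (fun ψ : S => (ψ : WeakDual ℂ A)) (@nhds S instTopologicalSpaceSubtype φ)
        (𝓝 (φ : WeakDual ℂ A)) := continuous_subtype_val.tendsto φ
      filter_upwards [h3.eventually h2] with ψ hψ
      exact lt_of_le_of_lt (hψ ψ.2) hδε
    exact h1

end Estimates

/-! ### Topography, spectrum and states of a direct sum -/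

section Prod

variable {A B : Type u} [NonUnitalCStarAlgebra A] [NonUnitalCStarAlgebra B]
  {M : NonUnitalStarSubalgebra ℂ A} {N : NonUnitalStarSubalgebra ℂ B}

lemma isApproximateUnit_prod {l : Filter A} {l' : Filter B} (hl : l.IsApproximateUnit)
    (hl' : l'.IsApproximateUnit) : (l ×ˢ l').IsApproximateUnit where
  tendsto_mul_left m := by
    rw [nhds_prod_eq]
    exact (hl.tendsto_mul_left m.1).prodMap (hl'.tendsto_mul_left m.2)
  tendsto_mul_right m := by
    rw [nhds_prod_eq]
    exact (hl.tendsto_mul_right m.1).prodMap (hl'.tendsto_mul_right m.2)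
  neBot := by
    have := hl.neBot
    have := hl'.neBot
    infer_instance

lemma IsTopography.prod (hM : IsTopography M) (hN : IsTopography N) :
    IsTopography (M.prod N) where
  isClosed := hM.isClosed.prod hN.isClosed
  comm a ha b hb := Prod.ext (hM.comm _ ha.1 _ hb.1) (hN.comm _ ha.2 _ hb.2)
  approx := by
    obtain ⟨l, hl, hlM⟩ := hM.approx
    obtain ⟨l', hl', hlN⟩ := hN.approx
    exact ⟨l ×ˢ l', isApproximateUnit_prod hl hl', prod_mem_prod hlM hlN⟩

lemma IsTopography.isTopographicMorphism_fst (hM : IsTopography M) (hN : IsTopography N) :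
    IsTopographicMorphism (M.prod N) M (NonUnitalStarAlgHom.fst ℂ A B) where
  surjective a := ⟨(a, 0), rfl⟩
  map_mem m hm := hm.1
  map_approx := by
    obtain ⟨l, hl, hlM⟩ := hM.approx
    obtain ⟨l', hl', hlN⟩ := hN.approx
    have := hl'.neBot
    refine ⟨l ×ˢ l', isApproximateUnit_prod hl hl', prod_mem_prod hlM hlN, ?_⟩
    change (Filter.map Prod.fst (l ×ˢ l')).IsApproximateUnit
    rwa [map_fst_prod]

lemma IsTopography.isTopographicMorphism_snd (hM : IsTopography M) (hN : IsTopography N) :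
    IsTopographicMorphism (M.prod N) N (NonUnitalStarAlgHom.snd ℂ A B) where
  surjective b := ⟨(0, b), rfl⟩
  map_mem m hm := hm.2
  map_approx := by
    obtain ⟨l, hl, hlM⟩ := hM.approx
    obtain ⟨l', hl', hlN⟩ := hN.approx
    have := hl.neBot
    refine ⟨l ×ˢ l', isApproximateUnit_prod hl hl', prod_mem_prod hlM hlN, ?_⟩
    change (Filter.map Prod.snd (l ×ˢ l')).IsApproximateUnit
    rwa [map_snd_prod]

lemma isPos_prod_iff {p : A × B} : IsPos p ↔ IsPos p.1 ∧ IsPos p.2 := by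
  constructor
  · rintro ⟨q, rfl⟩
    exact ⟨⟨q.1, rfl⟩, ⟨q.2, rfl⟩⟩
  · rintro ⟨⟨a, ha⟩, ⟨b, hb⟩⟩
    exact ⟨(a, b), Prod.ext ha hb⟩

lemma isSelfAdjoint_prod_iff {p : A × B} :
    IsSelfAdjoint p ↔ IsSelfAdjoint p.1 ∧ IsSelfAdjoint p.2 :=
  Prod.ext_iff

variable (M N) in
/-- The character of `M × N` induced by a character of `M`. -/
noncomputable def specInl (x : Spectrum M) : Spectrum (M.prod N) :=
  ⟨StrongDual.toWeakDual
    { toFun := fun p => x ⟨p.1.1, p.2.1⟩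
      map_add' := fun p q => map_add x (⟨p.1.1, p.2.1⟩ : M) ⟨q.1.1, q.2.1⟩
      map_smul' := fun c p => map_smul x c (⟨p.1.1, p.2.1⟩ : M)
      cont := (map_continuous x).comp
        ((continuous_fst.comp continuous_subtype_val).subtype_mk _) }, by
    refine ⟨fun h => ?_, fun p q => map_mul x (⟨p.1.1, p.2.1⟩ : M) ⟨q.1.1, q.2.1⟩⟩
    refine x.2.1 (ContinuousLinearMap.ext fun m => ?_)
    exact DFunLike.congr_fun h (⟨(m, 0), m.2, zero_mem N⟩ : M.prod N)⟩

variable (M N) in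
/-- The character of `M × N` induced by a character of `N`. -/
noncomputable def specInr (x : Spectrum N) : Spectrum (M.prod N) :=
  ⟨StrongDual.toWeakDual
    { toFun := fun p => x ⟨p.1.2, p.2.2⟩
      map_add' := fun p q => map_add x (⟨p.1.2, p.2.2⟩ : N) ⟨q.1.2, q.2.2⟩
      map_smul' := fun c p => map_smul x c (⟨p.1.2, p.2.2⟩ : N)
      cont := (map_continuous x).comp
        ((continuous_snd.comp continuous_subtype_val).subtype_mk _) }, by
    refine ⟨fun h => ?_, fun p q => map_mul x (⟨p.1.2, p.2.2⟩ : N) ⟨q.1.2, q.2.2⟩⟩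
    refine x.2.1 (ContinuousLinearMap.ext fun m => ?_)
    exact DFunLike.congr_fun h (⟨(0, m), zero_mem M, m.2⟩ : M.prod N)⟩

lemma continuous_specInl : Continuous (specInl M N) :=
  continuous_to_spectrum fun p =>
    (WeakDual.eval_continuous (⟨p.1.1, p.2.1⟩ : M)).comp continuous_subtype_val

lemma continuous_specInr : Continuous (specInr M N) :=
  continuous_to_spectrum fun p =>
    (WeakDual.eval_continuous (⟨p.1.2, p.2.2⟩ : N)).comp continuous_subtype_val

/-- The disjoint union of subsets of the spectra of `M` and `N`, in the spectrum of `M × N`. -/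
def specSum (K : Set (Spectrum M)) (K' : Set (Spectrum N)) : Set (Spectrum (M.prod N)) :=
  specInl M N '' K ∪ specInr M N '' K'

variable {K : Set (Spectrum M)} {K' : Set (Spectrum N)}

lemma isCompact_specSum (hK : IsCompact K) (hK' : IsCompact K') : IsCompact (specSum K K') :=
  (hK.image continuous_specInl).union (hK'.image continuous_specInr)

lemma specSum_mono {K₁ : Set (Spectrum M)} {K₁' : Set (Spectrum N)} (h : K ⊆ K₁) (h' : K' ⊆ K₁') :
    specSum K K' ⊆ specSum K₁ K₁' :=
  union_subset_union (image_mono h) (image_mono h')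

/-- Locality is expressed through cut-off functions, so this reduces it to the two factors, without
a description of the whole spectrum of `M.prod N`. -/
lemma mem_cutoffs_specSum_iff {p : A × B} :
    p ∈ cutoffs (M.prod N) (specSum K K') ↔ p.1 ∈ cutoffs M K ∧ p.2 ∈ cutoffs N K' := by
  constructor
  · rintro ⟨h1, h2, h3, h4⟩
    refine ⟨⟨(isPos_prod_iff.mp h1).1, (norm_fst_le p).trans h2, h3.1, fun x hx => ?_⟩,
      ⟨(isPos_prod_iff.mp h1).2, (norm_snd_le p).trans h2, h3.2, fun x hx => ?_⟩⟩
    · exact h4 _ (Or.inl ⟨x, hx, rfl⟩)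
    · exact h4 _ (Or.inr ⟨x, hx, rfl⟩)
  · rintro ⟨⟨h1, h2, h3, h4⟩, ⟨h1', h2', h3', h4'⟩⟩
    refine ⟨isPos_prod_iff.mpr ⟨h1, h1'⟩, norm_prod_le_iff.mpr ⟨h2, h2'⟩, ⟨h3, h3'⟩, ?_⟩
    rintro _ (⟨x, hx, rfl⟩ | ⟨x, hx, rfl⟩)
    · exact h4 x hx
    · exact h4' x hx

/-! ### Functionals on a product -/

/-- The restriction of a functional on `A × B` to `A`. -/
noncomputable def resInl (φ : WeakDual ℂ (A × B)) : WeakDual ℂ A :=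
  StrongDual.toWeakDual ((WeakDual.toStrongDual φ).comp (ContinuousLinearMap.inl ℂ A B))

/-- The restriction of a functional on `A × B` to `B`. -/
noncomputable def resInr (φ : WeakDual ℂ (A × B)) : WeakDual ℂ B :=
  StrongDual.toWeakDual ((WeakDual.toStrongDual φ).comp (ContinuousLinearMap.inr ℂ A B))

/-- The functional on `A × B` induced by a functional on `A`. -/
noncomputable def extFst (B : Type u) [NonUnitalCStarAlgebra B] (φ : WeakDual ℂ A) :
    WeakDual ℂ (A × B) :=
  StrongDual.toWeakDual ((WeakDual.toStrongDual φ).comp (ContinuousLinearMap.fst ℂ A B))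

/-- The functional on `A × B` induced by a functional on `B`. -/
noncomputable def extSnd (A : Type u) [NonUnitalCStarAlgebra A] (φ : WeakDual ℂ B) :
    WeakDual ℂ (A × B) :=
  StrongDual.toWeakDual ((WeakDual.toStrongDual φ).comp (ContinuousLinearMap.snd ℂ A B))

@[simp] lemma resInl_apply (φ : WeakDual ℂ (A × B)) (a : A) : resInl φ a = φ (a, 0) := rfl
@[simp] lemma resInr_apply (φ : WeakDual ℂ (A × B)) (b : B) : resInr φ b = φ (0, b) := rfl

lemma apply_eq_resInl_add_resInr (φ : WeakDual ℂ (A × B)) (p : A × B) :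
    φ p = resInl φ p.1 + resInr φ p.2 := by
  rw [resInl_apply, resInr_apply, ← map_add]
  simp

lemma IsPosFun.resInl {φ : WeakDual ℂ (A × B)} (hφ : IsPosFun φ) : IsPosFun (resInl φ) :=
  fun a => hφ.of_isPos (isPos_prod_iff.mpr ⟨⟨a, rfl⟩, isPos_zero⟩)

lemma IsPosFun.resInr {φ : WeakDual ℂ (A × B)} (hφ : IsPosFun φ) : IsPosFun (resInr φ) :=
  fun b => hφ.of_isPos (isPos_prod_iff.mpr ⟨isPos_zero, ⟨b, rfl⟩⟩)

lemma exists_approx_unit_prod (A B : Type u) [NonUnitalCStarAlgebra A] [NonUnitalCStarAlgebra B] :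
    ∃ l : Filter A, ∃ l' : Filter B, l.IsApproximateUnit ∧ l'.IsApproximateUnit ∧
      (l ×ˢ l').IsApproximateUnit ∧ (∀ᶠ u in l, IsPos u ∧ ‖u‖ ≤ 1) ∧
      (∀ᶠ u in l', IsPos u ∧ ‖u‖ ≤ 1) ∧ ∀ᶠ p in l ×ˢ l', IsPos p ∧ ‖p‖ ≤ 1 := by
  obtain ⟨l, hl, hu⟩ := exists_approx_unit A
  obtain ⟨l', hl', hu'⟩ := exists_approx_unit B
  refine ⟨l, l', hl, hl', isApproximateUnit_prod hl hl', hu, hu', ?_⟩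
  filter_upwards [hu.prod_mk hu'] with p hp
  exact ⟨isPos_prod_iff.mpr ⟨hp.1.1, hp.2.1⟩, norm_prod_le_iff.mpr ⟨hp.1.2, hp.2.2⟩⟩

/-- The norm of a positive functional is its limit on squares along an approximate unit, and
approximate units of the factors combine to one of the product. -/
lemma IsPosFun.fnorm_prod {φ : WeakDual ℂ (A × B)} (hφ : IsPosFun φ) :
    fnorm φ = fnorm (QMS.resInl φ) + fnorm (QMS.resInr φ) := by
  obtain ⟨l, l', hl, hl', hll, hu, hu', huu⟩ := exists_approx_unit_prod A B
  have := hll.neBot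
  have h1 := (hφ.resInl.tendsto_mul_self hl (hu.mono fun u h => ⟨h.1.isSelfAdjoint, h.2⟩)).comp
    (tendsto_fst (f := l) (g := l'))
  have h2 := (hφ.resInr.tendsto_mul_self hl' (hu'.mono fun u h => ⟨h.1.isSelfAdjoint, h.2⟩)).comp
    (tendsto_snd (f := l) (g := l'))
  have h3 := hφ.tendsto_mul_self hll (huu.mono fun u h => ⟨h.1.isSelfAdjoint, h.2⟩)
  have h4 := tendsto_nhds_unique h3 ((h1.add h2).congr fun p =>
    (apply_eq_resInl_add_resInr φ (p * p)).symm)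
  exact_mod_cast h4

lemma IsPosFun.fnorm_extFst {φ : WeakDual ℂ A} (hφ : IsPosFun φ) :
    IsPosFun (extFst B φ) ∧ fnorm (extFst B φ) = fnorm φ := by
  have h : IsPosFun (extFst B φ) := fun p => hφ p.1
  refine ⟨h, ?_⟩
  have h1 : QMS.resInl (extFst B φ) = φ := DFunLike.ext _ _ fun a => rfl
  have h2 : fnorm (QMS.resInr (extFst B φ)) = 0 := by
    have : QMS.resInr (extFst B φ) = (0 : ℂ) • QMS.resInr (extFst B φ) := DFunLike.ext _ _ fun b => by
      change φ 0 = (0 : ℂ) * φ 0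
      simp
    rw [this, fnorm_smul]
    simp
  rw [h.fnorm_prod, h1, h2, add_zero]

lemma IsPosFun.fnorm_extSnd {φ : WeakDual ℂ B} (hφ : IsPosFun φ) :
    IsPosFun (extSnd A φ) ∧ fnorm (extSnd A φ) = fnorm φ := by
  have h : IsPosFun (extSnd A φ) := fun p => hφ p.2
  refine ⟨h, ?_⟩
  have h1 : QMS.resInr (extSnd A φ) = φ := DFunLike.ext _ _ fun a => rfl
  have h2 : fnorm (QMS.resInl (extSnd A φ)) = 0 := by
    have : QMS.resInl (extSnd A φ) = (0 : ℂ) • QMS.resInl (extSnd A φ) := DFunLike.ext _ _ fun b => by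
      change φ 0 = (0 : ℂ) * φ 0
      simp
    rw [this, fnorm_smul]
    simp
  rw [h.fnorm_prod, h1, h2, zero_add]

lemma extFst_mem_states {φ : WeakDual ℂ A} (hφ : φ ∈ states A) : extFst B φ ∈ states (A × B) := by
  obtain ⟨h1, h2⟩ := mem_states_iff.mp hφ
  exact mem_states_iff.mpr ⟨h1.fnorm_extFst.1, h1.fnorm_extFst.2.trans h2⟩

lemma extSnd_mem_states {φ : WeakDual ℂ B} (hφ : φ ∈ states B) : extSnd A φ ∈ states (A × B) := by
  obtain ⟨h1, h2⟩ := mem_states_iff.mp hφ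
  exact mem_states_iff.mpr ⟨h1.fnorm_extSnd.1, h1.fnorm_extSnd.2.trans h2⟩

/-- A positive functional is a multiple of a state. -/
lemma IsPosFun.exists_state_smul (hne : (states A).Nonempty) {φ : WeakDual ℂ A}
    (hφ : IsPosFun φ) : ∃ ψ ∈ states A, ∀ a, φ a = (fnorm φ : ℂ) * ψ a := by
  by_cases h0 : fnorm φ = 0
  · obtain ⟨ψ, hψ⟩ := hne
    exact ⟨ψ, hψ, fun a => by rw [eq_zero_of_fnorm_eq_zero h0, h0]; simp⟩
  · refine ⟨_, hφ.normalize_mem_states h0, fun a => ?_⟩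
    change φ a = (fnorm φ : ℂ) * ((((fnorm φ)⁻¹ : ℝ) : ℂ) * φ a)
    rw [← mul_assoc, ← Complex.ofReal_mul, mul_inv_cancel₀ h0]
    simp

/-- States of a product are convex combinations of states of the factors. -/
lemma exists_states_of_mem_states_prod (hA : (states A).Nonempty) (hB : (states B).Nonempty)
    {φ : WeakDual ℂ (A × B)} (hφ : φ ∈ states (A × B)) :
    ∃ ψ ∈ states A, ∃ χ ∈ states B, ∃ s t : ℝ, 0 ≤ s ∧ 0 ≤ t ∧ s + t = 1 ∧
      ∀ p, φ p = s * ψ p.1 + t * χ p.2 := by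
  obtain ⟨h1, h2⟩ := mem_states_iff.mp hφ
  obtain ⟨ψ, hψ, e1⟩ := h1.resInl.exists_state_smul hA
  obtain ⟨χ, hχ, e2⟩ := h1.resInr.exists_state_smul hB
  refine ⟨ψ, hψ, χ, hχ, _, _, fnorm_nonneg _, fnorm_nonneg _, h1.fnorm_prod.symm.trans h2,
    fun p => ?_⟩
  rw [apply_eq_resInl_add_resInr, e1, e2]

lemma norm_state_prod_sub_le (hA : (states A).Nonempty) (hB : (states B).Nonempty)
    {φ : WeakDual ℂ (A × B)} (hφ : φ ∈ states (A × B)) {p : A × B} {z : ℂ} {c : ℝ}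
    (h : ∀ ψ ∈ states A, ‖ψ p.1 - z‖ ≤ c) (h' : ∀ χ ∈ states B, ‖χ p.2 - z‖ ≤ c) :
    ‖φ p - z‖ ≤ c := by
  obtain ⟨ψ, hψ, χ, hχ, s, t, hs, ht, hst, e⟩ := exists_states_of_mem_states_prod hA hB hφ
  have hst' : (s : ℂ) + t = 1 := by exact_mod_cast hst
  have : φ p - z = s * (ψ p.1 - z) + t * (χ p.2 - z) := by
    rw [e p]
    linear_combination z * hst'
  rw [this]
  calc ‖(s : ℂ) * (ψ p.1 - z) + t * (χ p.2 - z)‖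
      ≤ ‖(s : ℂ) * (ψ p.1 - z)‖ + ‖(t : ℂ) * (χ p.2 - z)‖ := norm_add_le _ _
    _ = s * ‖ψ p.1 - z‖ + t * ‖χ p.2 - z‖ := by
      rw [norm_mul, norm_mul, Complex.norm_real, Complex.norm_real, Real.norm_of_nonneg hs,
        Real.norm_of_nonneg ht]
    _ ≤ s * c + t * c := by gcongr; exacts [h ψ hψ, h' χ hχ]
    _ = c := by rw [← add_mul, hst, one_mul]

lemma IsTopography.mem_localStates_specSum_iff (hM : IsTopography M) (hN : IsTopography N)
    (hK : IsCompact K) (hK' : IsCompact K') {φ : WeakDual ℂ (A × B)} :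
    φ ∈ localStates (M.prod N) (specSum K K') ↔ φ ∈ states (A × B) ∧
      ∀ m ∈ cutoffs M K, ∀ n ∈ cutoffs N K', φ (m, n) = 1 := by
  rw [(hM.prod hN).mem_localStates_iff (isCompact_specSum hK hK')]
  refine and_congr_right fun _ => ⟨fun h m hm n hn => h _ (mem_cutoffs_specSum_iff.mpr ⟨hm, hn⟩),
    fun h p hp => ?_⟩
  obtain ⟨h1, h2⟩ := mem_cutoffs_specSum_iff.mp hp
  exact h _ h1 _ h2

lemma IsTopography.mem_Loc_specSum_iff (hM : IsTopography M) (hN : IsTopography N)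
    (hK : IsCompact K) (hK' : IsCompact K') {L : A × B → ℝ≥0∞} {p : A × B} :
    p ∈ Loc L (M.prod N) (specSum K K') ↔ (IsSelfAdjoint p.1 ∧ IsSelfAdjoint p.2) ∧
      ((∀ u ∈ cutoffs M K, u * p.1 = p.1) ∧ ∀ v ∈ cutoffs N K', v * p.2 = p.2) ∧ L p < ⊤ := by
  rw [(hM.prod hN).mem_Loc_iff (isCompact_specSum hK hK'), isSelfAdjoint_prod_iff]
  refine and_congr_right fun _ => and_congr_left fun _ => ⟨fun h => ⟨fun u hu => ?_, fun v hv => ?_⟩,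
    fun h q hq => ?_⟩
  · obtain ⟨v, hv⟩ := hN.cutoffs_nonempty hK'
    exact congrArg Prod.fst (h (u, v) (mem_cutoffs_specSum_iff.mpr ⟨hu, hv⟩))
  · obtain ⟨u, hu⟩ := hM.cutoffs_nonempty hK
    exact congrArg Prod.snd (h (u, v) (mem_cutoffs_specSum_iff.mpr ⟨hu, hv⟩))
  · obtain ⟨h1, h2⟩ := mem_cutoffs_specSum_iff.mp hq
    exact Prod.ext (h.1 _ h1) (h.2 _ h2)

end Prod

/-! ### The gap, and the seminorm on the direct sum -/

section Gap

variable {A B : Type u} [NonUnitalCStarAlgebra A] [NonUnitalCStarAlgebra B]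
  {M : NonUnitalStarSubalgebra ℂ A} {N : NonUnitalStarSubalgebra ℂ B}
  {L : A → ℝ≥0∞} {L' : B → ℝ≥0∞}

/-- The largest distance between the values of the states of `A` at `a` and the values of the
states of `B` at `b`. -/
noncomputable def gap (a : A) (b : B) : ℝ≥0∞ :=
  ⨆ φ : states A, ⨆ ψ : states B, edist ((φ : WeakDual ℂ A) a) ((ψ : WeakDual ℂ B) b)

lemma gap_le_iff {a : A} {b : B} {c : ℝ} (hc : 0 ≤ c) :
    gap a b ≤ ENNReal.ofReal c ↔ ∀ φ ∈ states A, ∀ ψ ∈ states B, ‖φ a - ψ b‖ ≤ c := by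
  simp only [gap, iSup_le_iff, Subtype.forall, edist_dist, ENNReal.ofReal_le_ofReal_iff hc,
    dist_eq_norm]

lemma gap_comm (a : A) (b : B) : gap a b = gap b a := by
  unfold gap
  rw [iSup_comm]
  simp only [edist_comm]

lemma gap_zero_right_le (a : A) : gap a (0 : B) ≤ ENNReal.ofReal ‖a‖ :=
  (gap_le_iff (norm_nonneg a)).mpr fun φ hφ ψ _ => by
    simpa using norm_state_apply_le hφ a

lemma gap_lt_top (a : A) (b : B) : gap a b < ⊤ := by
  refine lt_of_le_of_lt ((gap_le_iff (by positivity : 0 ≤ ‖a‖ + ‖b‖)).mpr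
    fun φ hφ ψ hψ => ?_) ENNReal.ofReal_lt_top
  exact (norm_sub_le _ _).trans (add_le_add (norm_state_apply_le hφ a) (norm_state_apply_le hψ b))

lemma norm_sub_le_gap (a : A) (b : B) {φ : WeakDual ℂ A} {ψ : WeakDual ℂ B} (hφ : φ ∈ states A)
    (hψ : ψ ∈ states B) : ‖φ a - ψ b‖ ≤ (gap a b).toReal :=
  (gap_le_iff ENNReal.toReal_nonneg).mp (ENNReal.ofReal_toReal (gap_lt_top a b).ne).ge φ hφ ψ hψ

lemma gap_add_le (a a' : A) (b b' : B) : gap (a + a') (b + b') ≤ gap a b + gap a' b' := by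
  refine iSup₂_le fun φ ψ => ?_
  rw [map_add, map_add]
  refine (edist_add_add_le _ _ _ _).trans (add_le_add ?_ ?_)
  · exact le_iSup₂ (f := fun (φ : states A) (ψ : states B) =>
      edist ((φ : WeakDual ℂ A) a) ((ψ : WeakDual ℂ B) b)) φ ψ
  · exact le_iSup₂ (f := fun (φ : states A) (ψ : states B) =>
      edist ((φ : WeakDual ℂ A) a') ((ψ : WeakDual ℂ B) b')) φ ψ

lemma gap_smul (t : ℝ) (a : A) (b : B) :
    gap ((t : ℂ) • a) ((t : ℂ) • b) = ENNReal.ofReal |t| * gap a b := by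
  simp only [gap, ENNReal.mul_iSup]
  refine iSup_congr fun φ => iSup_congr fun ψ => ?_
  rw [map_smul, map_smul, edist_dist, edist_dist, ← ENNReal.ofReal_mul (abs_nonneg t), dist_smul₀,
    Complex.norm_real, Real.norm_eq_abs]

/-- Insert the scalar φ(a)ψ(b′). On all states of `A`, a′ is within gap(a′, b′) of ψ(b′), and on all
states of `B`, b is within gap(a, b) of φ(a). Multiplying by a and by b′ costs their norms. -/
lemma gap_jordan_le {a a' : A} {b b' : B} (ha : IsSelfAdjoint a) (ha' : IsSelfAdjoint a')
    (hb : IsSelfAdjoint b) (hb' : IsSelfAdjoint b') :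
    gap (jordan a a') (jordan b b') ≤ ‖a‖ₑ * gap a' b' + gap a b * ‖b'‖ₑ := by
  have e : ‖a‖ₑ * gap a' b' + gap a b * ‖b'‖ₑ =
      ENNReal.ofReal (‖a‖ * (gap a' b').toReal + (gap a b).toReal * ‖b'‖) := by
    rw [ENNReal.ofReal_add (by positivity) (by positivity), ENNReal.ofReal_mul (norm_nonneg _),
      ENNReal.ofReal_mul ENNReal.toReal_nonneg, ENNReal.ofReal_toReal (gap_lt_top _ _).ne,
      ENNReal.ofReal_toReal (gap_lt_top _ _).ne, ofReal_norm, ofReal_norm]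
  rw [e, gap_le_iff (by positivity)]
  intro φ hφ ψ hψ
  have e1 : ψ b' = ((ψ b').re : ℂ) := (mem_states_iff.mp hψ).1.eq_re hb'
  have e2 : φ a = ((φ a).re : ℂ) := (mem_states_iff.mp hφ).1.eq_re ha
  have h1 := norm_state_jordan_sub_le hφ ha ha' (s := (ψ b').re) ENNReal.toReal_nonneg
    fun χ hχ => by rw [← e1]; exact norm_sub_le_gap a' b' hχ hψ
  have h2 := norm_state_jordan_sub_le hψ hb' hb (s := (φ a).re) ENNReal.toReal_nonneg
    fun χ hχ => by rw [← e2, norm_sub_rev]; exact norm_sub_le_gap a b hφ hχ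
  rw [← e1] at h1
  rw [← e2, jordan_comm] at h2
  calc ‖φ (jordan a a') - ψ (jordan b b')‖
      = ‖(φ (jordan a a') - ψ b' * φ a) - (ψ (jordan b b') - φ a * ψ b')‖ := by ring_nf
    _ ≤ _ := norm_sub_le _ _
    _ ≤ _ := by linarith

lemma gap_lie_le {a a' : A} {b b' : B} (ha : IsSelfAdjoint a) (ha' : IsSelfAdjoint a')
    (hb : IsSelfAdjoint b) (hb' : IsSelfAdjoint b') :
    gap (lie a a') (lie b b') ≤ ‖a‖ₑ * gap a' b' + gap a b * ‖b'‖ₑ := by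
  have e : ‖a‖ₑ * gap a' b' + gap a b * ‖b'‖ₑ =
      ENNReal.ofReal (‖a‖ * (gap a' b').toReal + (gap a b).toReal * ‖b'‖) := by
    rw [ENNReal.ofReal_add (by positivity) (by positivity), ENNReal.ofReal_mul (norm_nonneg _),
      ENNReal.ofReal_mul ENNReal.toReal_nonneg, ENNReal.ofReal_toReal (gap_lt_top _ _).ne,
      ENNReal.ofReal_toReal (gap_lt_top _ _).ne, ofReal_norm, ofReal_norm]
  rw [e, gap_le_iff (by positivity)]
  intro φ hφ ψ hψ
  have e1 : ψ b' = ((ψ b').re : ℂ) := (mem_states_iff.mp hψ).1.eq_re hb'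
  have e2 : φ a = ((φ a).re : ℂ) := (mem_states_iff.mp hφ).1.eq_re ha
  have h1 := norm_state_lie_le hφ ha ha' (s := (ψ b').re) ENNReal.toReal_nonneg
    fun χ hχ => by rw [← e1]; exact norm_sub_le_gap a' b' hχ hψ
  have h2 := norm_state_lie_le hψ hb' hb (s := (φ a).re) ENNReal.toReal_nonneg
    fun χ hχ => by rw [← e2, norm_sub_rev]; exact norm_sub_le_gap a b hφ hχ
  rw [norm_lie_swap] at h2
  exact (norm_sub_le _ _).trans (by linarith)

/-- The seminorm on the product which combines two seminorms and the gap. -/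
noncomputable def prodL (L : A → ℝ≥0∞) (L' : B → ℝ≥0∞) (C : ℝ) (p : A × B) : ℝ≥0∞ :=
  max (max (L p.1) (L' p.2)) ((ENNReal.ofReal C)⁻¹ * gap p.1 p.2)

variable {C : ℝ}

lemma prodL_le_iff (hC : 0 < C) {p : A × B} {c : ℝ≥0∞} :
    prodL L L' C p ≤ c ↔ (L p.1 ≤ c ∧ L' p.2 ≤ c) ∧ gap p.1 p.2 ≤ ENNReal.ofReal C * c := by
  rw [prodL, max_le_iff, max_le_iff,
    ENNReal.inv_mul_le_iff (ENNReal.ofReal_pos.mpr hC).ne' ENNReal.ofReal_ne_top]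

lemma fst_le_prodL (p : A × B) : L p.1 ≤ prodL L L' C p :=
  (le_max_left _ _).trans (le_max_left _ _)

lemma snd_le_prodL (p : A × B) : L' p.2 ≤ prodL L L' C p :=
  (le_max_right _ _).trans (le_max_left _ _)

lemma gap_le_mul_prodL (hC : 0 < C) (p : A × B) :
    gap p.1 p.2 ≤ ENNReal.ofReal C * prodL L L' C p :=
  ((prodL_le_iff hC).mp le_rfl).2

lemma prodL_lt_top_iff (hC : 0 < C) {p : A × B} :
    prodL L L' C p < ⊤ ↔ L p.1 < ⊤ ∧ L' p.2 < ⊤ := by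
  refine ⟨fun h => ⟨(fst_le_prodL p).trans_lt h, (snd_le_prodL p).trans_lt h⟩, fun h => ?_⟩
  refine max_lt (max_lt h.1 h.2) (ENNReal.mul_lt_top ?_ (gap_lt_top _ _))
  exact ENNReal.inv_lt_top.mpr (ENNReal.ofReal_pos.mpr hC)

lemma norm_sub_le_of_prodL_le_one (hC : 0 < C) {p : A × B} (hp : prodL L L' C p ≤ 1)
    {φ : WeakDual ℂ A} {ψ : WeakDual ℂ B} (hφ : φ ∈ states A) (hψ : ψ ∈ states B) :
    ‖φ p.1 - ψ p.2‖ ≤ C :=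
  (gap_le_iff hC.le).mp (by simpa using ((prodL_le_iff hC).mp hp).2) φ hφ ψ hψ

lemma IsLipschitzPair.apply_zero (h : IsLipschitzPair L) : L 0 = 0 :=
  (h.eq_zero_iff 0).mpr (Or.inl rfl)

/-- For the kernel: if both factors have units, a vanishing gap makes the two scalars equal. If one
component is zero, a vanishing gap makes the other vanish on all states, hence be zero. Thus only
zero remains when a unit is missing. -/
lemma IsLipschitzPair.prod (hL : IsLipschitzPair L) (hL' : IsLipschitzPair L')
    (hA : (states A).Nonempty) (hB : (states B).Nonempty) (hC : 0 < C) :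
    IsLipschitzPair (prodL L L' C) where
  isSelfAdjoint_of_lt_top p hp := by
    rw [prodL_lt_top_iff hC] at hp
    exact isSelfAdjoint_prod_iff.mpr ⟨hL.isSelfAdjoint_of_lt_top _ hp.1,
      hL'.isSelfAdjoint_of_lt_top _ hp.2⟩
  add_le p q := by
    refine (prodL_le_iff hC).mpr ⟨⟨?_, ?_⟩, ?_⟩
    · exact (hL.add_le _ _).trans (add_le_add (fst_le_prodL p) (fst_le_prodL q))
    · exact (hL'.add_le _ _).trans (add_le_add (snd_le_prodL p) (snd_le_prodL q))
    · rw [mul_add]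
      exact (gap_add_le _ _ _ _).trans
        (add_le_add (gap_le_mul_prodL hC p) (gap_le_mul_prodL hC q))
  smul_eq t p := by
    have hm : ∀ x y : ℝ≥0∞, ENNReal.ofReal |t| * max x y =
        max (ENNReal.ofReal |t| * x) (ENNReal.ofReal |t| * y) := fun x y =>
      (show Monotone fun x : ℝ≥0∞ => ENNReal.ofReal |t| * x from
        fun _ _ h => mul_le_mul' le_rfl h).map_max
    unfold prodL
    rw [Prod.smul_fst, Prod.smul_snd, hL.smul_eq, hL'.smul_eq, gap_smul, mul_left_comm, hm, hm]
  dense_dom p hp := by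
    have e : {q : A × B | prodL L L' C q < ⊤} = {a | L a < ⊤} ×ˢ {b | L' b < ⊤} :=
      Set.ext fun q => prodL_lt_top_iff hC
    rw [isSelfAdjoint_prod_iff] at hp
    rw [e, closure_prod_eq]
    exact ⟨hL.dense_dom _ hp.1, hL'.dense_dom _ hp.2⟩
  eq_zero_iff p := by
    have key : prodL L L' C p = 0 ↔
        (p.1 ∈ realScalars A ∧ p.2 ∈ realScalars B) ∧ gap p.1 p.2 ≤ ENNReal.ofReal 0 := by
      rw [← nonpos_iff_eq_zero, prodL_le_iff hC]
      simp only [nonpos_iff_eq_zero, mul_zero, hL.eq_zero_iff, hL'.eq_zero_iff, ENNReal.ofReal_zero]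
    rw [key, gap_le_iff le_rfl]
    simp only [norm_le_zero_iff, sub_eq_zero]
    obtain ⟨φ, hφ⟩ := hA
    obtain ⟨ψ, hψ⟩ := hB
    have hunit : ∀ {E : Type u} [NonUnitalCStarAlgebra E] {e : E}, (∀ b, e * b = b ∧ b * e = b) →
        ∀ χ ∈ states E, χ e = 1 := by
      intro E _ e he χ hχ
      obtain ⟨h1, h2⟩ := mem_states_iff.mp hχ
      obtain ⟨l, hl, hu⟩ := exists_approx_unit E
      have := hl.neBot
      have hl1 : Tendsto (fun u => u) l (𝓝 e) :=
        (hl.tendsto_mul_left e).congr fun u => (he u).1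
      have h3 := ((map_continuous χ).tendsto _).comp (hl1.mul hl1)
      rw [(he e).1] at h3
      have h4 := h1.tendsto_mul_self hl (hu.mono fun u h => ⟨h.1.isSelfAdjoint, h.2⟩)
      rw [h2] at h4
      simpa using tendsto_nhds_unique h3 h4
    have hz : ∀ {E : Type u} [NonUnitalCStarAlgebra E] {y : E}, y ∈ realScalars E →
        (∀ χ ∈ states E, χ y = 0) → y = 0 := by
      intro E _ y hy h
      obtain rfl | ⟨e, t, he, rfl⟩ := hy
      · rfl
      · refine eq_of_states ?_ (IsSelfAdjoint.zero E) fun χ hχ => by rw [h χ hχ, map_zero]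
        have : star e = e := by
          have h1 := (he (star e)).1
          have h2 := congrArg star (he (star e)).1
          rw [star_mul, star_star] at h2
          exact h1.symm.trans h2
        rw [IsSelfAdjoint, star_smul, this, Complex.star_def, Complex.conj_ofReal]
    constructor
    · rintro ⟨⟨h1, h2⟩, h3⟩
      obtain ⟨a, b⟩ := p
      dsimp only at h1 h2 h3
      rcases h1 with rfl | ⟨e, t, he, rfl⟩
      · left
        rw [hz h2 fun χ hχ => by rw [← h3 φ hφ χ hχ, map_zero]]
        rfl
      · rcases h2 with rfl | ⟨e', t', he', rfl⟩
        · left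
          rw [hz (y := (t : ℂ) • e) (Or.inr ⟨e, t, he, rfl⟩)
            fun χ hχ => by rw [h3 χ hχ ψ hψ, map_zero]]
          rfl
        · right
          have h4 := h3 φ hφ ψ hψ
          rw [map_smul, map_smul, hunit he φ hφ, hunit he' ψ hψ, smul_eq_mul, smul_eq_mul, mul_one,
            mul_one] at h4
          rw [← h4]
          exact ⟨(e, e'), t, fun q => ⟨Prod.ext (he _).1 (he' _).1, Prod.ext (he _).2 (he' _).2⟩,
            rfl⟩
    · rintro (rfl | ⟨e, t, he, rfl⟩)
      · exact ⟨⟨Or.inl rfl, Or.inl rfl⟩, fun φ _ ψ _ => by simp⟩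
      · have h1 : ∀ b, e.1 * b = b ∧ b * e.1 = b := fun b =>
          ⟨congrArg Prod.fst (he (b, 0)).1, congrArg Prod.fst (he (b, 0)).2⟩
        have h2 : ∀ b, e.2 * b = b ∧ b * e.2 = b := fun b =>
          ⟨congrArg Prod.snd (he (0, b)).1, congrArg Prod.snd (he (0, b)).2⟩
        refine ⟨⟨Or.inr ⟨e.1, t, h1, rfl⟩, Or.inr ⟨e.2, t, h2, rfl⟩⟩, fun χ hχ χ' hχ' => ?_⟩
        rw [Prod.smul_fst, Prod.smul_snd, map_smul, map_smul, hunit h1 χ hχ, hunit h2 χ' hχ']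

/-- The gap is a supremum of functions that are continuous in (a, b), hence lower semi-continuous.
-/
lemma IsLSC.prod (hL : IsLSC L) (hL' : IsLSC L') (hC : 0 < C) : IsLSC (prodL L L' C) := by
  intro p hp c hc
  have hp' := isSelfAdjoint_prod_iff.mp hp
  have h1 : Tendsto Prod.fst (𝓝[{q : A × B | IsSelfAdjoint q}] p) (𝓝[{a | IsSelfAdjoint a}] p.1) :=
    tendsto_nhdsWithin_of_tendsto_nhds_of_eventually_within _
      (continuous_fst.continuousAt.tendsto.mono_left nhdsWithin_le_nhds)
      (eventually_mem_nhdsWithin.mono fun q hq => (isSelfAdjoint_prod_iff.mp hq).1)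
  have h2 : Tendsto Prod.snd (𝓝[{q : A × B | IsSelfAdjoint q}] p) (𝓝[{b | IsSelfAdjoint b}] p.2) :=
    tendsto_nhdsWithin_of_tendsto_nhds_of_eventually_within _
      (continuous_snd.continuousAt.tendsto.mono_left nhdsWithin_le_nhds)
      (eventually_mem_nhdsWithin.mono fun q hq => (isSelfAdjoint_prod_iff.mp hq).2)
  rw [gt_iff_lt, prodL, lt_max_iff, lt_max_iff] at hc
  rcases hc with (hc | hc) | hc
  · filter_upwards [h1.eventually (hL p.1 hp'.1 c hc)] with q hq
    exact hq.trans_le (fst_le_prodL q)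
  · filter_upwards [h2.eventually (hL' p.2 hp'.2 c hc)] with q hq
    exact hq.trans_le (snd_le_prodL q)
  · have hC' : (ENNReal.ofReal C)⁻¹ ≠ ⊤ :=
      (ENNReal.inv_lt_top.mpr (ENNReal.ofReal_pos.mpr hC)).ne
    simp only [gap, ENNReal.mul_iSup, lt_iSup_iff] at hc
    obtain ⟨φ, ψ, hc⟩ := hc
    have hcont : Continuous fun q : A × B =>
        (ENNReal.ofReal C)⁻¹ * edist ((φ : WeakDual ℂ A) q.1) ((ψ : WeakDual ℂ B) q.2) :=
      (ENNReal.continuous_const_mul hC').comp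
        (((map_continuous φ.1).comp continuous_fst).edist ((map_continuous ψ.1).comp continuous_snd))
    filter_upwards [(hcont.tendsto p).eventually_const_lt hc |>.filter_mono nhdsWithin_le_nhds]
      with q hq
    refine hq.trans_le ((mul_le_mul_right ?_ _).trans (le_max_right _ _))
    exact le_iSup₂ (f := fun (φ : states A) (ψ : states B) =>
      edist ((φ : WeakDual ℂ A) q.1) ((ψ : WeakDual ℂ B) q.2)) φ ψ

lemma prodL_jordan_le (hC : 0 < C)
    (hL : ∀ a b : A, IsSelfAdjoint a → IsSelfAdjoint b → L (jordan a b) ≤ ‖a‖ₑ * L b + L a * ‖b‖ₑ)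
    (hL' : ∀ a b : B, IsSelfAdjoint a → IsSelfAdjoint b →
      L' (jordan a b) ≤ ‖a‖ₑ * L' b + L' a * ‖b‖ₑ)
    {p q : A × B} (hp : IsSelfAdjoint p) (hq : IsSelfAdjoint q) :
    prodL L L' C (jordan p q) ≤ prodL L L' C p * ‖q‖ₑ + prodL L L' C q * ‖p‖ₑ := by
  rw [isSelfAdjoint_prod_iff] at hp hq
  have hp1 : ‖p.1‖ₑ ≤ ‖p‖ₑ := enorm_le_iff_norm_le.mpr (norm_fst_le p)
  have hq1 : ‖q.1‖ₑ ≤ ‖q‖ₑ := enorm_le_iff_norm_le.mpr (norm_fst_le q)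
  have hp2 : ‖p.2‖ₑ ≤ ‖p‖ₑ := enorm_le_iff_norm_le.mpr (norm_snd_le p)
  have hq2 : ‖q.2‖ₑ ≤ ‖q‖ₑ := enorm_le_iff_norm_le.mpr (norm_snd_le q)
  rw [add_comm, mul_comm (prodL L L' C q)]
  refine (prodL_le_iff hC).mpr ⟨⟨?_, ?_⟩, ?_⟩
  · exact (hL _ _ hp.1 hq.1).trans (add_le_add (mul_le_mul' hp1 (fst_le_prodL q))
      (mul_le_mul' (fst_le_prodL p) hq1))
  · exact (hL' _ _ hp.2 hq.2).trans (add_le_add (mul_le_mul' hp2 (snd_le_prodL q))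
      (mul_le_mul' (snd_le_prodL p) hq2))
  · rw [mul_add, mul_left_comm, ← mul_assoc (ENNReal.ofReal C)]
    exact (gap_jordan_le hp.1 hq.1 hp.2 hq.2).trans
      (add_le_add (mul_le_mul' hp1 (gap_le_mul_prodL hC q))
        (mul_le_mul' (gap_le_mul_prodL hC p) hq2))

lemma prodL_lie_le (hC : 0 < C)
    (hL : ∀ a b : A, IsSelfAdjoint a → IsSelfAdjoint b → L (lie a b) ≤ ‖a‖ₑ * L b + L a * ‖b‖ₑ)
    (hL' : ∀ a b : B, IsSelfAdjoint a → IsSelfAdjoint b →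
      L' (lie a b) ≤ ‖a‖ₑ * L' b + L' a * ‖b‖ₑ)
    {p q : A × B} (hp : IsSelfAdjoint p) (hq : IsSelfAdjoint q) :
    prodL L L' C (lie p q) ≤ prodL L L' C p * ‖q‖ₑ + prodL L L' C q * ‖p‖ₑ := by
  rw [isSelfAdjoint_prod_iff] at hp hq
  have hp1 : ‖p.1‖ₑ ≤ ‖p‖ₑ := enorm_le_iff_norm_le.mpr (norm_fst_le p)
  have hq1 : ‖q.1‖ₑ ≤ ‖q‖ₑ := enorm_le_iff_norm_le.mpr (norm_fst_le q)
  have hp2 : ‖p.2‖ₑ ≤ ‖p‖ₑ := enorm_le_iff_norm_le.mpr (norm_snd_le p)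
  have hq2 : ‖q.2‖ₑ ≤ ‖q‖ₑ := enorm_le_iff_norm_le.mpr (norm_snd_le q)
  rw [add_comm, mul_comm (prodL L L' C q)]
  refine (prodL_le_iff hC).mpr ⟨⟨?_, ?_⟩, ?_⟩
  · exact (hL _ _ hp.1 hq.1).trans (add_le_add (mul_le_mul' hp1 (fst_le_prodL q))
      (mul_le_mul' (fst_le_prodL p) hq1))
  · exact (hL' _ _ hp.2 hq.2).trans (add_le_add (mul_le_mul' hp2 (snd_le_prodL q))
      (mul_le_mul' (snd_le_prodL p) hq2))
  · rw [mul_add, mul_left_comm, ← mul_assoc (ENNReal.ofReal C)]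
    exact (gap_lie_le hp.1 hq.1 hp.2 hq.2).trans
      (add_le_add (mul_le_mul' hp1 (gap_le_mul_prodL hC q))
        (mul_le_mul' (gap_le_mul_prodL hC p) hq2))

/-- All elements of the unit ball of the product are uniformly close to a scalar on the states. -/
lemma exists_real_norm_sub_le (hA : (states A).Nonempty) (hB : (states B).Nonempty) (hC : 0 < C)
    {p : A × B} (hp : prodL L L' C p ≤ 1) (hsa : IsSelfAdjoint p) :
    ∃ s : ℝ, (∀ χ ∈ states A, ‖χ p.1 - s‖ ≤ 2 * C) ∧ (∀ χ ∈ states B, ‖χ p.2 - s‖ ≤ 2 * C) ∧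
      ∀ χ ∈ states (A × B), ‖χ p - s‖ ≤ 2 * C := by
  have ⟨φ, hφ⟩ := hA
  have ⟨ψ, hψ⟩ := hB
  have e : φ p.1 = ((φ p.1).re : ℂ) := (mem_states_iff.mp hφ).1.eq_re (isSelfAdjoint_prod_iff.mp hsa).1
  have hb : ∀ χ ∈ states B, ‖χ p.2 - ((φ p.1).re : ℂ)‖ ≤ C := fun χ hχ => by
    rw [← e, norm_sub_rev]
    exact norm_sub_le_of_prodL_le_one hC hp hφ hχ
  have h1 : ∀ χ ∈ states A, ‖χ p.1 - ((φ p.1).re : ℂ)‖ ≤ 2 * C := fun χ hχ =>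
    calc _ ≤ ‖χ p.1 - ψ p.2‖ + ‖ψ p.2 - ((φ p.1).re : ℂ)‖ := norm_sub_le_norm_sub_add_norm_sub ..
      _ ≤ C + C := add_le_add (norm_sub_le_of_prodL_le_one hC hp hχ hψ) (hb ψ hψ)
      _ = 2 * C := by ring
  have h2 : ∀ χ ∈ states B, ‖χ p.2 - ((φ p.1).re : ℂ)‖ ≤ 2 * C := fun χ hχ =>
    (hb χ hχ).trans (by linarith)
  exact ⟨_, h1, h2, fun χ hχ => norm_state_prod_sub_le hA hB hχ h1 h2⟩

/-- Elements of the unit ball lie within 2C of a scalar s on all states, so p − s may be compressed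
by some h in the topography at a cost governed by 1 − φ(h). The compression is the sum of its parts
in the two factors, each controlled by `IsQuantumLCMS.eventually_compress_sub_le`. -/
lemma IsQuantumLCMS.prod (hQ : IsQuantumLCMS L M) (hQ' : IsQuantumLCMS L' N)
    (hA : (states A).Nonempty) (hB : (states B).Nonempty) (hC : 0 < C) :
    IsQuantumLCMS (prodL L L' C) (M.prod N) where
  isLipschitzPair := hQ.isLipschitzPair.prod hQ'.isLipschitzPair hA hB hC
  isTopography := hQ.isTopography.prod hQ'.isTopography
  metrizes S hS _ := by
    have hM := hQ.isTopography
    have hN := hQ'.isTopography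
    have hLD := hQ.isLipschitzPair.prod hQ'.isLipschitzPair hA hB hC
    refine hLD.mkTopology_eq hS fun φ hφS ε hε => ?_
    have hφ := mem_states_iff.mp (hS hφS)
    obtain ⟨l, hl, hlb⟩ := hM.exists_approx_bumps
    obtain ⟨l', hl', hlb'⟩ := hN.exists_approx_bumps
    have hll := isApproximateUnit_prod hl hl'
    have := hll.neBot
    have hprop : ∀ᶠ p in l ×ˢ l', IsPos p ∧ ‖p‖ ≤ 1 ∧ IsPos (p - p * p) ∧
        (∃ K : Set (Spectrum M), IsCompact K ∧ p.1 ∈ bumps M K) ∧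
        ∃ K : Set (Spectrum N), IsCompact K ∧ p.2 ∈ bumps N K := by
      filter_upwards [hlb.prod_mk hlb'] with p ⟨⟨K, hK, h1⟩, ⟨K', hK', h2⟩⟩
      exact ⟨isPos_prod_iff.mpr ⟨hM.isPos_of_mem_bumps h1, hN.isPos_of_mem_bumps h2⟩,
        norm_prod_le_iff.mpr ⟨hM.norm_le_one h1.1 h1.2.1, hN.norm_le_one h2.1 h2.2.1⟩,
        isPos_prod_iff.mpr ⟨hM.isPos_sub_mul_self h1.1 h1.2.1, hN.isPos_sub_mul_self h2.1 h2.2.1⟩,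
        ⟨K, hK, h1⟩, ⟨K', hK', h2⟩⟩
    have hsmall : ∀ {ι : Type u} {F : Filter ι} {g : ι → ℂ}, Tendsto g F (𝓝 1) →
        Tendsto (fun i => 2 * (2 * C * √(1 - (g i).re))) F (𝓝 0) := by
      intro ι F g hg
      have : Tendsto (fun z : ℂ => 2 * (2 * C * √(1 - z.re))) (𝓝 1) (𝓝 0) := by
        have hc : Continuous fun z : ℂ => 2 * (2 * C * √(1 - z.re)) := by fun_prop
        simpa using hc.tendsto 1
      exact this.comp hg
    have hlim := hφ.1.tendsto_apply hll (hprop.mono fun p h => ⟨h.1.isSelfAdjoint, h.2.1⟩)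
      (hprop.mono fun p h => h.2.2.1)
    rw [hφ.2, Complex.ofReal_one] at hlim
    -- As φ tends to 1 along the approximate unit, some compactly supported h has compression error
    -- below ε/4 at φ; by weak* continuity the same holds for ψ near φ.
    obtain ⟨h, hhφ, hh, hh1, hhh, ⟨K, hK, hu⟩, K', hK', hv⟩ :=
      (((hsmall hlim).eventually_lt_const (by positivity : (0 : ℝ) < ε / 4)).and hprop).exists
    have hev : Continuous fun ψ : WeakDual ℂ (A × B) => 2 * (2 * C * √(1 - (ψ h).re)) := by
      have hc : Continuous fun z : ℂ => 2 * (2 * C * √(1 - z.re)) := by fun_prop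
      exact hc.comp (WeakDual.eval_continuous (𝕜 := ℂ) h)
    have hψ1 : ∀ᶠ ψ : WeakDual ℂ (A × B) in 𝓝[S] φ, 2 * (2 * C * √(1 - (ψ h).re)) < ε / 4 :=
      ((hev.tendsto φ).eventually_lt_const hhφ).filter_mono nhdsWithin_le_nhds
    have hSev : ∀ᶠ ψ : WeakDual ℂ (A × B) in 𝓝[S] φ, ψ ∈ states (A × B) :=
      eventually_mem_nhdsWithin.mono fun ψ h => hS h
    have hl1 : Tendsto (fun ψ : WeakDual ℂ (A × B) => resInl ψ) (𝓝[S] φ) (𝓝 (resInl φ)) :=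
      ((WeakDual.continuous_of_continuous_eval fun a =>
        WeakDual.eval_continuous (𝕜 := ℂ) ((a, 0) : A × B)).tendsto φ).mono_left nhdsWithin_le_nhds
    have hl2 : Tendsto (fun ψ : WeakDual ℂ (A × B) => resInr ψ) (𝓝[S] φ) (𝓝 (resInr φ)) :=
      ((WeakDual.continuous_of_continuous_eval fun b =>
        WeakDual.eval_continuous (𝕜 := ℂ) ((0, b) : A × B)).tendsto φ).mono_left nhdsWithin_le_nhds
    have h1 := hQ.eventually_compress_sub_le (c := 2 * C) hK hu (hSev.mono fun ψ hψ => by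
        obtain ⟨p1, p2⟩ := mem_states_iff.mp hψ
        refine ⟨p1.resInl, ?_⟩
        have := p1.fnorm_prod
        have := fnorm_nonneg (resInr ψ)
        linarith) hφ.1.resInl hl1 (by positivity : 0 < ε / 4)
    have h2 := hQ'.eventually_compress_sub_le (c := 2 * C) hK' hv (hSev.mono fun ψ hψ => by
        obtain ⟨p1, p2⟩ := mem_states_iff.mp hψ
        refine ⟨p1.resInr, ?_⟩
        have := p1.fnorm_prod
        have := fnorm_nonneg (resInl ψ)
        linarith) hφ.1.resInr hl2 (by positivity : 0 < ε / 4)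
    filter_upwards [hψ1, hSev, h1, h2] with ψ hψ1 hψ h1 h2
    refine (mkDist_le_iff hε.le).mpr fun p hp => ?_
    have hsa := hLD.isSelfAdjoint_of_lt_top p (hp.trans_lt ENNReal.one_lt_top)
    obtain ⟨s, hs1, hs2, hs3⟩ := exists_real_norm_sub_le hA hB hC hp hsa
    have k1 := norm_state_sub_scalar_sub_conj_le hψ hh hh1 hhh hsa (by positivity) hs3
    have k2 := norm_state_sub_scalar_sub_conj_le (hS hφS) hh hh1 hhh hsa (by positivity) hs3
    have k3 := h1 p.1 ((fst_le_prodL p).trans hp) s hs1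
    have k4 := h2 p.2 ((snd_le_prodL p).trans hp) s hs2
    have e : ∀ χ : WeakDual ℂ (A × B), χ (h * p * h) - s * χ (h * h) =
        (resInl χ (h.1 * p.1 * h.1) - s * resInl χ (h.1 * h.1)) +
        (resInr χ (h.2 * p.2 * h.2) - s * resInr χ (h.2 * h.2)) := fun χ => by
      rw [apply_eq_resInl_add_resInr χ (h * p * h), apply_eq_resInl_add_resInr χ (h * h)]
      simp only [Prod.fst_mul, Prod.snd_mul]
      ring
    rw [e] at k1 k2
    generalize resInl ψ (h.1 * p.1 * h.1) - s * resInl ψ (h.1 * h.1) = x1 at *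
    generalize resInr ψ (h.2 * p.2 * h.2) - s * resInr ψ (h.2 * h.2) = x2 at *
    generalize resInl φ (h.1 * p.1 * h.1) - s * resInl φ (h.1 * h.1) = y1 at *
    generalize resInr φ (h.2 * p.2 * h.2) - s * resInr φ (h.2 * h.2) = y2 at *
    -- Four errors of ε/4: compressing ψ, compressing φ, and the change from φ to ψ in each factor.
    -- The scalar s cancels.
    calc ‖ψ p - φ p‖ = ‖((ψ p - s - (x1 + x2)) - (φ p - s - (y1 + y2))) + ((x1 - y1) + (x2 - y2))‖ := by
          congr 1
          ring
      _ ≤ ‖(ψ p - s - (x1 + x2)) - (φ p - s - (y1 + y2))‖ + ‖(x1 - y1) + (x2 - y2)‖ := norm_add_le _ _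
      _ ≤ (‖ψ p - s - (x1 + x2)‖ + ‖φ p - s - (y1 + y2)‖) + (‖x1 - y1‖ + ‖x2 - y2‖) :=
          add_le_add (norm_sub_le _ _) (norm_add_le _ _)
      _ ≤ ε := by linarith

end Gap

/-! ### Local states of a direct sum -/

section LocalStates

variable {A B : Type u} [NonUnitalCStarAlgebra A] [NonUnitalCStarAlgebra B]
  {M : NonUnitalStarSubalgebra ℂ A} {N : NonUnitalStarSubalgebra ℂ B}

lemma IsTopography.Loc_mono (hM : IsTopography M) {K K₁ : Set (Spectrum M)} (hK : IsCompact K)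
    (hK₁ : IsCompact K₁) (h : K ⊆ K₁) (L : A → ℝ≥0∞) : Loc L M K ⊆ Loc L M K₁ := fun a ha => by
  rw [hM.mem_Loc_iff hK] at ha
  exact (hM.mem_Loc_iff hK₁).mpr ⟨ha.1, fun u hu => ha.2.1 u (cutoffs_anti h hu), ha.2.2⟩

lemma IsTopography.exists_localState_smul (hM : IsTopography M) {K : Set (Spectrum M)}
    (hK : IsCompact K) (hne : (localStates M K).Nonempty) {φ : WeakDual ℂ A} (hφ : IsPosFun φ)
    (h : ∀ m ∈ cutoffs M K, φ m = fnorm φ) :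
    ∃ ψ ∈ localStates M K, ∀ a, φ a = (fnorm φ : ℂ) * ψ a := by
  by_cases h0 : fnorm φ = 0
  · obtain ⟨ψ, hψ⟩ := hne
    exact ⟨ψ, hψ, fun a => by rw [eq_zero_of_fnorm_eq_zero h0, h0]; simp⟩
  · have e : ∀ a, ((((fnorm φ)⁻¹ : ℝ) : ℂ) • φ) a = ((fnorm φ)⁻¹ : ℝ) * φ a := fun a => rfl
    refine ⟨_, (hM.mem_localStates_iff hK).mpr ⟨hφ.normalize_mem_states h0, fun m hm => ?_⟩,
      fun a => ?_⟩
    · rw [e, h m hm, ← Complex.ofReal_mul, inv_mul_cancel₀ h0, Complex.ofReal_one]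
    · rw [e, ← mul_assoc, ← Complex.ofReal_mul, mul_inv_cancel₀ h0]
      simp

/-- The restrictions of φ to the factors have norms with sum 1 and values at cut-off functions
bounded by these norms. As φ(m, n) = 1, both bounds are equalities, so the normalized restrictions
are local states. -/
lemma IsTopography.exists_of_mem_localStates_specSum (hM : IsTopography M) (hN : IsTopography N)
    {K : Set (Spectrum M)} {K' : Set (Spectrum N)} (hK : IsCompact K) (hK' : IsCompact K')
    (hne : (localStates M K).Nonempty) (hne' : (localStates N K').Nonempty)
    {φ : WeakDual ℂ (A × B)} (hφ : φ ∈ localStates (M.prod N) (specSum K K')) :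
    ∃ ψ ∈ localStates M K, ∃ χ ∈ localStates N K', ∃ s t : ℝ, 0 ≤ s ∧ 0 ≤ t ∧ s + t = 1 ∧
      ∀ p, φ p = s * ψ p.1 + t * χ p.2 := by
  obtain ⟨h0, h3⟩ := (hM.mem_localStates_specSum_iff hN hK hK').mp hφ
  obtain ⟨h1, h2⟩ := mem_states_iff.mp h0
  have hsum := h1.fnorm_prod
  rw [h2] at hsum
  have key : ∀ m ∈ cutoffs M K, ∀ n ∈ cutoffs N K',
      resInl φ m = fnorm (resInl φ) ∧ resInr φ n = fnorm (resInr φ) := by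
    intro m hm n hn
    have e := h3 m hm n hn
    rw [apply_eq_resInl_add_resInr] at e
    have e1 := h1.resInl.eq_re hm.1.isSelfAdjoint
    have e2 := h1.resInr.eq_re hn.1.isSelfAdjoint
    have b1 : (resInl φ m).re ≤ fnorm (resInl φ) :=
      (Complex.re_le_norm _).trans ((norm_apply_le_fnorm _ _).trans
        (mul_le_of_le_one_right (fnorm_nonneg _) hm.2.1))
    have b2 : (resInr φ n).re ≤ fnorm (resInr φ) :=
      (Complex.re_le_norm _).trans ((norm_apply_le_fnorm _ _).trans
        (mul_le_of_le_one_right (fnorm_nonneg _) hn.2.1))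
    have e' : (resInl φ m).re + (resInr φ n).re = 1 := by
      have := congrArg Complex.re e
      simpa using this
    have c1 : (resInl φ m).re = fnorm (resInl φ) := by linarith
    have c2 : (resInr φ n).re = fnorm (resInr φ) := by linarith
    exact ⟨by rw [e1, c1], by rw [e2, c2]⟩
  obtain ⟨m₀, hm₀⟩ := hM.cutoffs_nonempty hK
  obtain ⟨n₀, hn₀⟩ := hN.cutoffs_nonempty hK'
  obtain ⟨ψ, hψ, e1⟩ := hM.exists_localState_smul hK hne h1.resInl
    fun m hm => (key m hm n₀ hn₀).1
  obtain ⟨χ, hχ, e2⟩ := hN.exists_localState_smul hK' hne' h1.resInr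
    fun n hn => (key m₀ hm₀ n hn).2
  refine ⟨ψ, hψ, χ, hχ, _, _, fnorm_nonneg _, fnorm_nonneg _, hsum.symm, fun p => ?_⟩
  rw [apply_eq_resInl_add_resInr, e1, e2]

/-- A convex combination of two numbers at distance at most `c` is at distance at most `c` from
both of them. -/
lemma norm_convexCombo_sub_le {x y : ℂ} {s t c : ℝ} (hs : 0 ≤ s) (ht : 0 ≤ t) (hst : s + t = 1)
    (h : ‖x - y‖ ≤ c) : ‖s * x + t * y - x‖ ≤ c ∧ ‖s * x + t * y - y‖ ≤ c := by
  have hst' : (s : ℂ) + t = 1 := by exact_mod_cast hst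
  have e1 : s * x + t * y - x = (t : ℂ) * (y - x) := by linear_combination x * hst'
  have e2 : s * x + t * y - y = (s : ℂ) * (x - y) := by linear_combination y * hst'
  rw [e1, e2, norm_mul, norm_mul, Complex.norm_real, Complex.norm_real, Real.norm_of_nonneg hs,
    Real.norm_of_nonneg ht, norm_sub_rev y x]
  have := norm_nonneg (x - y)
  constructor <;> nlinarith

end LocalStates

/-! ### The direct sum as a tunnel -/

section Passage

variable (𝔸 𝔹 : PointedProperQMS.{u})

lemma PointedProperQMS.states_nonempty : (states 𝔸.Carrier).Nonempty := by
  obtain ⟨φ, hφ, _⟩ := 𝔸.isProper.isTopography.exists_state_extending 𝔸.μ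
  exact ⟨φ, hφ⟩

lemma PointedProperQMS.isCompact_ball (r : ℝ) : IsCompact (𝔸.ball r) :=
  𝔸.isProper.isCompact_spectrumBall 𝔸.μ r

lemma PointedProperQMS.mem_ball_self {r : ℝ} : 𝔸.μ ∈ 𝔸.ball r := by
  change mkDist _ _ _ ≤ _
  simp [mkDist]

/-- The passage given by the product of two pointed proper quantum metric spaces. -/
noncomputable def prodPassage {C : ℝ} (hC : 0 < C) : Passage 𝔸 𝔹 where
  D := 𝔸.Carrier × 𝔹.Carrier
  L := prodL 𝔸.L 𝔹.L C
  M := 𝔸.M.prod 𝔹.M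
  isQuantumLCMS := 𝔸.isProper.toIsQuantumLCMS.prod 𝔹.isProper.toIsQuantumLCMS
    𝔸.states_nonempty 𝔹.states_nonempty hC
  isLSC := 𝔸.isProper.isLSC.prod 𝔹.isProper.isLSC hC
  π := NonUnitalStarAlgHom.fst ℂ 𝔸.Carrier 𝔹.Carrier
  ρ := NonUnitalStarAlgHom.snd ℂ 𝔸.Carrier 𝔹.Carrier
  topographic_π := 𝔸.isProper.isTopography.isTopographicMorphism_fst 𝔹.isProper.isTopography
  topographic_ρ := 𝔸.isProper.isTopography.isTopographicMorphism_snd 𝔹.isProper.isTopography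

variable {𝔸 𝔹} {C : ℝ}

/-- A criterion for admissibility in the product passage: each local Lipschitz element of one
space has a counterpart in the topography of the other space. -/
lemma isAdmissiblePair_prodPassage (hC : 0 < C) {t : ℝ} {K : Set (Spectrum 𝔸.M)}
    {K' : Set (Spectrum 𝔹.M)} (hK : IsCompact K) (hK' : IsCompact K')
    (hKl : 𝔸.ball t ⊆ K) (hKr : K ⊆ 𝔸.ball (t + 4 * C))
    (hKl' : 𝔹.ball t ⊆ K') (hKr' : K' ⊆ 𝔹.ball (t + 4 * C))
    (hlift : ∀ a ∈ 𝔸.LocBall t, ∃ b ∈ Loc 𝔹.L 𝔹.M K', b ∈ 𝔹.M ∧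
      gap a b ≤ ENNReal.ofReal C * 𝔸.L a ∧ 𝔹.L b ≤ 𝔸.L a)
    (hlift' : ∀ b ∈ 𝔹.LocBall t, ∃ a ∈ Loc 𝔸.L 𝔸.M K, a ∈ 𝔸.M ∧
      gap a b ≤ ENNReal.ofReal C * 𝔹.L b ∧ 𝔸.L a ≤ 𝔹.L b) :
    (prodPassage 𝔸 𝔹 hC).IsAdmissiblePair t C (specSum K K') := by
  have hM := 𝔸.isProper.isTopography
  have hN := 𝔹.isProper.isTopography
  have hne : (localStates 𝔸.M K).Nonempty :=
    (hM.exists_localState_extending hK (hKl 𝔸.mem_ball_self)).imp fun _ h => h.1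
  have hne' : (localStates 𝔹.M K').Nonempty :=
    (hN.exists_localState_extending hK' (hKl' 𝔹.mem_ball_self)).imp fun _ h => h.1
  have hLoc : Loc 𝔸.L 𝔸.M K ⊆ 𝔸.LocBall (t + 4 * C) :=
    hM.Loc_mono hK (𝔸.isCompact_ball _) hKr 𝔸.L
  have hLoc' : Loc 𝔹.L 𝔹.M K' ⊆ 𝔹.LocBall (t + 4 * C) :=
    hN.Loc_mono hK' (𝔹.isCompact_ball _) hKr' 𝔹.L
  have hpair : ∀ {a b}, a ∈ Loc 𝔸.L 𝔸.M K → b ∈ Loc 𝔹.L 𝔹.M K' →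
      (a, b) ∈ Loc (prodL 𝔸.L 𝔹.L C) (𝔸.M.prod 𝔹.M) (specSum K K') := by
    intro a b ha hb
    rw [hM.mem_Loc_iff hK] at ha
    rw [hN.mem_Loc_iff hK'] at hb
    exact (hM.mem_Loc_specSum_iff hN hK hK').mpr ⟨⟨ha.1, hb.1⟩, ⟨ha.2.1, hb.2.1⟩,
      (prodL_lt_top_iff hC).mpr ⟨ha.2.2, hb.2.2⟩⟩
  have htarget : ∀ a ∈ 𝔸.LocBall t, ∃ d ∈ (prodPassage 𝔸 𝔹 hC).liftSet a (𝔸.L a) t C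
      (specSum K K'), d.2 ∈ 𝔹.M := by
    intro a ha
    obtain ⟨b, hb, hbN, hg, hL⟩ := hlift a ha
    have ha' := hM.Loc_mono (𝔸.isCompact_ball _) hK hKl 𝔸.L ha
    exact ⟨(a, b), ⟨hpair ha' hb, rfl, hLoc' hb, (prodL_le_iff hC).mpr ⟨⟨le_rfl, hL⟩, hg⟩⟩, hbN⟩
  have htarget' : ∀ b ∈ 𝔹.LocBall t, ∃ d ∈ (prodPassage 𝔸 𝔹 hC).inv.liftSet b (𝔹.L b) t C
      (specSum K K'), d.1 ∈ 𝔸.M := by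
    intro b hb
    obtain ⟨a, ha, haM, hg, hL⟩ := hlift' b hb
    have hb' := hN.Loc_mono (𝔹.isCompact_ball _) hK' hKl' 𝔹.L hb
    exact ⟨(a, b), ⟨hpair ha hb', rfl, hLoc ha, (prodL_le_iff hC).mpr ⟨⟨hL, le_rfl⟩, hg⟩⟩, haM⟩
  have hsa : ∀ d ∈ Loc (prodL 𝔸.L 𝔹.L C) (𝔸.M.prod 𝔹.M) (specSum K K'), IsSelfAdjoint d :=
    fun d hd => hd.1
  refine ⟨⟨fun ψ hψ => ?_, fun φ hφ => ?_, fun a ha => ?_, fun a ha _ => ?_,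
    fun d _ => snd_le_prodL d⟩, ⟨fun ψ hψ => ?_, fun φ hφ => ?_, fun b hb => ?_, fun b hb _ => ?_,
    fun d _ => fst_le_prodL d⟩, ?_, fun d hd d' hd' => ?_, fun d hd d' hd' => ?_⟩
  · rw [PointedProperQMS.ballStates, hM.mem_localStates_iff (𝔸.isCompact_ball t)] at hψ
    exact ⟨extFst 𝔹.Carrier ψ, (hM.mem_localStates_specSum_iff hN hK hK').mpr
      ⟨extFst_mem_states hψ.1, fun m hm n _ => hψ.2 m (cutoffs_anti hKl hm)⟩, fun d => rfl⟩
  -- The component ψ of the convex combination is the required state: on the unit ball ψ and χ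
  -- differ by at most C, so the combination differs from ψ by at most C.
  · obtain ⟨ψ, hψ, χ, hχ, s, s', hs, hs', hss, e⟩ :=
      hM.exists_of_mem_localStates_specSum hN hK hK' hne hne' hφ
    refine ⟨ψ, localStates_mono_of_isCompact hM hK (𝔸.isCompact_ball _) hKr hψ,
      (mkDist_le_iff hC.le).mpr fun d hd => ?_⟩
    have := (norm_convexCombo_sub_le hs hs' hss (norm_sub_le_of_prodL_le_one hC hd hψ.1 hχ.1)).1
    rw [← e d] at this
    exact this
  · obtain ⟨d, hd, _⟩ := htarget a ha
    exact ⟨_, d, hd, rfl⟩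
  · obtain ⟨d, hd, h⟩ := htarget a ha
    exact ⟨_, ⟨d, hd, rfl⟩, h⟩
  · rw [PointedProperQMS.ballStates, hN.mem_localStates_iff (𝔹.isCompact_ball t)] at hψ
    exact ⟨extSnd 𝔸.Carrier ψ, (hM.mem_localStates_specSum_iff hN hK hK').mpr
      ⟨extSnd_mem_states hψ.1, fun m _ n hn => hψ.2 n (cutoffs_anti hKl' hn)⟩, fun d => rfl⟩
  · obtain ⟨ψ, hψ, χ, hχ, s, s', hs, hs', hss, e⟩ :=
      hM.exists_of_mem_localStates_specSum hN hK hK' hne hne' hφ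
    refine ⟨χ, localStates_mono_of_isCompact hN hK' (𝔹.isCompact_ball _) hKr' hχ,
      (mkDist_le_iff hC.le).mpr fun d hd => ?_⟩
    have := (norm_convexCombo_sub_le hs hs' hss (norm_sub_le_of_prodL_le_one hC hd hψ.1 hχ.1)).2
    rw [← e d] at this
    exact this
  · obtain ⟨d, hd, _⟩ := htarget' b hb
    exact ⟨_, d, hd, rfl⟩
  · obtain ⟨d, hd, h⟩ := htarget' b hb
    exact ⟨_, ⟨d, hd, rfl⟩, h⟩
  · obtain ⟨φ, hφ, e⟩ := hM.exists_state_extending 𝔸.μ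
    obtain ⟨ψ, hψ, e'⟩ := hN.exists_state_extending 𝔹.μ
    refine (mkDist_le_iff hC.le).mpr fun m hm => ?_
    have := norm_sub_le_of_prodL_le_one hC hm hφ hψ
    rwa [e ⟨_, m.2.1⟩, e' ⟨_, m.2.2⟩] at this
  · exact prodL_jordan_le hC 𝔸.isProper.leibniz_jordan 𝔹.isProper.leibniz_jordan (hsa d hd)
      (hsa d' hd')
  · exact prodL_lie_le hC 𝔸.isProper.leibniz_lie 𝔹.isProper.leibniz_lie (hsa d hd) (hsa d' hd')

lemma zero_mem_Loc {A : Type u} [NonUnitalCStarAlgebra A] {L : A → ℝ≥0∞}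
    {M : NonUnitalStarSubalgebra ℂ A} (hL : IsLipschitzPair L) (hM : IsTopography M)
    {K : Set (Spectrum M)} (hK : IsCompact K) : (0 : A) ∈ Loc L M K :=
  (hM.mem_Loc_iff hK).mpr ⟨IsSelfAdjoint.zero A, fun u _ => mul_zero u, by
    rw [hL.apply_zero]; exact ENNReal.zero_lt_top⟩

/-- If the spectrum of the topography is compact, then it contains a unit, and the
Monge-Kantorovich metric has finite diameter. -/
lemma IsQuantumLCMS.exists_unit_of_compactSpace {A : Type u} [NonUnitalCStarAlgebra A]
    {L : A → ℝ≥0∞} {M : NonUnitalStarSubalgebra ℂ A} (hQ : IsQuantumLCMS L M)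
    (hc : CompactSpace (Spectrum M)) : ∃ e ∈ M, IsSelfAdjoint e ∧ (∀ b, e * b = b ∧ b * e = b) ∧
      (∀ u ∈ cutoffs M univ, u = e) ∧ (∀ φ ∈ states A, φ e = 1) ∧ ∃ C : ℝ, 0 < C ∧
        ∀ φ ∈ states A, ∀ ψ ∈ states A, ∀ a, L a ≤ 1 → ‖φ a - ψ a‖ ≤ C := by
  have hM := hQ.isTopography
  obtain ⟨C, hC, h⟩ := hQ.exists_mkDist_le isCompact_univ
  obtain ⟨e, hcut⟩ := hM.cutoffs_nonempty isCompact_univ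
  obtain ⟨l, hl, hlM⟩ := hM.approx
  have := hl.neBot
  obtain ⟨heM, -, he1⟩ := hM.mem_cutoffs_iff.mp hcut
  -- A cut-off function of the whole spectrum is a unit of `M`, hence of `A`, because `M` contains
  -- an approximate unit of `A`.
  have hem : ∀ m ∈ M, e * m = m := fun m hm =>
    hM.cutoff_mul_of_support hcut hm fun x hx => (hx (mem_univ x)).elim
  have hunit : ∀ b, e * b = b := fun b =>
    tendsto_nhds_unique ((hl.tendsto_mul_right b).const_mul e)
      ((hl.tendsto_mul_right b).congr' (by
        filter_upwards [hlM] with u hu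
        rw [← mul_assoc, hem u hu]))
  have hunit' : ∀ b, b * e = b := fun b =>
    tendsto_nhds_unique ((hl.tendsto_mul_left b).mul_const e)
      ((hl.tendsto_mul_left b).congr' (by
        filter_upwards [hlM] with u hu
        rw [mul_assoc, hM.comm u hu e heM, hem u hu]))
  have hune : ∀ u ∈ cutoffs M univ, u = e := fun u hu => by
    obtain ⟨huM, -, hu1⟩ := hM.mem_cutoffs_iff.mp hu
    exact hM.ext_char huM heM fun x => (hu1 x (mem_univ x)).trans (he1 x (mem_univ x)).symm
  have hstate : ∀ φ ∈ states A, φ e = 1 := fun φ hφ => by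
    rw [mem_states_iff] at hφ
    obtain ⟨l', hl', hu'⟩ := exists_approx_unit A
    have := hl'.neBot
    have h5 := hφ.1.tendsto_mul_self hl' (hu'.mono fun u h => ⟨h.1.isSelfAdjoint, h.2⟩)
    have hl1 : Tendsto (fun u => u) l' (𝓝 e) := (hl'.tendsto_mul_left e).congr fun u => hunit u
    have h6 := ((map_continuous φ).tendsto _).comp (hl1.mul hl1)
    rw [hunit e] at h6
    rw [hφ.2] at h5
    simpa using tendsto_nhds_unique h6 h5
  have hloc : ∀ φ ∈ states A, φ ∈ localStates M univ := fun φ hφ =>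
    (hM.mem_localStates_iff isCompact_univ).mpr ⟨hφ, fun m hm => by rw [hune m hm, hstate φ hφ]⟩
  exact ⟨e, heM, hcut.1.isSelfAdjoint, fun b => ⟨hunit b, hunit' b⟩, hune, hstate, C, hC,
    fun φ hφ ψ hψ => h φ (hloc φ hφ) ψ (hloc ψ hψ)⟩

/-- Rescaling to L ≤ 1 divides by a strictly positive bound c for L; letting c decrease to L also
covers L = 0. -/
lemma le_ofReal_mul_of_forall {g l : ℝ≥0∞} {C : ℝ} (hl : l < ⊤) (hC : 0 ≤ C)
    (h : ∀ c : ℝ, 0 < c → l ≤ ENNReal.ofReal c → g ≤ ENNReal.ofReal (C * c)) :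
    g ≤ ENNReal.ofReal C * l := by
  have h1 : Tendsto (fun c : ℝ => ENNReal.ofReal (C * c)) (𝓝[>] l.toReal)
      (𝓝 (ENNReal.ofReal (C * l.toReal))) :=
    ((ENNReal.continuous_ofReal.comp (continuous_const.mul continuous_id)).tendsto _).mono_left
      nhdsWithin_le_nhds
  rw [ENNReal.ofReal_mul hC, ENNReal.ofReal_toReal hl.ne] at h1
  refine ge_of_tendsto h1 (eventually_mem_nhdsWithin.mono fun c hc => ?_)
  exact h c (ENNReal.toReal_nonneg.trans_lt hc) (ENNReal.le_ofReal_iff_toReal_le hl.ne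
    (ENNReal.toReal_nonneg.trans hc.le) |>.mpr hc.le)

/-- The counterpart, in the scalars of a unital topography, of a Lipschitz element. -/
lemma exists_scalar_lift {A B : Type u} [NonUnitalCStarAlgebra A] [NonUnitalCStarAlgebra B]
    {L : A → ℝ≥0∞} {L' : B → ℝ≥0∞} {N : NonUnitalStarSubalgebra ℂ B} (hL : IsLipschitzPair L)
    (hL' : IsLipschitzPair L') (hN : IsTopography N) (hA : (states A).Nonempty) (hC : 0 < C)
    (hdiam : ∀ φ ∈ states A, ∀ ψ ∈ states A, ∀ a, L a ≤ 1 → ‖φ a - ψ a‖ ≤ C)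
    [CompactSpace (Spectrum N)] {e : B} (he : e ∈ N) (hsa : IsSelfAdjoint e)
    (hunit : ∀ b, e * b = b ∧ b * e = b) (hcut : ∀ u ∈ cutoffs N univ, u = e)
    (hstate : ∀ φ ∈ states B, φ e = 1) {a : A} (ha : L a < ⊤) :
    ∃ b ∈ Loc L' N univ, b ∈ N ∧ gap a b ≤ ENNReal.ofReal C * L a ∧ L' b ≤ L a := by
  obtain ⟨φ, hφ⟩ := hA
  -- The counterpart s·e has Lipschitz seminorm 0. Since every state of `B` is 1 at e, its gap to a
  -- is the oscillation of a around φ(a), bounded by the Monge-Kantorovich diameter.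
  set s := (φ a).re with hs
  have e1 : φ a = (s : ℂ) := (mem_states_iff.mp hφ).1.eq_re (hL.isSelfAdjoint_of_lt_top a ha)
  have h0 : L' ((s : ℂ) • e) = 0 := (hL'.eq_zero_iff _).mpr (Or.inr ⟨e, s, hunit, rfl⟩)
  refine ⟨(s : ℂ) • e, (hN.mem_Loc_iff isCompact_univ).mpr ⟨?_, fun u hu => ?_, ?_⟩,
    SMulMemClass.smul_mem _ he, le_ofReal_mul_of_forall ha hC.le fun c hc hac => ?_, h0 ▸ zero_le⟩
  · rw [IsSelfAdjoint, star_smul, hsa.star_eq, Complex.star_def, Complex.conj_ofReal]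
  · rw [hcut u hu, (hunit _).1]
  · rw [h0]
    exact ENNReal.zero_lt_top
  · refine (gap_le_iff (by positivity)).mpr fun χ hχ ψ hψ => ?_
    rw [map_smul, hstate ψ hψ, smul_eq_mul, mul_one, ← e1]
    exact hL.norm_sub_le (hdiam χ hχ φ hφ) hc hac

/-- If both spectra are compact, then there is a tunnel. -/
lemma exists_isTunnel_of_compactSpace (hA : CompactSpace (Spectrum 𝔸.M))
    (hB : CompactSpace (Spectrum 𝔹.M)) (r : ℝ) : ∃ τ : Passage 𝔸 𝔹, τ.IsTunnel r := by
  obtain ⟨e, heM, hsa, hunit, hcut, hstate, C₁, hC₁, hd⟩ :=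
    𝔸.isProper.toIsQuantumLCMS.exists_unit_of_compactSpace hA
  obtain ⟨e', heM', hsa', hunit', hcut', hstate', C₂, hC₂, hd'⟩ :=
    𝔹.isProper.toIsQuantumLCMS.exists_unit_of_compactSpace hB
  have hC : 0 < max C₁ C₂ := lt_max_of_lt_left hC₁
  -- Balls whose radius is at least a bound for the diameter of the state space contain the whole
  -- spectrum. As t + 4C exceeds that bound, `K` may be taken to be everything, whatever t is.
  have hball : ∀ (𝔼 : PointedProperQMS.{u}) (c t : ℝ), 0 < c → c ≤ t →
      (∀ φ ∈ states 𝔼.Carrier, ∀ ψ ∈ states 𝔼.Carrier, ∀ a, 𝔼.L a ≤ 1 → ‖φ a - ψ a‖ ≤ c) →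
      univ ⊆ 𝔼.ball t := by
    intro 𝔼 c t hc hct h x _
    obtain ⟨φ, hφ, e1⟩ := 𝔼.isProper.isTopography.exists_state_extending x
    obtain ⟨ψ, hψ, e2⟩ := 𝔼.isProper.isTopography.exists_state_extending 𝔼.μ
    refine (spectrumDist_le_mkDist e1 e2).trans ((mkDist_le_iff (hc.le.trans hct)).mpr
      fun b hb => (h φ hφ ψ hψ b hb).trans hct)
  refine ⟨prodPassage 𝔸 𝔹 hC, max C₁ C₂, hC, fun _ => specSum univ univ,
    fun _ _ => isCompact_specSum isCompact_univ isCompact_univ, fun _ _ _ _ _ => subset_rfl,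
    fun t ht => isAdmissiblePair_prodPassage hC isCompact_univ isCompact_univ (subset_univ _)
      (hball 𝔸 C₁ _ hC₁ ?_ hd) (subset_univ _) (hball 𝔹 C₂ _ hC₂ ?_ hd') (fun a ha => ?_)
      (fun b hb => ?_)⟩
  · linarith [le_max_left C₁ C₂, ht.1]
  · linarith [le_max_right C₁ C₂, ht.1]
  · exact exists_scalar_lift 𝔸.isProper.isLipschitzPair 𝔹.isProper.isLipschitzPair
      𝔹.isProper.isTopography 𝔸.states_nonempty hC
      (fun φ hφ ψ hψ a ha => (hd φ hφ ψ hψ a ha).trans (le_max_left _ _)) heM' hsa' hunit' hcut'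
      hstate' ha.2.2
  · simp only [gap_comm _ b]
    exact exists_scalar_lift 𝔹.isProper.isLipschitzPair 𝔸.isProper.isLipschitzPair
      𝔸.isProper.isTopography 𝔹.states_nonempty hC
      (fun φ hφ ψ hψ a ha => (hd' φ hφ ψ hψ a ha).trans (le_max_right _ _)) heM hsa hunit hcut
      hstate hb.2.2

/-- The largest of the norms of the Lipschitz elements supported on balls which do not exhaust the
spectra, if it is positive, is admissible. -/
lemma mem_Adm_prodPassage (hC : 0 < C) {r : ℝ}
    (h : ∀ a ∈ 𝔸.LocBall r, 𝔸.L a ≤ 1 → ‖a‖ ≤ C) (h' : ∀ b ∈ 𝔹.LocBall r, 𝔹.L b ≤ 1 → ‖b‖ ≤ C) :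
    C ∈ (prodPassage 𝔸 𝔹 hC).Adm r := by
  -- The counterpart is 0: gap(a, 0) ≤ ‖a‖, and ‖a‖ ≤ C·L(a) by homogeneity. Elements supported in
  -- the ball of radius t ≤ r are also supported in that of radius r.
  have key : ∀ (𝔼 𝔽 : PointedProperQMS.{u}), (∀ a ∈ 𝔼.LocBall r, 𝔼.L a ≤ 1 → ‖a‖ ≤ C) →
      ∀ t ∈ Ioc 0 r, ∀ a ∈ 𝔼.LocBall t,
        gap a (0 : 𝔽.Carrier) ≤ ENNReal.ofReal C * 𝔼.L a := by
    intro 𝔼 𝔽 h t ht a ha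
    have hL := 𝔼.isProper.isLipschitzPair
    have hM := 𝔼.isProper.isTopography
    have ha' := (hM.mem_Loc_iff (𝔼.isCompact_ball r)).mp
      (hM.Loc_mono (𝔼.isCompact_ball t) (𝔼.isCompact_ball r) (spectrumBall_mono ht.2) 𝔼.L ha)
    refine le_ofReal_mul_of_forall ha.2.2 hC.le fun c hc hac => (gap_zero_right_le a).trans
      (ENNReal.ofReal_le_ofReal ?_)
    have h1 := hL.smul_le_one hc hac
    have h2 := h _ ((hM.mem_Loc_iff (𝔼.isCompact_ball r)).mpr
      ⟨hL.isSelfAdjoint_of_lt_top _ (h1.trans_lt ENNReal.one_lt_top),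
        fun u hu => by rw [mul_smul_comm, ha'.2.1 u hu], h1.trans_lt ENNReal.one_lt_top⟩) h1
    rwa [norm_smul, Complex.norm_real, norm_inv, Real.norm_of_nonneg hc.le,
      inv_mul_le_iff₀ hc, mul_comm] at h2
  refine ⟨hC, fun t => specSum (𝔸.ball t) (𝔹.ball t),
    fun t _ => isCompact_specSum (𝔸.isCompact_ball t) (𝔹.isCompact_ball t),
    fun t _ t' _ htt => specSum_mono (spectrumBall_mono htt) (spectrumBall_mono htt),
    fun t ht => isAdmissiblePair_prodPassage hC (𝔸.isCompact_ball t) (𝔹.isCompact_ball t)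
      subset_rfl (spectrumBall_mono (by linarith)) subset_rfl (spectrumBall_mono (by linarith))
      (fun a ha => ⟨0, ?_, zero_mem _, key 𝔸 𝔹 h t ht a ha, ?_⟩)
      (fun b hb => ⟨0, ?_, zero_mem _, ?_, ?_⟩)⟩
  · exact zero_mem_Loc 𝔹.isProper.isLipschitzPair 𝔹.isProper.isTopography (𝔹.isCompact_ball t)
  · simp [𝔹.isProper.isLipschitzPair.apply_zero]
  · exact zero_mem_Loc 𝔸.isProper.isLipschitzPair 𝔸.isProper.isTopography (𝔸.isCompact_ball t)
  · rw [gap_comm]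
    exact key 𝔹 𝔸 h' t ht b hb
  · simp [𝔸.isProper.isLipschitzPair.apply_zero]

end Passage

/-! ### A rapidly converging cosine series that vanishes near zero -/

section Fourier

open Real

/-- The Fourier coefficients of a function on the circle which is constant near zero. -/
noncomputable def bumpCoeff (n : ℕ) : ℝ :=
  -- The factor n⁻⁸ comes from the eighth Bernoulli polynomial, (2 sin(πn/16))⁸ from its eighth
  -- central difference with step 1/16, and the sign from a shift by half a period. At n = 0 the
  -- coefficient is 0, since 1/0 = 0.
  1 / (n : ℝ) ^ 8 * (2 * sin (π * n / 16)) ^ 8 * (-1) ^ n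

lemma abs_bumpCoeff_le (n : ℕ) : |bumpCoeff n| ≤ 256 * (1 / (n : ℝ) ^ 8) := by
  have h : |2 * sin (π * n / 16)| ≤ 2 := by
    rw [abs_mul, abs_two]
    linarith [abs_sin_le_one (π * n / 16)]
  have h1 : |2 * sin (π * n / 16)| ^ 8 ≤ 2 ^ 8 := pow_le_pow_left₀ (abs_nonneg _) h 8
  rw [bumpCoeff, abs_mul, abs_mul, abs_pow, abs_pow, abs_neg, abs_one, one_pow, mul_one,
    abs_of_nonneg (by positivity), mul_comm]
  gcongr
  norm_num at h1 ⊢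
  exact h1

/-- The Fourier series of the eighth Bernoulli polynomial. -/
lemma exists_hasSum_cos : ∃ c : ℕ → ℝ, ∀ u ∈ Icc (0 : ℝ) 1,
    HasSum (fun n : ℕ => 1 / (n : ℝ) ^ 8 * cos (2 * π * n * u))
      (∑ i ∈ Finset.range 9, c i * u ^ (8 - i)) := by
  refine ⟨fun i => (-1 : ℝ) ^ (4 + 1) * (2 * π) ^ (2 * 4) / 2 / (2 * 4).factorial *
    ((bernoulli i * Nat.choose 8 i : ℚ) : ℝ), fun u hu => ?_⟩
  have h := hasSum_one_div_nat_pow_mul_cos (k := 4) (by norm_num) hu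
  convert h using 1
  rw [Polynomial.bernoulli, Polynomial.map_sum, Polynomial.eval_finsetSum, Finset.mul_sum]
  refine Finset.sum_congr rfl fun i _ => ?_
  rw [Polynomial.map_monomial, Polynomial.eval_monomial, mul_assoc]
  rfl

lemma hasSum_of_eq {f g : ℕ → ℝ} {a b : ℝ} (h : HasSum f a) (hg : ∀ n, g n = f n) (hb : a = b) :
    HasSum g b := by
  rwa [funext hg, ← hb]

lemma two_mul_sin_pow_eight (a : ℝ) : (2 * sin a) ^ 8 =
    70 - 112 * cos (2 * a) + 56 * cos (4 * a) - 16 * cos (6 * a) + 2 * cos (8 * a) := by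
  have h2 : cos (2 * a) = 1 - 2 * sin a ^ 2 := by rw [cos_two_mul, cos_sq']; ring
  have h4 : cos (4 * a) = 2 * cos (2 * a) ^ 2 - 1 := by
    rw [← cos_two_mul]; ring_nf
  have h8 : cos (8 * a) = 2 * cos (4 * a) ^ 2 - 1 := by
    rw [← cos_two_mul]; ring_nf
  have h6 : cos (6 * a) = 4 * cos (2 * a) ^ 3 - 3 * cos (2 * a) := by
    rw [← cos_three_mul]; ring_nf
  rw [h8, h6, h4, h2]
  ring

lemma cos_mul_sin_pow_eight (a b : ℝ) : (2 * sin a) ^ 8 * cos b =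
    70 * cos b - 56 * (cos (b + 2 * a) + cos (b - 2 * a))
      + 28 * (cos (b + 4 * a) + cos (b - 4 * a)) - 8 * (cos (b + 6 * a) + cos (b - 6 * a))
      + (cos (b + 8 * a) + cos (b - 8 * a)) := by
  rw [two_mul_sin_pow_eight]
  simp only [cos_add, cos_sub]
  ring

/-- The eighth difference of a polynomial of degree eight is constant. The nine points u + j/16 with
|j| ≤ 4 must lie in [0, 1], where the Fourier series represents the polynomial; hence the interval
[1/4, 3/4]. -/
lemma exists_hasSum_sin_pow_mul_cos : ∃ q : ℝ, ∀ u ∈ Icc (1 / 4 : ℝ) (3 / 4),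
    HasSum (fun n : ℕ => 1 / (n : ℝ) ^ 8 * ((2 * sin (π * n / 16)) ^ 8 * cos (2 * π * n * u))) q := by
  obtain ⟨c, hc⟩ := exists_hasSum_cos
  have key : ∀ u ∈ Icc (1 / 4 : ℝ) (3 / 4), ∀ t : ℝ, |t| ≤ 1 / 4 →
      HasSum (fun n : ℕ => 1 / (n : ℝ) ^ 8 * cos (2 * π * n * (u + t)))
        (∑ i ∈ Finset.range 9, c i * (u + t) ^ (8 - i)) := fun u hu t ht =>
    hc _ ⟨by linarith [hu.1, (abs_le.mp ht).1], by linarith [hu.2, (abs_le.mp ht).2]⟩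
  have main : ∀ u ∈ Icc (1 / 4 : ℝ) (3 / 4),
      HasSum (fun n : ℕ => 1 / (n : ℝ) ^ 8 * ((2 * sin (π * n / 16)) ^ 8 * cos (2 * π * n * u)))
        -- The leading coefficient times 8! = 40320 times the eighth power of the step.
        (c 0 * 40320 * (1 / 16) ^ 8) := by
    intro u hu
    have k0 := key u hu 0 (by norm_num)
    have k1 := key u hu (1 / 16) (by norm_num [abs_le])
    have k2 := key u hu (2 / 16) (by norm_num [abs_le])
    have k3 := key u hu (3 / 16) (by norm_num [abs_le])
    have k4 := key u hu (4 / 16) (by norm_num [abs_le])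
    have l1 := key u hu (-1 / 16) (by norm_num [abs_le])
    have l2 := key u hu (-2 / 16) (by norm_num [abs_le])
    have l3 := key u hu (-3 / 16) (by norm_num [abs_le])
    have l4 := key u hu (-4 / 16) (by norm_num [abs_le])
    have := ((((k0.mul_left 70).sub ((k1.add l1).mul_left 56)).add ((k2.add l2).mul_left 28)).sub
      ((k3.add l3).mul_left 8)).add (k4.add l4)
    refine hasSum_of_eq this (fun n => ?_) ?_
    · rw [cos_mul_sin_pow_eight]
      have e : ∀ j : ℝ, cos (2 * π * n * (u + j / 16)) = cos (2 * π * n * u + 2 * j * (π * n / 16)) :=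
        fun j => by ring_nf
      have e0 : cos (2 * π * n * (u + 0)) = cos (2 * π * n * u) := by rw [add_zero]
      rw [e0, e 1, e 2, e 3, e 4, e (-1), e (-2), e (-3), e (-4)]
      ring_nf
    · simp only [Finset.sum_range_succ, Finset.sum_range_zero]
      norm_num
      ring
  exact ⟨_, main⟩

/-- A cosine series which vanishes near zero. -/
lemma hasSum_bumpCoeff_zero {y : ℝ} (hy : |y| ≤ 1 / 4) :
    HasSum (fun n => bumpCoeff n * (cos (2 * π * n * y) - 1)) 0 := by
  obtain ⟨q, hq⟩ := exists_hasSum_sin_pow_mul_cos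
  rw [abs_le] at hy
  have := (hq (1 / 2 + y) ⟨by linarith, by linarith⟩).sub (hq (1 / 2) (by norm_num))
  rw [sub_self] at this
  refine hasSum_of_eq this (fun n => ?_) rfl
  have e1 : cos (2 * π * n * (1 / 2 + y)) = (-1) ^ n * cos (2 * π * n * y) := by
    rw [← cos_add_nat_mul_pi]
    ring_nf
  have e2 : cos (2 * π * n * (1 / 2)) = (-1) ^ n := by
    rw [← cos_nat_mul_pi]
    ring_nf
  rw [e1, e2, bumpCoeff]
  ring

lemma summable_bumpCoeff_mul {f : ℕ → ℝ} {c : ℝ} (hf : ∀ n, |f n| ≤ c * n ^ 5) :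
    Summable fun n => bumpCoeff n * f n := by
  have h3 : Summable fun n : ℕ => 1 / (n : ℝ) ^ 3 := Real.summable_one_div_nat_pow.mpr (by norm_num)
  refine Summable.of_norm_bounded (h3.mul_left (256 * c)) fun n => ?_
  rw [norm_mul, Real.norm_eq_abs, Real.norm_eq_abs]
  calc |bumpCoeff n| * |f n| ≤ 256 * (1 / (n : ℝ) ^ 8) * (c * n ^ 5) :=
        mul_le_mul (abs_bumpCoeff_le n) (hf n) (abs_nonneg _) (by positivity)
    _ = 256 * c * (1 / (n : ℝ) ^ 3) := by
        rcases eq_or_ne (n : ℝ) 0 with h | h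
        · simp [h]
        · field_simp

/-- At the angle π the signs combine to (−1)ⁿ((−1)ⁿ − 1) = 1 − (−1)ⁿ ≥ 0, so no term is negative,
and the term n = 1 is positive. -/
lemma tsum_bumpCoeff_ne_zero : ∑' n, bumpCoeff n * (cos (n * π) - 1) ≠ 0 := by
  have h : Summable fun n => bumpCoeff n * (cos (n * π) - 1) := by
    refine summable_bumpCoeff_mul (c := 2) fun n => ?_
    rcases Nat.eq_zero_or_pos n with rfl | hn
    · simp
    · have : (1 : ℝ) ≤ (n : ℝ) ^ 5 := one_le_pow₀ (by exact_mod_cast hn)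
      rw [abs_le]
      constructor <;> linarith [neg_one_le_cos (n * π), cos_le_one (n * π)]
  refine (h.tsum_pos (fun n => ?_) 1 ?_).ne'
  · rw [bumpCoeff, cos_nat_mul_pi, mul_assoc]
    refine mul_nonneg (by positivity) ?_
    rcases neg_one_pow_eq_or ℝ n with e | e <;> rw [e] <;> norm_num
  · have : 0 < sin (π * (1 : ℕ) / 16) :=
      sin_pos_of_pos_of_lt_pi (by positivity) (by push_cast; linarith [pi_pos])
    rw [bumpCoeff, cos_nat_mul_pi, mul_assoc]
    refine mul_pos (by positivity) (by norm_num)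

end Fourier

/-! ### Chebyshev polynomials and smooth functional calculus for Lipschitz elements -/

section Bump

variable {A : Type u} [NonUnitalCStarAlgebra A] {L : A → ℝ≥0∞} {M : NonUnitalStarSubalgebra ℂ A}

lemma IsTopography.isSelfAdjoint_of_char (hM : IsTopography M) {m : A} (h : m ∈ M)
    (hm : ∀ x : Spectrum M, (x ⟨m, h⟩).im = 0) : IsSelfAdjoint m := by
  let _ := hM.commCStar
  exact congrArg Subtype.val (QMS.isSelfAdjoint_of_char (y := (⟨m, h⟩ : M)) hm).star_eq

lemma IsTopography.norm_le_of_char (hM : IsTopography M) {m : A} (h : m ∈ M) {c : ℝ} (hc : 0 ≤ c)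
    (hm : ∀ x : Spectrum M, ‖x ⟨m, h⟩‖ ≤ c) : ‖m‖ ≤ c := by
  let _ := hM.commCStar
  exact QMS.norm_le_of_char (y := (⟨m, h⟩ : M)) hc hm

lemma IsTopography.norm_apply_le (hM : IsTopography M) {m : A} (h : m ∈ M) (x : Spectrum M) :
    ‖x ⟨m, h⟩‖ ≤ ‖m‖ := by
  let _ := hM.commCStar
  exact norm_char_le x (⟨m, h⟩ : M)

lemma IsTopography.apply_eq_re (hM : IsTopography M) {m : A} (h : m ∈ M) (hm : IsSelfAdjoint m)
    (x : Spectrum M) : x ⟨m, h⟩ = ((x ⟨m, h⟩).re : ℂ) := by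
  let _ := hM.commCStar
  exact char_eq_re (a := (⟨m, h⟩ : M)) (Subtype.ext hm.star_eq) x

/-- The Chebyshev polynomials of an element of the topography, up to constants. -/
lemma IsTopography.exists_cos (hM : IsTopography M) {w : A} (h : w ∈ M) (hw : IsSelfAdjoint w) :
    ∃ c : ℕ → A, ∀ n, ∃ hn : c n ∈ M, ∀ x : Spectrum M, x ⟨c n, hn⟩ =
      ((Real.cos (n * Real.arccos (1 - 2 * (x ⟨w, h⟩).re)) - 1 : ℝ) : ℂ) := by
  let _ := hM.commCStar
  have hsa : IsSelfAdjoint (⟨w, h⟩ : M) := Subtype.ext hw.star_eq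
  -- Subtracting 1 makes the function vanish at t = 0, where the angle arccos(1 − 2t) is 0, as the
  -- non-unital calculus requires. On [0, 1] the angle runs from 0 to π.
  refine ⟨fun n => (cfcₙ (fun t : ℝ => Real.cos (n * Real.arccos (1 - 2 * t)) - 1) (⟨w, h⟩ : M) : M),
    fun n => ⟨Subtype.property _, fun x => ?_⟩⟩
  refine char_cfc hsa (fun t : ℝ => Real.cos (n * Real.arccos (1 - 2 * t)) - 1) ?_ (by simp) x
  have := Real.continuous_arccos
  fun_prop

lemma IsLipschitzPair.add_le_ofReal (hL : IsLipschitzPair L) {a b : A} {α β : ℝ} (hα : 0 ≤ α)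
    (hβ : 0 ≤ β) (ha : L a ≤ ENNReal.ofReal α) (hb : L b ≤ ENNReal.ofReal β) :
    L (a + b) ≤ ENNReal.ofReal (α + β) := by
  rw [ENNReal.ofReal_add hα hβ]
  exact (hL.add_le a b).trans (add_le_add ha hb)

lemma IsLipschitzPair.smul_le_ofReal (hL : IsLipschitzPair L) {a : A} {α : ℝ} (t : ℝ)
    (ha : L a ≤ ENNReal.ofReal α) : L ((t : ℂ) • a) ≤ ENNReal.ofReal (|t| * α) := by
  rw [hL.smul_eq, ENNReal.ofReal_mul (abs_nonneg t)]
  exact mul_le_mul' le_rfl ha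

lemma IsLipschitzPair.sum_le_ofReal (hL : IsLipschitzPair L) {ι : Type*} (s : Finset ι) {f : ι → A}
    {α : ι → ℝ} (hα : ∀ i, 0 ≤ α i) (hf : ∀ i, L (f i) ≤ ENNReal.ofReal (α i)) :
    L (∑ i ∈ s, f i) ≤ ENNReal.ofReal (∑ i ∈ s, α i) := by
  classical
  induction s using Finset.induction_on with
  | empty => simp [hL.apply_zero]
  | insert i s hi ih =>
    rw [Finset.sum_insert hi, Finset.sum_insert hi]
    exact hL.add_le_ofReal (hα i) (Finset.sum_nonneg fun i _ => hα i) (hf i) ih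

lemma IsProperQMS.mul_le_ofReal (hP : IsProperQMS L M) {a b : A} (hab : a * b = b * a)
    (ha : IsSelfAdjoint a) (hb : IsSelfAdjoint b) {α β γ : ℝ} (hα : 0 ≤ α) (hβ : 0 ≤ β)
    (hγ : 0 ≤ γ) (hLa : L a ≤ ENNReal.ofReal α) (hLb : L b ≤ ENNReal.ofReal β) (hna : ‖a‖ ≤ γ)
    (hnb : ‖b‖ ≤ γ) : L (a * b) ≤ ENNReal.ofReal (γ * (α + β)) := by
  have e : jordan a b = a * b := by
    rw [jordan, ← hab, ← two_smul ℂ (a * b), smul_smul]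
    norm_num
  have h := hP.leibniz_jordan a b ha hb
  rw [e] at h
  refine h.trans ?_
  rw [mul_add, add_comm, ENNReal.ofReal_add (by positivity) (by positivity),
    ENNReal.ofReal_mul hγ, ENNReal.ofReal_mul hγ, mul_comm (ENNReal.ofReal γ) (ENNReal.ofReal α),
    ← ofReal_norm, ← ofReal_norm]
  gcongr

/-- The Lipschitz constants of the Chebyshev polynomials grow at most polynomially. -/
lemma IsProperQMS.cos_le (hP : IsProperQMS L M) {c : ℕ → A} (hc : ∀ n, c n ∈ M)
    {θ : Spectrum M → ℝ} (h : ∀ n (x : Spectrum M), x ⟨c n, hc n⟩ =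
      ((Real.cos (n * θ x) - 1 : ℝ) : ℂ)) {l : ℝ} (hl : 0 ≤ l) (h1 : L (c 1) ≤ ENNReal.ofReal l)
    (n : ℕ) : L (c n) ≤ ENNReal.ofReal ((n : ℝ) ^ 5 * l) := by
  have hM := hP.isTopography
  have hL := hP.isLipschitzPair
  have hsa : ∀ n, IsSelfAdjoint (c n) := fun n => hM.isSelfAdjoint_of_char (hc n) fun x => by
    rw [h]; exact Complex.ofReal_im _
  have hnorm : ∀ n, ‖c n‖ ≤ 2 := fun n => hM.norm_le_of_char (hc n) zero_le_two fun x => by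
    rw [h, Complex.norm_real, Real.norm_eq_abs, abs_le]
    constructor <;> linarith [Real.neg_one_le_cos (n * θ x), Real.cos_le_one (n * θ x)]
  have hmul : ∀ m n : ℕ, L (c m) ≤ ENNReal.ofReal ((m : ℝ) ^ 5 * l) →
      L (c n) ≤ ENNReal.ofReal ((n : ℝ) ^ 5 * l) →
      L (c m * c n) ≤ ENNReal.ofReal (2 * ((m : ℝ) ^ 5 * l + (n : ℝ) ^ 5 * l)) := fun m n hm hn =>
    hP.mul_le_ofReal (hM.comm _ (hc m) _ (hc n)) (hsa m) (hsa n) (by positivity) (by positivity)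
      zero_le_two hm hn (hnorm m) (hnorm n)
  -- Halving the index keeps the recursion logarithmic. The Leibniz inequality costs a constant
  -- factor at each product, so the three-term recursion would only give an exponential bound.
  induction n using Nat.strong_induction_on with
  | _ n ih =>
    obtain ⟨m, rfl | rfl⟩ := Nat.even_or_odd' n
    · rcases Nat.eq_zero_or_pos m with rfl | hm
      · have : c (2 * 0) = 0 := hM.ext_char (hc _) (zero_mem M) fun x => by
          rw [h]
          have : x ⟨0, zero_mem M⟩ = 0 := map_zero x
          simp [this]
        rw [this, hL.apply_zero]
        exact zero_le
      · have e : c (2 * m) = ((2 : ℝ) : ℂ) • (c m * c m) + ((4 : ℝ) : ℂ) • c m := by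
          have hmm : c m * c m ∈ M := mul_mem (hc m) (hc m)
          have h2 : ((2 : ℝ) : ℂ) • (c m * c m) ∈ M := SMulMemClass.smul_mem _ hmm
          have h4 : ((4 : ℝ) : ℂ) • c m ∈ M := SMulMemClass.smul_mem _ (hc m)
          refine hM.ext_char (hc _) (add_mem h2 h4) fun x => ?_
          have e1 : x ⟨_, add_mem h2 h4⟩ = x ⟨_, h2⟩ + x ⟨_, h4⟩ := map_add x (⟨_, h2⟩ : M) ⟨_, h4⟩
          have e2 : x ⟨_, h2⟩ = ((2 : ℝ) : ℂ) * x ⟨_, hmm⟩ := map_smul x _ (⟨_, hmm⟩ : M)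
          have e3 : x ⟨_, h4⟩ = ((4 : ℝ) : ℂ) * x ⟨_, hc m⟩ := map_smul x _ (⟨_, hc m⟩ : M)
          rw [e1, e2, e3, map_mk_mul x (hc m) (hc m) hmm, h, h]
          norm_cast
          push_cast
          rw [mul_assoc, Real.cos_two_mul]
          ring
        have hm' := ih m (by omega)
        rw [e]
        refine (hL.add_le_ofReal (by positivity) (by positivity)
          (hL.smul_le_ofReal 2 (hmul m m hm' hm')) (hL.smul_le_ofReal 4 hm')).trans
          (ENNReal.ofReal_le_ofReal ?_)
        rw [abs_of_pos two_pos, abs_of_pos four_pos]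
        push_cast
        have : 0 ≤ (m : ℝ) ^ 5 * l := by positivity
        nlinarith
    · rcases Nat.eq_zero_or_pos m with rfl | hm
      · simpa using h1
      · have e : c (2 * m + 1) = (((2 : ℝ) : ℂ) • (c m * c (m + 1)) + (((2 : ℝ) : ℂ) • c m +
            ((2 : ℝ) : ℂ) • c (m + 1))) + ((-1 : ℝ) : ℂ) • c 1 := by
          have hmm : c m * c (m + 1) ∈ M := mul_mem (hc m) (hc (m + 1))
          have h2 : ((2 : ℝ) : ℂ) • (c m * c (m + 1)) ∈ M := SMulMemClass.smul_mem _ hmm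
          have h3 : ((2 : ℝ) : ℂ) • c m ∈ M := SMulMemClass.smul_mem _ (hc m)
          have h4 : ((2 : ℝ) : ℂ) • c (m + 1) ∈ M := SMulMemClass.smul_mem _ (hc _)
          have h5 : ((-1 : ℝ) : ℂ) • c 1 ∈ M := SMulMemClass.smul_mem _ (hc _)
          have h6 := add_mem h3 h4
          have h7 := add_mem h2 h6
          refine hM.ext_char (hc _) (add_mem h7 h5) fun x => ?_
          have e1 : x ⟨_, add_mem h7 h5⟩ = x ⟨_, h7⟩ + x ⟨_, h5⟩ := map_add x (⟨_, h7⟩ : M) ⟨_, h5⟩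
          have e2 : x ⟨_, h7⟩ = x ⟨_, h2⟩ + x ⟨_, h6⟩ := map_add x (⟨_, h2⟩ : M) ⟨_, h6⟩
          have e3 : x ⟨_, h6⟩ = x ⟨_, h3⟩ + x ⟨_, h4⟩ := map_add x (⟨_, h3⟩ : M) ⟨_, h4⟩
          have e4 : x ⟨_, h2⟩ = ((2 : ℝ) : ℂ) * x ⟨_, hmm⟩ := map_smul x _ (⟨_, hmm⟩ : M)
          have e5 : x ⟨_, h3⟩ = ((2 : ℝ) : ℂ) * x ⟨_, hc m⟩ := map_smul x _ (⟨_, hc m⟩ : M)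
          have e6 : x ⟨_, h4⟩ = ((2 : ℝ) : ℂ) * x ⟨_, hc (m + 1)⟩ := map_smul x _ (⟨_, hc (m + 1)⟩ : M)
          have e7 : x ⟨_, h5⟩ = ((-1 : ℝ) : ℂ) * x ⟨_, hc 1⟩ := map_smul x _ (⟨_, hc 1⟩ : M)
          rw [e1, e2, e3, e4, e5, e6, e7, map_mk_mul x (hc m) (hc (m + 1)) hmm, h, h, h, h]
          norm_cast
          push_cast
          have t1 : (2 * (m : ℝ) + 1) * θ x = m * θ x + (m + 1) * θ x := by ring
          have t2 : 1 * θ x = (m + 1) * θ x - m * θ x := by ring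
          rw [t1, t2, Real.cos_add, Real.cos_sub]
          ring
        have hm' := ih m (by omega)
        have hm1 := ih (m + 1) (by omega)
        rw [e]
        refine (hL.add_le_ofReal (by positivity) (by positivity) (hL.add_le_ofReal (by positivity)
          (by positivity) (hL.smul_le_ofReal 2 (hmul m (m + 1) hm' hm1))
          (hL.add_le_ofReal (by positivity) (by positivity) (hL.smul_le_ofReal 2 hm')
          (hL.smul_le_ofReal 2 hm1))) (hL.smul_le_ofReal (-1) h1)).trans
          (ENNReal.ofReal_le_ofReal ?_)
        rw [abs_of_pos two_pos, abs_neg, abs_one]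
        push_cast
        have hm1 : (1 : ℝ) ≤ m := by exact_mod_cast hm
        -- The exponent 5 is large enough already at m = 1, where 199 ≤ 243; the exponent 4 would
        -- require 103 ≤ 81.
        have key : 6 * ((m : ℝ) ^ 5 + ((m : ℝ) + 1) ^ 5) + 1 ≤ (2 * (m : ℝ) + 1) ^ 5 := by
          obtain ⟨k, hk⟩ : ∃ k : ℝ, (m : ℝ) = k + 1 := ⟨m - 1, by ring⟩
          have hk0 : 0 ≤ k := by linarith
          rw [hk, ← sub_nonneg]
          ring_nf
          positivity
        have := mul_le_mul_of_nonneg_right key hl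
        linarith

/-- An element of the topography with values in `[0, 1]` gives a Lipschitz element which vanishes
where the values are at most one half, and which does not vanish where the value is one. -/
lemma IsProperQMS.exists_bump (hP : IsProperQMS L M) {w : A} (hw : w ∈ M)
    (hw01 : ∀ x : Spectrum M, 0 ≤ x ⟨w, hw⟩ ∧ x ⟨w, hw⟩ ≤ 1) (hLw : L w < ⊤) :
    ∃ g : A, ∃ hg : g ∈ M, IsSelfAdjoint g ∧ L g < ⊤ ∧
      (∀ x : Spectrum M, (x ⟨w, hw⟩).re ≤ 1 / 2 → x ⟨g, hg⟩ = 0) ∧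
      ∀ x : Spectrum M, x ⟨w, hw⟩ = 1 → x ⟨g, hg⟩ ≠ 0 := by
  have hM := hP.isTopography
  have hL := hP.isLipschitzPair
  have hwsa : IsSelfAdjoint w := hL.isSelfAdjoint_of_lt_top w hLw
  obtain ⟨c, hc'⟩ := hM.exists_cos hw hwsa
  choose hc h using hc'
  set θ : Spectrum M → ℝ := fun x => Real.arccos (1 - 2 * (x ⟨w, hw⟩).re) with hθ
  have hre : ∀ x : Spectrum M, 0 ≤ (x ⟨w, hw⟩).re ∧ (x ⟨w, hw⟩).re ≤ 1 := fun x =>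
    ⟨(Complex.le_def.mp (hw01 x).1).1, (Complex.le_def.mp (hw01 x).2).1⟩
  have e1 : c 1 = ((-2 : ℝ) : ℂ) • w := by
    have h2 : ((-2 : ℝ) : ℂ) • w ∈ M := SMulMemClass.smul_mem _ hw
    refine hM.ext_char (hc 1) h2 fun x => ?_
    have e2 : x ⟨_, h2⟩ = ((-2 : ℝ) : ℂ) * x ⟨w, hw⟩ := map_smul x _ (⟨_, hw⟩ : M)
    rw [h, e2, Nat.cast_one, one_mul,
      Real.cos_arccos (by linarith [(hre x).2]) (by linarith [(hre x).1])]
    conv_rhs => rw [hM.apply_eq_re hw hwsa x, ← Complex.ofReal_mul]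
    congr 1
    ring
  have hc1 : L (c 1) < ⊤ := by
    rw [e1, hL.smul_eq]
    exact ENNReal.mul_lt_top ENNReal.ofReal_lt_top hLw
  have hlip := hP.cos_le hc h (l := (L (c 1)).toReal) ENNReal.toReal_nonneg
    (ENNReal.ofReal_toReal hc1.ne).ge
  have hsa : ∀ n, IsSelfAdjoint (c n) := fun n => hM.isSelfAdjoint_of_char (hc n) fun x => by
    rw [h]; exact Complex.ofReal_im _
  have hnorm : ∀ n : ℕ, ‖c n‖ ≤ 2 * (n : ℝ) ^ 5 := fun n =>
    hM.norm_le_of_char (hc n) (by positivity) fun x => by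
      rcases Nat.eq_zero_or_pos n with rfl | hn
      · simp [h]
      · have : (1 : ℝ) ≤ (n : ℝ) ^ 5 := one_le_pow₀ (by exact_mod_cast hn)
        rw [h, Complex.norm_real, Real.norm_eq_abs, abs_le]
        constructor <;> linarith [Real.neg_one_le_cos (n * θ x), Real.cos_le_one (n * θ x)]
  have hsum1 : Summable fun n => bumpCoeff n * ‖c n‖ :=
    summable_bumpCoeff_mul (c := 2) fun n => by rw [abs_norm]; exact hnorm n
  have hsum : Summable fun n => ((bumpCoeff n : ℝ) : ℂ) • c n := by
    refine Summable.of_norm ((summable_congr fun n => ?_).mpr hsum1.abs)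
    rw [norm_smul, Complex.norm_real, Real.norm_eq_abs, abs_mul, abs_norm]
  have hsum2 : Summable fun n : ℕ => |bumpCoeff n| * ((n : ℝ) ^ 5 * (L (c 1)).toReal) := by
    have := (summable_bumpCoeff_mul (f := fun n : ℕ => (n : ℝ) ^ 5 * (L (c 1)).toReal)
      (c := (L (c 1)).toReal) fun n => by
        rw [abs_of_nonneg (by positivity), mul_comm]).abs
    refine (summable_congr fun n => ?_).mpr this
    rw [abs_mul, abs_of_nonneg (by positivity : 0 ≤ (n : ℝ) ^ 5 * (L (c 1)).toReal)]
  have hgM : ∑' n, ((bumpCoeff n : ℝ) : ℂ) • c n ∈ M :=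
    hM.isClosed.mem_of_tendsto hsum.hasSum.tendsto_sum_nat
      (Eventually.of_forall fun n => sum_mem fun i _ => SMulMemClass.smul_mem _ (hc i))
  have hsa' : ∀ n, IsSelfAdjoint (((bumpCoeff n : ℝ) : ℂ) • c n) := fun n => by
    rw [IsSelfAdjoint, star_smul, (hsa n).star_eq, Complex.star_def, Complex.conj_ofReal]
  have hchar : ∀ x : Spectrum M, HasSum (fun n => bumpCoeff n * (Real.cos (n * θ x) - 1))
      (x ⟨_, hgM⟩).re := by
    intro x
    obtain ⟨φ, -, hφ⟩ := hM.exists_state_extending x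
    have hsumφ := Complex.hasSum_re (hsum.hasSum.mapL (WeakDual.toStrongDual φ))
    have e3 : φ (∑' n, ((bumpCoeff n : ℝ) : ℂ) • c n) = x ⟨_, hgM⟩ := hφ ⟨_, hgM⟩
    refine hasSum_of_eq hsumφ (fun n => ?_) (congrArg Complex.re e3)
    change _ = (φ (((bumpCoeff n : ℝ) : ℂ) • c n)).re
    rw [map_smul, hφ ⟨_, hc n⟩, h, smul_eq_mul, ← Complex.ofReal_mul, Complex.ofReal_re]
  have hgsa : IsSelfAdjoint (∑' n, ((bumpCoeff n : ℝ) : ℂ) • c n) := by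
    rw [IsSelfAdjoint, tsum_star]
    exact tsum_congr fun n => hsa' n
  refine ⟨_, hgM, hgsa, ?_, fun x hx => ?_, fun x hx => ?_⟩
  -- The partial sums have L bounded by the sum of |`bumpCoeff n`|·n⁵·L(c₁), a series of order n⁻³;
  -- lower semi-continuity passes the bound to the limit.
  · refine lt_of_le_of_lt (hP.isLSC.le_of_tendsto hsum.hasSum.tendsto_sum_nat
      (Eventually.of_forall fun n => isSelfAdjoint_sum _ fun i _ => hsa' i)
      (c := ENNReal.ofReal (∑' n : ℕ, |bumpCoeff n| * ((n : ℝ) ^ 5 * (L (c 1)).toReal)))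
      (Eventually.of_forall fun n => ?_)) ENNReal.ofReal_lt_top
    refine (hL.sum_le_ofReal _ (fun i => by positivity)
      fun i => hL.smul_le_ofReal (bumpCoeff i) (hlip i)).trans (ENNReal.ofReal_le_ofReal ?_)
    exact hsum2.sum_le_tsum _ fun i _ => by positivity
  -- A value of w at most 1/2 means an angle at most π/2, that is |y| ≤ 1/4 for y = θ/2π, where the
  -- series vanishes.
  · have hθ2 : θ x ≤ Real.pi / 2 := by
      rw [hθ, Real.arccos_le_pi_div_two]
      linarith
    have hθ0 : 0 ≤ θ x := Real.arccos_nonneg _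
    have hz := hasSum_bumpCoeff_zero (y := θ x / (2 * Real.pi)) (by
      rw [abs_of_nonneg (by positivity), div_le_iff₀ (by positivity)]
      linarith)
    have hz' := hasSum_of_eq (g := fun n => bumpCoeff n * (Real.cos (n * θ x) - 1)) hz (fun n => by
      have : 2 * Real.pi * n * (θ x / (2 * Real.pi)) = n * θ x := by
        field_simp
      rw [this]) rfl
    rw [hM.apply_eq_re hgM hgsa x, (hchar x).unique hz', Complex.ofReal_zero]
  · have hθx : θ x = Real.pi := by
      rw [hθ]
      simp only [hx, Complex.one_re]
      norm_num
    have h2 := (hchar x).tsum_eq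
    rw [hθx] at h2
    intro h0
    rw [h0] at h2
    exact tsum_bumpCoeff_ne_zero h2

end Bump

/-! ### Nonzero Lipschitz elements supported in a small ball -/

section Bump

variable {A : Type u} [NonUnitalCStarAlgebra A] {L : A → ℝ≥0∞} {M : NonUnitalStarSubalgebra ℂ A}

/-- Around each point there is an element of the topography which is one at this point and at most
one fourth off a given neighbourhood. -/
lemma IsTopography.exists_peak (hM : IsTopography M) {x₀ : Spectrum M} {U : Set (Spectrum M)}
    (hU : U ∈ 𝓝 x₀) : ∃ b : A, ∃ hb : b ∈ M, IsSelfAdjoint b ∧ x₀ ⟨b, hb⟩ = 1 ∧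
      ∀ x ∉ U, ‖x ⟨b, hb⟩‖ ≤ 1 / 4 := by
  obtain ⟨e, he⟩ := hM.cutoffs_nonempty (isCompact_singleton (x := x₀))
  obtain ⟨heM, he01, he1⟩ := hM.mem_cutoffs_iff.mp he
  have hge : IsCompact {x : Spectrum M | (1 / 4 : ℝ) ≤ ‖x ⟨e, heM⟩‖} := by
    let _ := hM.commCStar
    exact isCompact_char_ge (⟨e, heM⟩ : M) (by norm_num)
  -- The peak is e(1 − m). Off U, either |e| < 1/4, or the point lies in this compact set, where the
  -- cut-off function m is 1; at the centre e = 1 and m = 0.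
  have hK := hge.diff (isOpen_interior (s := U))
  obtain ⟨m, hm, hmM, hm0⟩ := hM.exists_cutoff_apply_eq_zero hK (x₀ := x₀)
    fun h => h.2 (mem_interior_iff_mem_nhds.mpr hU)
  obtain ⟨_, hm01, hm1⟩ := hM.mem_cutoffs_iff.mp hm
  have hem : e * m ∈ M := mul_mem heM hmM
  have hval : ∀ x : Spectrum M, x ⟨e - e * m, sub_mem heM hem⟩ =
      x ⟨e, heM⟩ - x ⟨e, heM⟩ * x ⟨m, hmM⟩ := fun x => by
    rw [map_mk_sub x heM hem, map_mk_mul x heM hmM]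
  refine ⟨e - e * m, sub_mem heM hem, he.1.isSelfAdjoint.sub ?_, ?_, fun x hx => ?_⟩
  · rw [IsSelfAdjoint, star_mul, he.1.isSelfAdjoint.star_eq, hm.1.isSelfAdjoint.star_eq,
      hM.comm m hmM e heM]
  · rw [hval, hm0, he1 x₀ rfl]
    simp
  · rw [hval]
    by_cases h : (1 / 4 : ℝ) ≤ ‖x ⟨e, heM⟩‖
    · rw [hm1 x ⟨h, fun h' => hx (interior_subset h')⟩]
      norm_num
    · have e1 : x ⟨e, heM⟩ - x ⟨e, heM⟩ * x ⟨m, hmM⟩ = x ⟨e, heM⟩ * (1 - x ⟨m, hmM⟩) := by ring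
      have h1 : (0 : ℂ) ≤ 1 - x ⟨m, hmM⟩ := sub_nonneg.mpr (hm01 x).2
      have h2 : 1 - x ⟨m, hmM⟩ ≤ 1 := sub_le_self _ (hm01 x).1
      rw [Complex.eq_coe_norm_of_nonneg h1] at h2
      have h3 : ‖1 - x ⟨m, hmM⟩‖ ≤ 1 := by exact_mod_cast h2
      rw [e1, norm_mul]
      exact (mul_le_of_le_one_right (norm_nonneg _) h3).trans (not_le.mp h).le

/-- The ball is a neighbourhood of its centre, so it carries a peak function, which a Lipschitz f in
the topography approximates. The normalized square of f is Lipschitz by Leibniz, at most 1/2 off the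
ball, and 1 where |f| is largest; `IsProperQMS.exists_bump` then cuts off its tail. -/
lemma IsProperQMS.exists_ne_zero_mem_Loc (hP : IsProperQMS L M) (x₀ : Spectrum M) {r : ℝ}
    (hr : 0 < r) : ∃ a ∈ Loc L M (spectrumBall L M x₀ r), a ≠ 0 := by
  have hM := hP.isTopography
  have hL := hP.isLipschitzPair
  obtain ⟨b, hb, hbsa, hb1, hb4⟩ :=
    hM.exists_peak (hP.toIsQuantumLCMS.spectrumBall_mem_nhds x₀ hr)
  obtain ⟨f, ⟨⟨K, hK, hfK⟩, hf⟩, hfb⟩ := Metric.mem_closure_iff.mp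
    (hP.locStar_dense_topography b hb hbsa) (1 / 10) (by norm_num)
  have hfsa : IsSelfAdjoint f := hfK.1
  have hclose : ∀ x : Spectrum M, ‖x ⟨b, hb⟩ - x ⟨f, hf⟩‖ ≤ 1 / 10 := fun x => by
    rw [← map_mk_sub x hb hf (sub_mem hb hf)]
    refine (hM.norm_apply_le _ x).trans ?_
    rw [← dist_eq_norm]
    exact hfb.le
  have hf0 : (9 / 10 : ℝ) ≤ ‖f‖ := by
    have h1 := hclose x₀
    have h2 := norm_sub_norm_le (x₀ ⟨b, hb⟩) (x₀ ⟨f, hf⟩)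
    have h3 := hM.norm_apply_le hf x₀
    rw [hb1, norm_one] at h2
    rw [hb1] at h1
    linarith
  have hfpos : 0 < ‖f‖ ^ 2 := by positivity
  have hff : f * f ∈ M := mul_mem hf hf
  have hwM : (((‖f‖ ^ 2)⁻¹ : ℝ) : ℂ) • (f * f) ∈ M := SMulMemClass.smul_mem _ hff
  have hwx : ∀ x : Spectrum M, x ⟨_, hwM⟩ = (((‖f‖ ^ 2)⁻¹ * ‖x ⟨f, hf⟩‖ ^ 2 : ℝ) : ℂ) := fun x => by
    have e1 : x ⟨_, hwM⟩ = (((‖f‖ ^ 2)⁻¹ : ℝ) : ℂ) * x ⟨_, hff⟩ := map_smul x _ (⟨_, hff⟩ : M)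
    rw [e1, map_mk_mul x hf hf hff, hM.apply_eq_re hf hfsa x, Complex.norm_real, Real.norm_eq_abs,
      sq_abs, Complex.ofReal_mul]
    push_cast
    ring
  have hLff : L (f * f) < ⊤ := by
    obtain ⟨c, hc, hfc⟩ := hL.exists_pos_le hfK.2.2
    exact (hP.mul_le_ofReal rfl hfsa hfsa hc.le hc.le (norm_nonneg f) hfc hfc le_rfl le_rfl).trans_lt
      ENNReal.ofReal_lt_top
  obtain ⟨g, hg, hgsa, hLg, hg0, hg1⟩ := hP.exists_bump hwM (fun x => by
      rw [hwx]
      constructor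
      · exact_mod_cast (by positivity : 0 ≤ (‖f‖ ^ 2)⁻¹ * ‖x ⟨f, hf⟩‖ ^ 2)
      · have : (‖f‖ ^ 2)⁻¹ * ‖x ⟨f, hf⟩‖ ^ 2 ≤ 1 := by
          rw [inv_mul_le_iff₀ hfpos, mul_one]
          exact pow_le_pow_left₀ (norm_nonneg _) (hM.norm_apply_le hf x) 2
        exact_mod_cast this) (by
      rw [hL.smul_eq]
      exact ENNReal.mul_lt_top ENNReal.ofReal_lt_top hLff)
  refine ⟨g, (hM.mem_Loc_iff (hP.isCompact_spectrumBall x₀ r)).mpr ⟨hgsa, fun u hu =>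
    hM.cutoff_mul_of_support hu hg fun x hx => hg0 x ?_, hLg⟩, ?_⟩
  -- Off the ball |f| ≤ 1/4 + 1/10 = 7/20, while ‖f‖ ≥ 9/10, so f²/‖f‖² is below 1/2 there.
  · rw [hwx, Complex.ofReal_re, inv_mul_le_iff₀ hfpos]
    have h1 := norm_sub_norm_le (x ⟨f, hf⟩) (x ⟨b, hb⟩)
    rw [norm_sub_rev] at h1
    have h2 := hclose x
    have h3 := hb4 x hx
    have h4 : ‖x ⟨f, hf⟩‖ ≤ 7 / 20 := by linarith
    have h5 := norm_nonneg (x ⟨f, hf⟩)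
    nlinarith
  · obtain ⟨x, hx⟩ : ∃ x : Spectrum M, ‖x ⟨f, hf⟩‖ = ‖f‖ := by
      let _ := hM.commCStar
      refine exists_char_norm_eq (y := (⟨f, hf⟩ : M)) fun h => ?_
      have : f = 0 := congrArg Subtype.val h
      rw [this, norm_zero] at hf0
      norm_num at hf0
    rintro rfl
    refine hg1 x ?_ (map_zero x)
    rw [hwx, hx, inv_mul_cancel₀ hfpos.ne', Complex.ofReal_one]

end Bump

/-! ### Existence of the maximum, and the conclusion -/

lemma PointedProperQMS.compactSpace_of_ball_eq_univ {𝔸 : PointedProperQMS.{u}} {r : ℝ}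
    (h : 𝔸.ball r = univ) : CompactSpace (Spectrum 𝔸.M) :=
  isCompact_univ_iff.mp (h ▸ 𝔸.isCompact_ball r)

lemma PointedProperQMS.ball_eq_univ_of_diam_le {𝔸 : PointedProperQMS.{u}} {r : ℝ}
    (h : 𝔸.diam ≤ ENNReal.ofReal r) : 𝔸.ball r = univ :=
  eq_univ_of_forall fun x => (le_iSup₂ (f := fun x y : Spectrum 𝔸.M =>
    spectrumDist 𝔸.L 𝔸.M x y) x 𝔸.μ).trans h

/-- When the balls do not exhaust the spectra, the largest of the norms of the Lipschitz elements
supported on them exists and is positive. -/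
lemma exists_isGreatest_lipNorms {𝔸 𝔹 : PointedProperQMS.{u}} {r : ℝ} (hr : 0 < r)
    (hA : 𝔸.ball r ≠ univ) (hB : 𝔹.ball r ≠ univ) :
    ∃ D : ℝ, 0 < D ∧ IsGreatest (lipNorms 𝔸 𝔹 r) D := by
  have hcomp : ∀ 𝔼 : PointedProperQMS.{u}, 𝔼.ball r ≠ univ →
      IsCompact ((fun a => ‖a‖) '' {a | a ∈ 𝔼.LocBall r ∧ 𝔼.L a ≤ 1}) := fun 𝔼 h =>
    (𝔼.isProper.toIsQuantumLCMS.isCompact_locUnit 𝔼.isProper.isLSC (𝔼.isCompact_ball r) h).image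
      continuous_norm
  obtain ⟨a, ha, ha0⟩ := 𝔸.isProper.exists_ne_zero_mem_Loc 𝔸.μ hr
  have hM := 𝔸.isProper.isTopography
  have hL := 𝔸.isProper.isLipschitzPair
  obtain ⟨c, hc, hac⟩ := hL.exists_pos_le ha.2.2
  have h1 := hL.smul_le_one hc hac
  have ha' := (hM.mem_Loc_iff (𝔸.isCompact_ball r)).mp ha
  have hmem : ‖((c⁻¹ : ℝ) : ℂ) • a‖ ∈ lipNorms 𝔸 𝔹 r :=
    Or.inl ⟨_, ⟨(hM.mem_Loc_iff (𝔸.isCompact_ball r)).mpr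
      ⟨hL.isSelfAdjoint_of_lt_top _ (h1.trans_lt ENNReal.one_lt_top),
        fun u hu => by rw [mul_smul_comm, ha'.2.1 u hu], h1.trans_lt ENNReal.one_lt_top⟩, h1⟩, rfl⟩
  obtain ⟨D, hD⟩ := ((hcomp 𝔸 hA).union (hcomp 𝔹 hB)).exists_isGreatest ⟨_, hmem⟩
  refine ⟨D, lt_of_lt_of_le ?_ (hD.2 hmem), hD⟩
  rw [norm_smul, Complex.norm_real, norm_inv, Real.norm_of_nonneg hc.le]
  have := norm_pos_iff.mpr ha0
  positivity

end QMS

theorem mainTheorem11 (𝔸 𝔹 : QMS.PointedProperQMS.{u}) (r : ℝ) (hr : 0 < r) :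
    (𝔸.diam ≤ ENNReal.ofReal r → 𝔹.diam ≤ ENNReal.ofReal r →
      ∃ τ : QMS.Passage 𝔸 𝔹, τ.IsTunnel r) ∧
    (ENNReal.ofReal r < 𝔸.diam → ENNReal.ofReal r < 𝔹.diam →
      (𝔸.ball r = Set.univ → CompactSpace (QMS.Spectrum 𝔹.M)) →
      (𝔹.ball r = Set.univ → CompactSpace (QMS.Spectrum 𝔸.M)) →
      ∃ τ : QMS.Passage 𝔸 𝔹, τ.IsTunnel r ∧
        (𝔸.ball r ≠ Set.univ → 𝔹.ball r ≠ Set.univ →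
          ∃ D : ℝ, IsGreatest (QMS.lipNorms 𝔸 𝔹 r) D ∧ τ.extent r ≤ D)) := by
  refine ⟨fun hA hB => ?_, fun _ _ hA hB => ?_⟩
  · exact QMS.exists_isTunnel_of_compactSpace
      (QMS.PointedProperQMS.compactSpace_of_ball_eq_univ
        (QMS.PointedProperQMS.ball_eq_univ_of_diam_le hA))
      (QMS.PointedProperQMS.compactSpace_of_ball_eq_univ
        (QMS.PointedProperQMS.ball_eq_univ_of_diam_le hB)) r
  -- A ball that is the whole spectrum makes that spectrum compact, and by assumption the other one
  -- too; the tunnel with scalar counterparts then applies.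
  · by_cases h : 𝔸.ball r = Set.univ
    · obtain ⟨τ, hτ⟩ := QMS.exists_isTunnel_of_compactSpace
        (QMS.PointedProperQMS.compactSpace_of_ball_eq_univ h) (hA h) r
      exact ⟨τ, hτ, fun h' => (h' h).elim⟩
    by_cases h' : 𝔹.ball r = Set.univ
    · obtain ⟨τ, hτ⟩ := QMS.exists_isTunnel_of_compactSpace (hB h')
        (QMS.PointedProperQMS.compactSpace_of_ball_eq_univ h') r
      exact ⟨τ, hτ, fun _ h'' => (h'' h').elim⟩
    obtain ⟨D, hD0, hD⟩ := QMS.exists_isGreatest_lipNorms hr h h'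
    have hmem := QMS.mem_Adm_prodPassage hD0 (r := r)
      (fun a ha ha1 => hD.2 (Or.inl ⟨a, ⟨ha, ha1⟩, rfl⟩))
      (fun b hb hb1 => hD.2 (Or.inr ⟨b, ⟨hb, hb1⟩, rfl⟩))
    -- The maximum D is itself an admissible number, so the infimum defining the extent is at most
    -- D.
    exact ⟨QMS.prodPassage 𝔸 𝔹 hD0, ⟨D, hmem⟩, fun _ _ => ⟨D, hD,
      csInf_le ⟨0, fun ε hε => hε.1.le⟩ hmem⟩⟩
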